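/- Throughout, $p$ is an odd prime and $A$ is a compact (Hausdorff) noetherian local topological ring with maximal ideal $\mathfrak m$ and finite residue field $\mathbb F$ of characteristic $p$; $W(\mathbb F)$ is the ring of Witt vectors, $W(\mathbb F)\to A$ the unique ring homomorphism lifting the residue map, and $s:\mathbb F\to A$ the resulting Teichmüller section. *Definitions.* A (two-dimensional) pseudo-representation of a group $\Pi$ over $A$ is a pair of maps $t,d:\Pi\to A$ such that $d$ is a homomorphism $\Pi\to A^\ast$, $t(xy)=t(yx)$, $t(1)=2$ and $t(xy)+d(y)t(xy^{-1})=t(x)t(y)$. An *admissible pseudo-deformation* over $A$ is a $4$-tuple $(\Pi,\bar\rho,t,d)$ in which: $\Pi$ is a profinite group such that the maximal pro-$p$ quotient of every open subgroup of $\Pi$ is topologically finitely generated; $\bar\rho:\Pi\to \mathrm{GL}_2(\mathbb F)$ is (the isomorphism class of) a continuous representation which is either absolutely irreducible or the sum of two distinct characters; $(t,d)$ is a continuous pseudo-representation of $\Pi$ over $A$ with $t\equiv \mathrm{tr}\,\bar\rho$ and $d\equiv\det\bar\rho$ modulo $\mathfrak m$; $d(\Pi)\subset s(\mathbb F)$;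 and $A$ is generated by $t(\Pi)$ as a topological $W(\mathbb F)$-algebra. It is *virtually abelian* if for some open subgroup $H$ of $\Pi$ the restriction $(t_{|H},d_{|H})$ factors through an abelian quotient of $H$. The representation $\bar\rho$ is *regular* if there is $g_0\in\Pi$ such that $\bar\rho(g_0)$ is diagonalizable with eigenvalues $\lambda,\mu\in\mathbb F_p^\ast$, $\lambda^2\ne\mu^2$. It is called dihedral if its projective image is a dihedral group of order $2n$ with $n\ge 2$, and large if its projective image is conjugate in $\mathrm{PGL}_2(\mathbb F)$ to $\mathrm{PGL}_2(k)$ or $\mathrm{PSL}_2(k)$ for a subfield $k$ of $\mathbb F$. A *generalized matrix algebra* (GMA) over a commutative ring $A$ is an algebra $R=\begin{pmatrix}A&B\\C&A\end{pmatrix}$ attached to $A$-modules $B$, $C$ and an $A$-bilinear map $m:B\times C\to A$, $m(b,c)=bc$, such that $(bc)b'=(b'c)b$ and $(bc')c=(bc)c'$, with matrix multiplication, trace $a+d$ and determinant $ad-bc$. It is *faithful* if the only $y\in R$ with $\det y=0$ and $\mathrm{tr}(yx)=0$ for all $x\in R$ is $y=0$. A subgroup of $R^\ast$ is a *congruence subgroup*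 if it is closed and contains, for some non-zero ideal $I$ of $A$, all elements of $R^\ast$ of determinant $1$ that are congruent to $1$ modulo $IR$. A pseudo-representation $(t,d)$ of $\Pi$ over $A$ has *congruence-large image* if there are representations $\rho:\Pi\to R^\ast$ with $\mathrm{tr}\,\rho=t$, $\det\rho=d$ and $R$ a faithful GMA over $A$ of finite type as an $A$-module, and if for every such $\rho$ the group $\rho(\Pi)$ is a congruence subgroup of $R^\ast$. **Theorem.** Assume that $A$ is a domain. Let $(\Pi,\bar\rho,t,d)$ be an admissible pseudo-deformation over $A$ such that $\bar\rho$ is regular. Assume moreover: * if $\bar\rho$ is reducible, then $t$ is not the sum of two continuous characters $\Pi\to A^\ast$; * if $\bar\rho$ is dihedral, and $\Pi'$ is the unique subgroup of index $2$ of $\Pi$ such that $\bar\rho(\Pi')$ is abelian, then $t_{|\Pi'}$ is not the sum of two continuous characters $\Pi'\to A^\ast$; * if $\bar\rho$ is neither reducible, nor dihedral, nor large (so that its projective image is isomorphic to $A_4$, $S_4$ or $A_5$), then $(\Pi,\bar\rho,t,d)$ is not virtually abelian. Then there exist a subring $A_0$ of $A$ which, with the induced topology, is a compact noetherian local ring with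 maximal ideal $\mathfrak m\cap A_0$, and an open subgroup $\Pi_0$ of $\Pi$ containing $\ker\bar\rho$, such that * $t(\Pi_0)\subset A_0$ and $d(\Pi_0)\subset A_0^\ast$; * $(\Pi_0,\bar\rho_{|\Pi_0},t_{|\Pi_0},d_{|\Pi_0})$ is an admissible pseudo-deformation over $A_0$, where $\bar\rho_{|\Pi_0}$ is, up to isomorphism over $\mathbb F$, defined over the residue field of $A_0$; and $(t_{|\Pi_0},d_{|\Pi_0})$ has congruence-large image. -/

import Mathlib

open IsLocalRing Topology

universe u v

/-! ### Generalized matrix algebras of type (1,1) -/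

/-- The data `(B, C, m)` of a generalized matrix algebra over a commutative ring `A`. -/
structure GMA (A : Type u) [CommRing A] where
  B : Type u
  C : Type u
  [addCommGroupB : AddCommGroup B]
  [addCommGroupC : AddCommGroup C]
  [moduleB : Module A B]
  [moduleC : Module A C]
  m : B →ₗ[A] C →ₗ[A] A
  assoc_B : ∀ (b b' : B) (c : C), m b c • b' = m b' c • b
  assoc_C : ∀ (b : B) (c c' : C), m b c' • c = m b c • c'

attribute [instance] GMA.addCommGroupB GMA.addCommGroupC GMA.moduleB GMA.moduleC

namespace GMA

variable {A : Type u} [CommRing A]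

/-- The algebra of matrices with diagonal entries `a`, `d` in `A`, upper right entry `b` in `B`
and lower left entry `c` in `C`, written `(a, b, c, d)`. -/
def Alg (R : GMA A) : Type u := A × R.B × R.C × A

namespace Alg

variable {R : GMA A}

instance : AddCommGroup R.Alg := inferInstanceAs (AddCommGroup (A × R.B × R.C × A))

instance : Module A R.Alg := inferInstanceAs (Module A (A × R.B × R.C × A))

def a (x : R.Alg) : A := x.1
def b (x : R.Alg) : R.B := x.2.1
def c (x : R.Alg) : R.C := x.2.2.1
def d (x : R.Alg) : A := x.2.2.2

def mk (a : A) (b : R.B) (c : R.C) (d : A) : R.Alg := (a, b, c, d)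

@[simp] theorem a_mk (a : A) (b : R.B) (c : R.C) (d : A) : (mk a b c d : R.Alg).a = a := rfl
@[simp] theorem b_mk (a : A) (b : R.B) (c : R.C) (d : A) : (mk a b c d : R.Alg).b = b := rfl
@[simp] theorem c_mk (a : A) (b : R.B) (c : R.C) (d : A) : (mk a b c d : R.Alg).c = c := rfl
@[simp] theorem d_mk (a : A) (b : R.B) (c : R.C) (d : A) : (mk a b c d : R.Alg).d = d := rfl

theorem ext' {x y : R.Alg} (ha : x.a = y.a) (hb : x.b = y.b) (hc : x.c = y.c) (hd : x.d = y.d) :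
    x = y :=
  Prod.ext ha (Prod.ext hb (Prod.ext hc hd))

@[simp] theorem a_add (x y : R.Alg) : (x + y).a = x.a + y.a := rfl
@[simp] theorem b_add (x y : R.Alg) : (x + y).b = x.b + y.b := rfl
@[simp] theorem c_add (x y : R.Alg) : (x + y).c = x.c + y.c := rfl
@[simp] theorem d_add (x y : R.Alg) : (x + y).d = x.d + y.d := rfl
@[simp] theorem a_zero : (0 : R.Alg).a = 0 := rfl
@[simp] theorem b_zero : (0 : R.Alg).b = 0 := rfl
@[simp] theorem c_zero : (0 : R.Alg).c = 0 := rfl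
@[simp] theorem d_zero : (0 : R.Alg).d = 0 := rfl
@[simp] theorem a_smul (r : A) (x : R.Alg) : (r • x).a = r * x.a := rfl
@[simp] theorem b_smul (r : A) (x : R.Alg) : (r • x).b = r • x.b := rfl
@[simp] theorem c_smul (r : A) (x : R.Alg) : (r • x).c = r • x.c := rfl
@[simp] theorem d_smul (r : A) (x : R.Alg) : (r • x).d = r * x.d := rfl

/-- Matrix multiplication. -/
instance : Mul R.Alg where
  mul x y := mk (x.a * y.a + R.m x.b y.c) (x.a • y.b + y.d • x.b)
    (y.a • x.c + x.d • y.c) (x.d * y.d + R.m y.b x.c)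

instance : One R.Alg where
  one := mk 1 0 0 1

@[simp] theorem a_mul (x y : R.Alg) : (x * y).a = x.a * y.a + R.m x.b y.c := rfl
@[simp] theorem b_mul (x y : R.Alg) : (x * y).b = x.a • y.b + y.d • x.b := rfl
@[simp] theorem c_mul (x y : R.Alg) : (x * y).c = y.a • x.c + x.d • y.c := rfl
@[simp] theorem d_mul (x y : R.Alg) : (x * y).d = x.d * y.d + R.m y.b x.c := rfl
@[simp] theorem a_one : (1 : R.Alg).a = 1 := rfl
@[simp] theorem b_one : (1 : R.Alg).b = 0 := rfl
@[simp] theorem c_one : (1 : R.Alg).c = 0 := rfl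
@[simp] theorem d_one : (1 : R.Alg).d = 1 := rfl

instance : Ring R.Alg :=
  { (inferInstance : AddCommGroup R.Alg), (inferInstance : Mul R.Alg),
    (inferInstance : One R.Alg) with
    left_distrib := fun x y z => by
      apply ext' <;> simp [mul_add, add_smul, smul_add] <;> abel
    right_distrib := fun x y z => by
      apply ext' <;> simp [add_mul, add_smul, smul_add] <;> abel
    zero_mul := fun x => by apply ext' <;> simp
    mul_zero := fun x => by apply ext' <;> simp
    one_mul := fun x => by apply ext' <;> simp
    mul_one := fun x => by apply ext' <;> simp
    mul_assoc := fun x y z => by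
      apply ext'
      · simp; ring
      · simp [add_smul, R.assoc_B x.b z.b y.c]; module
      · simp [add_smul, R.assoc_C y.b x.c z.c]; module
      · simp; ring }

instance : Algebra A R.Alg :=
  Algebra.ofModule (fun r x y => by apply ext' <;> simp [mul_add, mul_assoc, mul_smul, smul_add]
                                      <;> first | rfl | (rw [smul_comm]))
    (fun r x y => by
      apply ext' <;> simp [mul_add, mul_smul, smul_add, mul_left_comm]
        <;> first | rfl | (rw [smul_comm]))

/-- The trace of a generalized matrix. -/
def tr (x : R.Alg) : A := x.a + x.d

/-- The determinant of a generalized matrix. -/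
def det (x : R.Alg) : A := x.a * x.d - R.m x.b x.c

end Alg

/-- `R` is faithful: the kernel of the pseudo-representation `(tr, det)` of `R` is zero. -/
def IsFaithful (R : GMA A) : Prop :=
  ∀ y : R.Alg, y.det = 0 → (∀ x : R.Alg, (y * x).tr = 0) → y = 0

/-- The subgroup `G` of `Rˣ` is a congruence subgroup: it is closed, for the topology on `Rˣ`
induced by the canonical `A`-module topology of `R`, and for some non-zero ideal `I` of `A` it
contains all the elements of determinant `1` that are congruent to `1` modulo `I R`. -/
def IsCongruenceSubgroup [TopologicalSpace A] (R : GMA A) (G : Subgroup R.Algˣ) : Prop :=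
  IsClosed[(moduleTopology A R.Alg).induced Units.val] (G : Set R.Algˣ) ∧
  ∃ I : Ideal A, I ≠ ⊥ ∧ ∀ g : R.Algˣ, (g : R.Alg).det = 1 →
    (g : R.Alg) - 1 ∈ I • (⊤ : Submodule A R.Alg) → g ∈ G

end GMA

/-! ### Pseudo-representations -/

/-- `(t, d)` is a pseudo-representation of dimension two of the group `G` over `A`. -/
structure IsPseudoRep {G : Type v} [Group G] {A : Type u} [CommRing A] (t d : G → A) : Prop where
  d_hom : ∃ χ : G →* Aˣ, ∀ g, d g = χ g
  t_central : ∀ x y, t (x * y) = t (y * x)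
  t_one : t 1 = 2
  t_mul : ∀ x y, t (x * y) + d y * t (x * y⁻¹) = t x * t y

/-- `t` is the sum of two continuous characters with values in `Aˣ`. -/
def IsSumOfTwoCharacters {G : Type v} [Group G] [TopologicalSpace G] {A : Type u} [CommRing A]
    [TopologicalSpace A] (t : G → A) : Prop :=
  ∃ χ₁ χ₂ : G →* Aˣ, Continuous (fun g => (χ₁ g : A)) ∧ Continuous (fun g => (χ₂ g : A)) ∧
    ∀ g, t g = χ₁ g + χ₂ g

/-- On some open subgroup, `(t, d)` factors through an abelian quotient. -/
def IsVirtuallyAbelian {G : Type v} [Group G] [TopologicalSpace G] {A : Type u}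
    (t d : G → A) : Prop :=
  ∃ H : Subgroup G, IsOpen (H : Set G) ∧ ∃ (N : Subgroup H) (_ : N.Normal),
    (∀ x y : H ⧸ N, x * y = y * x) ∧
    ∃ t' d' : H ⧸ N → A, ∀ h : H, t h = t' (h : H ⧸ N) ∧ d h = d' (h : H ⧸ N)

/-- `(t, d)` has congruence-large image: representations with trace `t` and determinant `d` in
the units of a faithful GMA that is finite as an `A`-module exist, and the image of each of them is
a congruence subgroup. -/
def HasCongruenceLargeImage {G : Type v} [Group G] {A : Type u} [CommRing A]
    [TopologicalSpace A] (t d : G → A) : Prop :=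
  (∃ (R : GMA A) (ρ : G →* R.Algˣ), R.IsFaithful ∧ Module.Finite A R.Alg ∧
    (∀ g, (ρ g : R.Alg).tr = t g) ∧ (∀ g, (ρ g : R.Alg).det = d g)) ∧
  ∀ (R : GMA A) (ρ : G →* R.Algˣ), R.IsFaithful → Module.Finite A R.Alg →
    (∀ g, (ρ g : R.Alg).tr = t g) → (∀ g, (ρ g : R.Alg).det = d g) →
    R.IsCongruenceSubgroup ρ.range

/-! ### The finiteness condition -/

/-- The kernel of the projection of a profinite group `H` to its maximal pro-`p` quotient. -/
def proPKernel (p : ℕ) (H : Type v) [Group H] [TopologicalSpace H] : Subgroup H :=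
  sInf {N : Subgroup H | N.Normal ∧ IsOpen (N : Set H) ∧ ∃ k : ℕ, N.index = p ^ k}

instance proPKernel_normal (p : ℕ) (H : Type v) [Group H] [TopologicalSpace H] :
    (proPKernel p H).Normal where
  conj_mem n hn g := by
    simp only [proPKernel, Subgroup.mem_sInf] at hn ⊢
    intro N hN
    exact hN.1.conj_mem n (hn N hN) g

/-- The maximal pro-`p` quotient of every open subgroup is topologically finitely generated. -/
def SatisfiesPFiniteness (p : ℕ) (G : Type v) [Group G] [TopologicalSpace G] : Prop :=
  ∀ H : Subgroup G, IsOpen (H : Set G) → ∃ S : Set (H ⧸ proPKernel p H), S.Finite ∧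
    Dense ((Subgroup.closure S : Subgroup (H ⧸ proPKernel p H)) : Set (H ⧸ proPKernel p H))

/-! ### Two-dimensional representations over a field -/

section Residual

variable {G : Type v} [Group G] {F : Type u} [Field F]

/-- A two-dimensional representation is reducible: there is a stable line. -/
def IsReducibleRep (ρ : G →* GL (Fin 2) F) : Prop :=
  ∃ w : Fin 2 → F, w ≠ 0 ∧ ∀ g, ∃ c : F, (ρ g : Matrix (Fin 2) (Fin 2) F).mulVec w = c • w

def IsAbsolutelyIrreducibleRep (ρ : G →* GL (Fin 2) F) : Prop :=
  ¬ IsReducibleRep ((Matrix.GeneralLinearGroup.map (algebraMap F (AlgebraicClosure F))).comp ρ)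

/-- The representation is isomorphic to the direct sum of two distinct characters. -/
def IsSumOfDistinctCharacters (ρ : G →* GL (Fin 2) F) : Prop :=
  ∃ χ₁ χ₂ : G →* Fˣ, χ₁ ≠ χ₂ ∧ ∃ P : GL (Fin 2) F, ∀ g,
    ((P * ρ g * P⁻¹ : GL (Fin 2) F) : Matrix (Fin 2) (Fin 2) F) =
      Matrix.diagonal ![(χ₁ g : F), (χ₂ g : F)]

/-- Some `ρ g` is diagonalizable with eigenvalues `x`, `y` in the multiplicative group of the
prime field such that `x ^ 2 ≠ y ^ 2`. -/
def IsRegularRep (ρ : G →* GL (Fin 2) F) : Prop :=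
  ∃ (g : G) (x y : F) (P : GL (Fin 2) F), x ∈ (⊥ : Subfield F) ∧ y ∈ (⊥ : Subfield F) ∧
    x ≠ 0 ∧ y ≠ 0 ∧ x ^ 2 ≠ y ^ 2 ∧
    ((P * ρ g * P⁻¹ : GL (Fin 2) F) : Matrix (Fin 2) (Fin 2) F) = Matrix.diagonal ![x, y]

/-- The image of a representation in `PGL₂`. -/
def projectiveImage (ρ : G →* GL (Fin 2) F) : Subgroup (Matrix.ProjGenLinGroup (Fin 2) F) :=
  (Matrix.ProjGenLinGroup.mk.comp ρ).range

/-- The projective image is a dihedral group of order `2 * n`, for some `n ≥ 2`. -/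
def IsDihedralRep (ρ : G →* GL (Fin 2) F) : Prop :=
  ∃ n : ℕ, 2 ≤ n ∧ Nonempty (projectiveImage ρ ≃* DihedralGroup n)

/-- The projective image is conjugate, in `PGL₂(F)`, to `PGL₂(k)` or to `PSL₂(k)`
for some subfield `k` of `F`. -/
def HasLargeProjectiveImage (ρ : G →* GL (Fin 2) F) : Prop :=
  ∃ (k : Subfield F) (P : Matrix.ProjGenLinGroup (Fin 2) F),
    (projectiveImage ρ).map (MulAut.conj P).toMonoidHom =
      (Matrix.ProjGenLinGroup.mk.comp
        (Matrix.GeneralLinearGroup.map (n := Fin 2) k.subtype)).range ∨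
    (projectiveImage ρ).map (MulAut.conj P).toMonoidHom =
      (Matrix.ProjGenLinGroup.mk.comp ((Matrix.GeneralLinearGroup.map k.subtype).comp
        (Matrix.SpecialLinearGroup.toGL (n := Fin 2)))).range

end Residual

/-! ### Admissible pseudo-deformations -/

/-- `(G, ρbar, t, d)` is an admissible pseudo-deformation over the compact local ring `A`.

In `constant_generated`, `φ` is the structural map of `A` as an algebra over the Witt vectors of
its residue field: it is the only ring homomorphism lifting the residue map, and it is
automatically continuous. The map `x ↦ φ (teichmuller x)` is the multiplicative section of the
residue map. Continuity of `ρbar`, for the discrete topology on the finite target, is openness of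
its kernel. -/
structure IsAdmissible (p : ℕ) [Fact p.Prime] {A : Type u} [CommRing A] [TopologicalSpace A]
    [IsLocalRing A] {G : Type v} [Group G] [TopologicalSpace G]
    (ρbar : G →* GL (Fin 2) (ResidueField A)) (t d : G → A) : Prop where
  isTopologicalRing : IsTopologicalRing A
  compactSpace_ring : CompactSpace A
  t2Space_ring : T2Space A
  finite_residueField : Finite (ResidueField A)
  charP_residueField : CharP (ResidueField A) p
  isTopologicalGroup : IsTopologicalGroup G
  compactSpace_group : CompactSpace G
  t2Space_group : T2Space G
  totallyDisconnectedSpace_group : TotallyDisconnectedSpace G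
  pFiniteness : SatisfiesPFiniteness p G
  continuous_residual : IsOpen (ρbar.ker : Set G)
  multiplicityFree : IsAbsolutelyIrreducibleRep ρbar ∨ IsSumOfDistinctCharacters ρbar
  isPseudoRep : IsPseudoRep t d
  continuous_t : Continuous t
  continuous_d : Continuous d
  residue_t : ∀ g, residue A (t g) = (ρbar g : Matrix (Fin 2) (Fin 2) (ResidueField A)).trace
  residue_d : ∀ g, residue A (d g) = (ρbar g : Matrix (Fin 2) (Fin 2) (ResidueField A)).det
  constant_generated : ∃ φ : WittVector p (ResidueField A) →+* A,
    (∀ x, residue A (φ x) = WittVector.constantCoeff x) ∧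
    (∀ g, ∃ x : ResidueField A, d g = φ (WittVector.teichmuller p x)) ∧
    Dense ((Subring.closure (Set.range φ ∪ Set.range t) : Subring A) : Set A)

/-! Replace a regular element by a limit point `g₀` of its powers `g ^ p ^ k`, so that its
eigenvalues `α`, `β` become Teichmüller lifts of elements of the prime field. In an eigenbasis of
`g₀` the pseudo-representation becomes a representation by generalized matrices, whose diagonal
entries and products `b(g) c(k)` of off-diagonal entries are explicit combinations of values of `t`
(`diagEntry`, `offDiagonal`, `IsPseudoRep.isMatrixEntries`). Everything depends on whether these
products vanish on `H = ker ρbar`.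

Suppose that `r = b(k₁) c(k₂)` is nonzero for some `k₁, k₂ ∈ H`. Take for `Π₀` the preimage of the
cyclic group generated by `ρbar g₀`, which consists of the products of elements of `H` and powers of
`g₀`, and for `A₀` the closed subring generated by `t(Π₀)`. On `H` the determinant is `1` and the
trace is congruent to `2`, so Pink's theory applies (`IsPinkDatum.exists_eq`): the traceless parts
of the image of `H` generate a closed Lie algebra `L`, and the image contains every element of
determinant `1` whose traceless part lies in the closed derived algebra and whose trace is suitably
close to `2`. Conjugation by `g₀` acts on `L` with eigenvalues `1`, `α/β`, `β/α`, which lie in the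
closure of `ℤ` and are residually distinct because `α ^ 2 - β ^ 2` is a unit; hence `L` contains the
upper and lower triangular parts of its elements. The diagonal entries of `L` act on these parts by
brackets and, with the other scalars that stabilize them, fill `A₀`, so the parts are `A₀`-modules
(`IsTorus.smul_plus_mem`). Then `L` contains `r` times every traceless element, its derived algebra
contains `r ^ 3` times every traceless element, and the image contains the congruence subgroup of
level `r ^ 3` (`IsTorus.exists_eq_of_sub_one`). The ring `A₀` is noetherian because the traces
factor through the finitely generated maximal pro-`p` quotient of `H`, which makes `A₀` a quotient
of a power series ring over `ℤ` (`Subring.isNoetherianRing_of_isClosed`).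

Suppose now that all products vanish on `H`. By rank one, all `b` or all `c` vanish on `H`, and then
also on every element that commutes residually with `g₀`; on such elements `t` is a sum of two
characters. This contradicts the hypotheses when `ρbar` is reducible (commutative image), dihedral
(the rotations centralize `g₀`) or exceptional (`t` is virtually abelian). There remains the large
case. Unipotent elements of the image force `H` to act trivially, so that `t` factors through
`ρbar`; a computation with traces of words in two unipotents then gives `p = 0` in `A` and traces in
the prime field on the preimage of `SL₂(𝔽_p)`. There `A₀ = 𝔽_p`, and the image contains every
element of determinant `1`. -/

set_option linter.unusedSectionVars false

/-! ### Algebras with a Cayley-Hamilton identity of degree two -/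

/-- `tr` is the trace of a quadratic algebra: every pair of elements satisfies the polarized
Cayley-Hamilton identity of degree two. -/
structure IsQuadraticTrace {A E : Type*} [CommRing A] [Ring E] [Algebra A E]
    (tr : E →ₗ[A] A) : Prop where
  one : tr 1 = 2
  comm : ∀ x y, tr (x * y) = tr (y * x)
  polar : ∀ x y, x * y + y * x =
    tr x • y + tr y • x + (tr (x * y) - tr x * tr y) • (1 : E)

/-- The traceless part of `x`, where `c` is the inverse of `2`. -/
def tracelessPart {A E : Type*} [CommRing A] [Ring E] [Algebra A E]
    (tr : E →ₗ[A] A) (c : A) : E →ₗ[A] E :=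
  LinearMap.id - (c • tr).smulRight (1 : E)

theorem tracelessPart_apply {A E : Type*} [CommRing A] [Ring E] [Algebra A E]
    (tr : E →ₗ[A] A) (c : A) (x : E) : tracelessPart tr c x = x - (c * tr x) • (1 : E) := rfl

namespace IsQuadraticTrace

variable {A E : Type*} [CommRing A] [Ring E] [Algebra A E] {tr : E →ₗ[A] A}
  (h : IsQuadraticTrace tr)

include h

theorem anticomm {u v : E} (hu : tr u = 0) (hv : tr v = 0) :
    u * v + v * u = tr (u * v) • (1 : E) := by
  rw [h.polar, hu, hv]; module

theorem tr_bracket (u v : E) : tr (u * v - v * u) = 0 := by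
  rw [map_sub, h.comm, sub_self]

/-- The vector triple product formula. Traceless elements anticommute up to scalars, and four such
exchanges leave only multiples of `v` and `w`. -/
theorem bracket_bracket {u v w : E} (hu : tr u = 0) (hv : tr v = 0) (hw : tr w = 0) :
    u * (v * w - w * v) - (v * w - w * v) * u =
      (2 : A) • (tr (u * v) • w - tr (u * w) • v) := by
  have h1 := congrArg (· * w) (h.anticomm hu hv)
  have h2 := congrArg (v * ·) (h.anticomm hu hw)
  have h3 := congrArg (· * v) (h.anticomm hu hw)
  have h4 := congrArg (w * ·) (h.anticomm hu hv)
  simp only [mul_add, add_mul, smul_mul_assoc, mul_smul_comm, one_mul, mul_one, mul_assoc]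
    at h1 h2 h3 h4
  simp only [mul_sub, sub_mul, mul_assoc]
  linear_combination (norm := module) h1 - h2 - h3 + h4

theorem sq (x : E) (c : A) (hc : 2 * c = 1) :
    x * x = tr x • x - (c * (tr x * tr x - tr (x * x))) • (1 : E) := by
  have h1 := congrArg (c • ·) (h.polar x x)
  have h2 : x * x = (2 * c) • (x * x) := by rw [hc, one_smul]
  have h3 : tr x • x = (2 * c) • tr x • x := by rw [hc, one_smul]
  beta_reduce at h1
  linear_combination (norm := module) h1 + h2 - h3

theorem tr_tracelessPart {c : A} (hc : 2 * c = 1) (x : E) : tr (tracelessPart tr c x) = 0 := by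
  rw [tracelessPart_apply, map_sub, map_smul, h.one, smul_eq_mul]
  linear_combination (-tr x) * hc


theorem mul_eq_of_traceless {c : A} (hc : 2 * c = 1) {u v : E} (hu : tr u = 0) (hv : tr v = 0) :
    u * v = (c * tr (u * v)) • (1 : E) + c • (u * v - v * u) := by
  have h1 := congrArg (c • ·) (h.anticomm hu hv)
  have h2 : u * v = (2 * c) • (u * v) := by rw [hc, one_smul]
  beta_reduce at h1
  linear_combination (norm := module) h1 + h2

theorem tr_mul_eq {c : A} (hc : 2 * c = 1) (x y : E) : tr (x * y) =
    2 * (c * tr x) * (c * tr y) + tr (tracelessPart tr c x * tracelessPart tr c y) := by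
  simp only [tracelessPart_apply, mul_sub, sub_mul, smul_mul_assoc, mul_smul_comm, one_mul,
    mul_one, map_sub, map_smul, h.one, smul_eq_mul]
  linear_combination (-2 * tr x * tr y * c) * hc

/-- The group law read on traceless parts: up to the half traces, a product becomes a sum plus half
a bracket. -/
theorem tracelessPart_mul {c : A} (hc : 2 * c = 1) (x y : E) : tracelessPart tr c (x * y) =
    (c * tr x) • tracelessPart tr c y + (c * tr y) • tracelessPart tr c x +
    c • (tracelessPart tr c x * tracelessPart tr c y -
      tracelessPart tr c y * tracelessPart tr c x) := by
  have h1 := h.mul_eq_of_traceless hc (h.tr_tracelessPart hc x) (h.tr_tracelessPart hc y)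
  have h2 := h.tr_mul_eq hc x y
  have h3 : (c * tr (x * y)) • (1 : E) =
      (c * (2 * (c * tr x) * (c * tr y))) • (1 : E) +
      (c * tr (tracelessPart tr c x * tracelessPart tr c y)) • (1 : E) := by
    rw [h2]; module
  have h4 : (c * (2 * (c * tr x) * (c * tr y))) • (1 : E) =
      (c * tr x * (c * tr y)) • (1 : E) := by
    congr 1; linear_combination (c * tr x * (c * tr y)) * hc
  have h5 : x * y = tracelessPart tr c x * tracelessPart tr c y +
      (c * tr x) • tracelessPart tr c y + (c * tr y) • tracelessPart tr c x +
      (c * tr x * (c * tr y)) • (1 : E) := by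
    simp only [tracelessPart_apply, mul_sub, sub_mul, smul_mul_assoc, mul_smul_comm, one_mul,
      mul_one]
    module
  rw [tracelessPart_apply (x := x * y)]
  linear_combination (norm := module) h5 + h1 - h3 - h4

omit h in
theorem tracelessPart_of_traceless (c : A) {u : E} (hu : tr u = 0) : tracelessPart tr c u = u := by
  rw [tracelessPart_apply, hu, mul_zero, zero_smul, sub_zero]

theorem tracelessPart_smul_one {c : A} (hc : 2 * c = 1) (a : A) :
    tracelessPart tr c (a • (1 : E)) = 0 := by
  rw [tracelessPart_apply, map_smul, h.one, smul_eq_mul, ← sub_smul,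
    show a - c * (a * 2) = 0 by linear_combination (-a) * hc, zero_smul]

/-- The hypothesis `x + x⁻¹ = tr x` expresses that `x` has determinant `1`, without a determinant on
`E`. -/
theorem tracelessPart_inv {c : A} (hc : 2 * c = 1) {x : Eˣ}
    (hx : (x : E) + (x⁻¹ : Eˣ) = tr (x : E) • (1 : E)) :
    tracelessPart tr c ((x⁻¹ : Eˣ) : E) = -tracelessPart tr c (x : E) := by
  rw [eq_neg_iff_add_eq_zero, ← map_add, add_comm, hx, h.tracelessPart_smul_one hc]

theorem tr_inv {x : Eˣ} (hx : (x : E) + (x⁻¹ : Eˣ) = tr (x : E) • (1 : E)) :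
    tr ((x⁻¹ : Eˣ) : E) = tr (x : E) := by
  have := congrArg tr hx
  rw [map_add, map_smul, h.one, smul_eq_mul] at this
  linear_combination this

theorem add_inv_mul {x y : Eˣ} (hx : (x : E) + (x⁻¹ : Eˣ) = tr (x : E) • (1 : E))
    (hy : (y : E) + (y⁻¹ : Eˣ) = tr (y : E) • (1 : E)) :
    ((x * y : Eˣ) : E) + ((x * y)⁻¹ : Eˣ) = tr ((x * y : Eˣ) : E) • (1 : E) := by
  have h1 := h.polar x y
  rw [mul_inv_rev, Units.val_mul, Units.val_mul, eq_sub_of_add_eq' hx, eq_sub_of_add_eq' hy]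
  simp only [mul_sub, sub_mul, smul_mul_assoc, mul_smul_comm, one_mul, mul_one]
  linear_combination (norm := module) h1

/-- Since `x y - y x = [u, v] = w`, the commutator is `1 + w (y x)⁻¹`. Besides `w` itself there
remain a multiple of `w` that is small when the trace of `y x` is close to `2`, and brackets with
`w`. -/
theorem tracelessPart_commutator {c : A} (hc : 2 * c = 1) {x y : Eˣ}
    (hx : (x : E) + (x⁻¹ : Eˣ) = tr (x : E) • (1 : E))
    (hy : (y : E) + (y⁻¹ : Eˣ) = tr (y : E) • (1 : E)) {u v w : E}
    (hu : u = tracelessPart tr c (x : E)) (hv : v = tracelessPart tr c (y : E))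
    (hw : w = u * v - v * u) :
    tracelessPart tr c ((x * y * x⁻¹ * y⁻¹ : Eˣ) : E) =
      w + (c * (tr ((y * x : Eˣ) : E) - 2)) • w -
        c • ((c * tr (y : E)) • (w * u - u * w) + (c * tr (x : E)) • (w * v - v * w)) := by
  have hyx := h.add_inv_mul hy hx
  have htw : tr w = 0 := by rw [hw]; exact h.tr_bracket u v
  have h1 : ((x * y * x⁻¹ * y⁻¹ : Eˣ) : E) = 1 + w * (((y * x)⁻¹ : Eˣ) : E) := by
    have h2 : w = ((x * y : Eˣ) : E) - ((y * x : Eˣ) : E) := by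
      rw [hw, hu, hv]
      simp only [tracelessPart_apply, mul_sub, sub_mul, smul_mul_assoc, mul_smul_comm, one_mul,
        mul_one, Units.val_mul]
      module
    rw [h2, sub_mul, ← Units.val_mul, ← Units.val_mul, mul_inv_cancel, Units.val_one,
      mul_inv_rev, ← mul_assoc]
    abel
  have h3 : tracelessPart tr c (1 : E) = 0 := by
    simpa using h.tracelessPart_smul_one hc 1
  rw [h1, map_add, h3, h.tracelessPart_mul hc, htw, tracelessPart_of_traceless c htw,
    h.tracelessPart_inv hc hyx, h.tr_inv hyx, Units.val_mul, h.tracelessPart_mul hc, ← hu, ← hv]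
  have h4 : v * u - u * v = -w := by rw [hw]; abel
  rw [h4]
  simp only [mul_add, add_mul, mul_neg, neg_mul, smul_mul_assoc, mul_smul_comm]
  have h5 : w = (2 * c) • w := by rw [hc, one_smul]
  linear_combination (norm := module) -h5

end IsQuadraticTrace

/-! ### The closed descending central series of a Lie algebra of traceless elements -/

section LieSeries

variable {A E : Type*} [CommRing A] [Ring E] [Algebra A E]
  [TopologicalSpace A] [IsTopologicalRing A] [TopologicalSpace E] [IsTopologicalRing E]
  [ContinuousSMul A E]

/-- The closed additive subgroup generated by the brackets of elements of `L` and `M`. -/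
def closedBracket (L M : AddSubgroup E) : AddSubgroup E :=
  (AddSubgroup.closure {w | ∃ u ∈ L, ∃ v ∈ M, w = u * v - v * u}).topologicalClosure

theorem bracket_mem_closedBracket {L M : AddSubgroup E} {u v : E} (hu : u ∈ L) (hv : v ∈ M) :
    u * v - v * u ∈ closedBracket L M :=
  AddSubgroup.le_topologicalClosure _ (AddSubgroup.subset_closure ⟨u, hu, v, hv, rfl⟩)

theorem closedBracket_le {L M V : AddSubgroup E} (hV : IsClosed (V : Set E))
    (hbr : ∀ u ∈ L, ∀ v ∈ M, u * v - v * u ∈ V) : closedBracket L M ≤ V := by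
  refine AddSubgroup.topologicalClosure_minimal _ ?_ hV
  rw [AddSubgroup.closure_le]
  rintro w ⟨u, hu, v, hv, rfl⟩
  exact hbr u hu v hv

/-- The descending central series of the Lie algebra `L`, with closed terms. -/
def lieSeries (L : AddSubgroup E) : ℕ → AddSubgroup E
  | 0 => L
  | n + 1 => closedBracket L (lieSeries L n)

theorem isClosed_lieSeries {L : AddSubgroup E} (hL : IsClosed (L : Set E)) :
    ∀ n, IsClosed (lieSeries L n : Set E)
  | 0 => hL
  | _ + 1 => AddSubgroup.isClosed_topologicalClosure _

theorem bracket_mem_lieSeries {L : AddSubgroup E} {n : ℕ} {u v : E} (hu : u ∈ L)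
    (hv : v ∈ lieSeries L n) : u * v - v * u ∈ lieSeries L (n + 1) :=
  bracket_mem_closedBracket hu hv

theorem lieSeries_succ_le {L : AddSubgroup E} (hL : IsClosed (L : Set E))
    (hbr : ∀ u ∈ L, ∀ v ∈ L, u * v - v * u ∈ L) :
    ∀ n, lieSeries L (n + 1) ≤ lieSeries L n
  | 0 => closedBracket_le hL hbr
  | n + 1 => closedBracket_le (isClosed_lieSeries hL _) fun _ hu _ hv =>
      bracket_mem_lieSeries hu (lieSeries_succ_le hL hbr n hv)

theorem lieSeries_le {L : AddSubgroup E} (hL : IsClosed (L : Set E))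
    (hbr : ∀ u ∈ L, ∀ v ∈ L, u * v - v * u ∈ L) (n : ℕ) : lieSeries L n ≤ L := by
  induction n with
  | zero => exact le_rfl
  | succ n ih => exact (lieSeries_succ_le hL hbr n).trans ih

/-- The scalars that stabilize an additive subgroup. -/
def scalarStabilizer (A : Type*) {E : Type*} [CommRing A] [Ring E] [Algebra A E]
    (L : AddSubgroup E) : Subring A where
  carrier := {a | ∀ u ∈ L, a • u ∈ L}
  mul_mem' ha hb u hu := by rw [mul_smul]; exact ha _ (hb u hu)
  one_mem' u hu := by rwa [one_smul]
  add_mem' ha hb u hu := by rw [add_smul]; exact L.add_mem (ha u hu) (hb u hu)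
  zero_mem' u hu := by rw [zero_smul]; exact L.zero_mem
  neg_mem' ha u hu := by rw [neg_smul]; exact L.neg_mem (ha u hu)

theorem isClosed_scalarStabilizer {L : AddSubgroup E} (hL : IsClosed (L : Set E)) :
    IsClosed (scalarStabilizer A L : Set A) := by
  have : (scalarStabilizer A L : Set A) = ⋂ u ∈ L, {a | a • u ∈ L} := by
    ext a; simp [scalarStabilizer]
  rw [this]
  refine isClosed_biInter fun u _ => hL.preimage (by fun_prop)

theorem isClosed_comap_smul {V : AddSubgroup E} (hV : IsClosed (V : Set E)) (a : A) :
    IsClosed (V.comap (DistribSMul.toAddMonoidHom E a) : Set E) :=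
  hV.preimage (continuous_const_smul a)

/-- The bracket with a fixed element on the left. -/
def bracketHom (u : E) : E →+ E := AddMonoidHom.mulLeft u - AddMonoidHom.mulRight u

omit [TopologicalSpace E] [IsTopologicalRing E] in
theorem bracketHom_apply (u v : E) : bracketHom u v = u * v - v * u := rfl

theorem isClosed_comap_bracketHom {V : AddSubgroup E} (hV : IsClosed (V : Set E)) (u : E) :
    IsClosed (V.comap (bracketHom u) : Set E) :=
  hV.preimage ((continuous_const.mul continuous_id).sub (continuous_id.mul continuous_const))

theorem smul_mem_lieSeries {L : AddSubgroup E} (hL : IsClosed (L : Set E)) {a : A}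
    (ha : a ∈ scalarStabilizer A L) : ∀ n, ∀ w ∈ lieSeries L n, a • w ∈ lieSeries L n
  | 0 => ha
  | n + 1 => closedBracket_le (V := (lieSeries L (n + 1)).comap (DistribSMul.toAddMonoidHom E a))
      (isClosed_comap_smul (isClosed_lieSeries hL _) a) fun u hu v hv => by
        change a • (u * v - v * u) ∈ lieSeries L (n + 1)
        rw [smul_sub, ← mul_smul_comm, ← smul_mul_assoc]
        exact bracket_mem_lieSeries hu (smul_mem_lieSeries hL ha n v hv)

variable {tr : E →ₗ[A] A} (h : IsQuadraticTrace tr)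
include h

/-- Multiplication by the trace of a product of two elements of `L` moves the terms of the
descending central series one step down, from the second term on. -/
theorem tr_mul_smul_mem_lieSeries {L : AddSubgroup E} (hL : IsClosed (L : Set E))
    (hbr : ∀ u ∈ L, ∀ v ∈ L, u * v - v * u ∈ L) (htr : ∀ u ∈ L, tr u = 0)
    {c : A} (hc : 2 * c = 1) (hcL : c ∈ scalarStabilizer A L) {n : ℕ} (hn : 1 ≤ n)
    {u v w : E} (hu : u ∈ L) (hv : v ∈ L) (hw : w ∈ lieSeries L n) :
    tr (u * v) • w ∈ lieSeries L (n + 1) := by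
  obtain ⟨n, rfl⟩ := Nat.exists_eq_add_of_le' hn
  have hle := lieSeries_le hL hbr
  suffices lieSeries L (n + 1) ≤
      (lieSeries L (n + 2)).comap (DistribSMul.toAddMonoidHom E (tr (u * v))) from this hw
  refine closedBracket_le (isClosed_comap_smul (isClosed_lieSeries hL _) _) fun r hr s hs => ?_
  change tr (u * v) • (r * s - s * r) ∈ lieSeries L (n + 2)
  -- The sum `[r, [u, [v, s]]] + [v, [u, [r, s]]]` lies deep in the series. By the triple product
  -- formula it is twice the element below, the terms in `tr (u * s)` cancelling.
  have key : ∀ u ∈ L, ∀ v ∈ L, ∀ r ∈ L, tr (u * v) • (r * s - s * r) +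
      tr (u * r) • (v * s - s * v) ∈ lieSeries L (n + 2) := by
    intro u hu v hv r hr
    have e1 := h.bracket_bracket (htr u hu) (htr v hv) (htr s (hle n hs))
    have e2 := h.bracket_bracket (htr u hu) (htr s (hle n hs)) (htr r hr)
    have m1 : r * (u * (v * s - s * v) - (v * s - s * v) * u) -
        (u * (v * s - s * v) - (v * s - s * v) * u) * r ∈ lieSeries L (n + 2) :=
      lieSeries_succ_le hL hbr _ (bracket_mem_lieSeries hr (bracket_mem_lieSeries hu
        (bracket_mem_lieSeries hv hs)))
    have m2 : v * (u * (r * s - s * r) - (r * s - s * r) * u) -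
        (u * (r * s - s * r) - (r * s - s * r) * u) * v ∈ lieSeries L (n + 2) :=
      lieSeries_succ_le hL hbr _ (bracket_mem_lieSeries hv (bracket_mem_lieSeries hu
        (bracket_mem_lieSeries hr hs)))
    have e3 : u * (r * s - s * r) - (r * s - s * r) * u =
        -(u * (s * r - r * s) - (s * r - r * s) * u) := by noncomm_ring
    rw [e1] at m1
    rw [e3, e2] at m2
    have m3 := smul_mem_lieSeries hL hcL _ _ (AddSubgroup.add_mem _ m1 m2)
    convert m3 using 1
    have h2 : ∀ x : E, x = (2 * c) • x := fun x => by rw [hc, one_smul]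
    have e4 := h2 (r * s - s * r)
    have e5 := h2 (v * s - s * v)
    simp only [mul_sub, sub_mul, mul_smul_comm, smul_mul_assoc, mul_neg, neg_mul]
      at e4 e5 ⊢
    linear_combination (norm := module) tr (u * v) • e4 + tr (u * r) • e5
  -- The three instances of `key` are the pairwise sums of `tr(uv) [r, s]`, `tr(ur) [v, s]` and
  -- `tr(vr) [u, s]`; this combination isolates twice the first.
  have m := AddSubgroup.sub_mem _ (AddSubgroup.add_mem _ (key u hu v hv r hr) (key v hv r hr u hu))
    (key r hr u hu v hv)
  have m' := smul_mem_lieSeries hL hcL _ _ m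
  convert m' using 1
  rw [h.comm v u, h.comm r u, h.comm r v]
  have e4 : r * s - s * r = (2 * c) • (r * s - s * r) := by rw [hc, one_smul]
  linear_combination (norm := module) tr (u * v) • e4

/-- If `tr (u * v) ∈ m` for all `u` and `v` in `L`, the descending central series of `L`
shrinks `m`-adically. -/
theorem lieSeries_le_pow_smul {L : AddSubgroup E} (hL : IsClosed (L : Set E))
    (hbr : ∀ u ∈ L, ∀ v ∈ L, u * v - v * u ∈ L) (htr : ∀ u ∈ L, tr u = 0)
    (htrc : Continuous tr) {m : Ideal A} (hm : ∀ u ∈ L, ∀ v ∈ L, tr (u * v) ∈ m)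
    (hmA : ∀ k, IsClosed ((m ^ k : Ideal A) : Set A))
    (hmE : ∀ k, IsClosed ((m ^ k • ⊤ : Submodule A E) : Set E)) (k : ℕ) :
    (∀ w ∈ lieSeries L (2 * k), w ∈ (m ^ k • ⊤ : Submodule A E)) ∧
      ∀ u ∈ L, ∀ w ∈ lieSeries L (2 * k), tr (u * w) ∈ m ^ (k + 1) := by
  have hle := lieSeries_le hL hbr
  induction k with
  | zero => exact ⟨fun w _ => by simp, fun u hu w hw => by simpa using hm u hu w hw⟩
  | succ k ih =>
    -- Two terms of the series are treated at a time: `[u, [v, w]] = 2 (tr(uv) w - tr(uw) v)`. One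
    -- power of `m` is gained from `hm` in the first summand and from the second half of the
    -- induction hypothesis in the other.
    have step : ∀ V : AddSubgroup E, IsClosed (V : Set E) →
        (∀ u ∈ L, ∀ v ∈ L, ∀ w ∈ lieSeries L (2 * k),
          (2 : A) • (tr (u * v) • w - tr (u * w) • v) ∈ V) → lieSeries L (2 * (k + 1)) ≤ V := by
      intro V hV hVm
      refine closedBracket_le hV fun u hu w hw => ?_
      revert w
      refine closedBracket_le (V := V.comap (bracketHom u)) (isClosed_comap_bracketHom hV u)
        fun v hv w hw => ?_
      rw [AddSubgroup.mem_comap, bracketHom_apply,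
        h.bracket_bracket (htr u hu) (htr v hv) (htr w (hle _ hw))]
      exact hVm u hu v hv w hw
    refine ⟨step (m ^ (k + 1) • ⊤ : Submodule A E).toAddSubgroup (hmE _)
      fun u hu v hv w hw => ?_, fun u' hu' => ?_⟩
    · refine Submodule.smul_mem (m ^ (k + 1) • ⊤ : Submodule A E) _ (Submodule.sub_mem _ ?_ ?_)
      · rw [pow_succ', Submodule.mul_smul]
        exact Submodule.smul_mem_smul (hm u hu v hv) (ih.1 w hw)
      · exact Submodule.smul_mem_smul (ih.2 u hu w hw) trivial
    · refine step ((m ^ (k + 1 + 1)).toAddSubgroup.comap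
        (tr.toAddMonoidHom.comp (AddMonoidHom.mulLeft u')))
        ((hmA (k + 1 + 1)).preimage (htrc.comp (continuous_const_mul u')))
        fun u hu v hv w hw => ?_
      change tr (u' * ((2 : A) • (tr (u * v) • w - tr (u * w) • v))) ∈ m ^ (k + 1 + 1)
      rw [mul_smul_comm, map_smul, mul_sub, mul_smul_comm, mul_smul_comm, map_sub, map_smul,
        map_smul]
      refine Ideal.mul_mem_left _ _ (Ideal.sub_mem _ ?_ ?_)
      · rw [pow_succ']
        exact Ideal.mul_mem_mul (hm u hu v hv) (ih.2 u' hu' w hw)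
      · rw [pow_succ]
        exact Ideal.mul_mem_mul (ih.2 u hu w hw) (hm u' hu' v hv)

end LieSeries

/-! ### Pink's theorem -/

/-- A closed subring of a compact ring contains the inverses of its elements. -/
theorem mem_of_mul_eq_one {A : Type*} [CommRing A] [TopologicalSpace A] [IsTopologicalRing A]
    [CompactSpace A] [T2Space A] {S : Subring A} (hS : IsClosed (S : Set A)) {a b : A}
    (ha : a ∈ S) (hab : a * b = 1) : b ∈ S := by
  let x : Aˣ := ⟨a, b, hab, by rw [mul_comm, hab]⟩
  -- In the compact group of units, `x⁻¹` is a cluster point of the positive powers of `x`.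
  have h1 := (mapClusterPt_self_zpow_atTop_pow x (-1)).continuousAt_comp
    (f := Units.val) Units.continuous_val.continuousAt
  have h2 : ((x ^ (-1 : ℤ) : Aˣ) : A) = b := by simp [x]
  rw [h2] at h1
  refine hS.mem_of_mapClusterPt (f := fun n => ((x ^ n : Aˣ) : A)) h1 (Filter.Eventually.of_forall fun n => ?_)
  simpa [x] using S.pow_mem ha n

/-- A group acting through units of trace close to `2` and determinant `1` of a compact
quadratic algebra over a local ring. -/
structure IsPinkDatum {A E G : Type*} [CommRing A] [IsLocalRing A] [TopologicalSpace A]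
    [Ring E] [Algebra A E] [TopologicalSpace E] [Group G] [TopologicalSpace G]
    (tr : E →ₗ[A] A) (c : A) (ρ : G →* Eˣ) (H : Subgroup G) : Prop where
  quadratic : IsQuadraticTrace tr
  two_mul : 2 * c = 1
  continuous_tr : Continuous tr
  continuous_rho : Continuous fun g => (ρ g : E)
  isClosed : IsClosed (H : Set G)
  add_inv : ∀ g ∈ H, (ρ g : E) + ((ρ g)⁻¹ : Eˣ) = tr (ρ g : E) • (1 : E)
  tr_sub_two : ∀ g ∈ H, tr (ρ g : E) - 2 ∈ maximalIdeal A

/-- The closed additive group generated by the traceless parts of the elements of `ρ H`. -/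
def pinkAlgebra {A E G : Type*} [CommRing A] [Ring E] [Algebra A E] [TopologicalSpace E]
    [IsTopologicalRing E] [Group G] (tr : E →ₗ[A] A) (c : A) (ρ : G →* Eˣ) (H : Subgroup G) :
    AddSubgroup E :=
  (AddSubgroup.closure ((fun g => tracelessPart tr c (ρ g : E)) '' H)).topologicalClosure

namespace IsPinkDatum

variable {A E G : Type*} [CommRing A] [IsLocalRing A] [IsNoetherianRing A] [TopologicalSpace A]
  [IsTopologicalRing A] [CompactSpace A] [T2Space A]
  [Ring E] [Algebra A E] [Module.Finite A E] [TopologicalSpace E] [IsTopologicalRing E]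
  [ContinuousSMul A E] [T2Space E]
  [Group G] [TopologicalSpace G] [IsTopologicalGroup G] [CompactSpace G]
  {tr : E →ₗ[A] A} {c : A} {ρ : G →* Eˣ} {H : Subgroup G} (D : IsPinkDatum tr c ρ H)

theorem isClosed_pinkAlgebra : IsClosed (pinkAlgebra tr c ρ H : Set E) :=
  AddSubgroup.isClosed_topologicalClosure _

theorem mem_pinkAlgebra {g : G} (hg : g ∈ H) :
    tracelessPart tr c (ρ g : E) ∈ pinkAlgebra tr c ρ H :=
  AddSubgroup.le_topologicalClosure _ (AddSubgroup.subset_closure ⟨g, hg, rfl⟩)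

theorem pinkAlgebra_le {V : AddSubgroup E} (hV : IsClosed (V : Set E))
    (hg : ∀ g ∈ H, tracelessPart tr c (ρ g : E) ∈ V) : pinkAlgebra tr c ρ H ≤ V := by
  refine AddSubgroup.topologicalClosure_minimal _ ?_ hV
  rw [AddSubgroup.closure_le]
  rintro _ ⟨g, h, rfl⟩
  exact hg g h

include D

theorem continuous_theta : Continuous (tracelessPart tr c : E → E) := by
  have := D.continuous_tr
  change Continuous fun x => x - (c * tr x) • (1 : E)
  fun_prop

theorem tr_eq_zero : ∀ u ∈ pinkAlgebra tr c ρ H, tr u = 0 := by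
  have := pinkAlgebra_le (H := H) (ρ := ρ) (c := c) (V := (LinearMap.ker tr).toAddSubgroup)
    (isClosed_singleton.preimage D.continuous_tr)
    fun g _ => D.quadratic.tr_tracelessPart D.two_mul _
  exact this

theorem mem_scalarStabilizer_half : c ∈ scalarStabilizer A (pinkAlgebra tr c ρ H) :=
  mem_of_mul_eq_one (isClosed_scalarStabilizer isClosed_pinkAlgebra)
    (ofNat_mem _ 2) D.two_mul

theorem theta_mul (x y : G) : tracelessPart tr c (ρ (x * y) : E) =
    (c * tr (ρ x : E)) • tracelessPart tr c (ρ y : E) +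
      (c * tr (ρ y : E)) • tracelessPart tr c (ρ x : E) +
    c • (tracelessPart tr c (ρ x : E) * tracelessPart tr c (ρ y : E) -
      tracelessPart tr c (ρ y : E) * tracelessPart tr c (ρ x : E)) := by
  rw [map_mul, Units.val_mul, D.quadratic.tracelessPart_mul D.two_mul]

theorem theta_inv {x : G} (hx : x ∈ H) : tracelessPart tr c (ρ x⁻¹ : E) =
    -tracelessPart tr c (ρ x : E) := by
  rw [map_inv, D.quadratic.tracelessPart_inv D.two_mul (D.add_inv x hx)]

/-- On generators `[θ y, θ x] = θ (y x) - θ (x y)`; the rest is additivity and continuity. -/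
theorem bracket_mem : ∀ u ∈ pinkAlgebra tr c ρ H, ∀ v ∈ pinkAlgebra tr c ρ H,
    u * v - v * u ∈ pinkAlgebra tr c ρ H := by
  intro u hu
  refine pinkAlgebra_le (V := (pinkAlgebra tr c ρ H).comap (bracketHom u))
    (isClosed_comap_bracketHom isClosed_pinkAlgebra u) fun y hy => ?_
  suffices h : pinkAlgebra tr c ρ H ≤ (pinkAlgebra tr c ρ H).comap
      (bracketHom (tracelessPart tr c (ρ y : E))) by
    have h1 := AddSubgroup.neg_mem _ (AddSubgroup.mem_comap.mp (h hu))
    rw [bracketHom_apply, neg_sub] at h1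
    exact h1
  refine pinkAlgebra_le (isClosed_comap_bracketHom isClosed_pinkAlgebra _) fun x hx => ?_
  rw [AddSubgroup.mem_comap, bracketHom_apply]
  have h1 := AddSubgroup.sub_mem _
    (mem_pinkAlgebra (tr := tr) (c := c) (ρ := ρ) (H.mul_mem hy hx))
    (mem_pinkAlgebra (tr := tr) (c := c) (ρ := ρ) (H.mul_mem hx hy))
  rw [D.theta_mul, D.theta_mul] at h1
  convert h1 using 1
  have h2 : ∀ x : E, x = (2 * c) • x := fun x => by rw [D.two_mul, one_smul]
  linear_combination (norm := module) h2 (tracelessPart tr c (ρ y : E) * tracelessPart tr c (ρ x : E)) - h2 (tracelessPart tr c (ρ x : E) * tracelessPart tr c (ρ y : E))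

/-- On determinant one elements, `θ (x y) - θ (x⁻¹ y) = tr y • θ x + [θ x, θ y]`. -/
theorem tr_mem_scalarStabilizer {y : G} (hy : y ∈ H) :
    tr (ρ y : E) ∈ scalarStabilizer A (pinkAlgebra tr c ρ H) := by
  refine pinkAlgebra_le (V := (pinkAlgebra tr c ρ H).comap
    (DistribSMul.toAddMonoidHom E (tr (ρ y : E)))) (isClosed_comap_smul isClosed_pinkAlgebra _)
    fun x hx => ?_
  change tr (ρ y : E) • tracelessPart tr c (ρ x : E) ∈ pinkAlgebra tr c ρ H
  have h1 := AddSubgroup.sub_mem _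
    (mem_pinkAlgebra (tr := tr) (c := c) (ρ := ρ) (H.mul_mem hx hy))
    (mem_pinkAlgebra (tr := tr) (c := c) (ρ := ρ) (H.mul_mem (H.inv_mem hx) hy))
  have h2 := D.bracket_mem _ (mem_pinkAlgebra hx) _ (mem_pinkAlgebra hy)
  rw [D.theta_mul, D.theta_mul, D.theta_inv hx, map_inv,
    D.quadratic.tr_inv (D.add_inv x hx)] at h1
  have h3 := AddSubgroup.sub_mem _ h1 h2
  convert h3 using 1
  have h2 : ∀ x : E, x = (2 * c) • x := fun x => by rw [D.two_mul, one_smul]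
  simp only [mul_neg, neg_mul]
  linear_combination (norm := module) tr (ρ y : E) • h2 (tracelessPart tr c (ρ x : E)) - h2 (tracelessPart tr c (ρ y : E) * tracelessPart tr c (ρ x : E)) + h2 (tracelessPart tr c (ρ x : E) * tracelessPart tr c (ρ y : E))

/-- Since `tr (θ x * θ y) = tr (x y) - tr x tr y / 2`, traces of products in the Lie algebra are
controlled by traces of group elements. -/
theorem tr_mul_mem_of {V : AddSubgroup A} (hV : IsClosed (V : Set A))
    (hxy : ∀ x ∈ H, ∀ y ∈ H,
      tr (ρ (x * y) : E) - 2 * (c * tr (ρ x : E)) * (c * tr (ρ y : E)) ∈ V) :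
    ∀ u ∈ pinkAlgebra tr c ρ H, ∀ v ∈ pinkAlgebra tr c ρ H, tr (u * v) ∈ V := by
  intro u hu
  have hcl : ∀ w : E, IsClosed (V.comap (tr.toAddMonoidHom.comp (AddMonoidHom.mulLeft w)) : Set E) :=
    fun w => hV.preimage (D.continuous_tr.comp (continuous_const_mul w))
  refine pinkAlgebra_le (hcl u) fun y hy => ?_
  change tr (u * tracelessPart tr c (ρ y : E)) ∈ V
  rw [D.quadratic.comm]
  revert u
  refine pinkAlgebra_le (hcl (tracelessPart tr c (ρ y : E))) fun x hx => ?_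
  change tr (tracelessPart tr c (ρ y : E) * tracelessPart tr c (ρ x : E)) ∈ V
  have := hxy y hy x hx
  rw [map_mul, Units.val_mul, D.quadratic.tr_mul_eq D.two_mul] at this
  simpa using this

theorem tr_mul_mem_scalarStabilizer : ∀ u ∈ pinkAlgebra tr c ρ H,
    ∀ v ∈ pinkAlgebra tr c ρ H, tr (u * v) ∈ scalarStabilizer A (pinkAlgebra tr c ρ H) := by
  refine D.tr_mul_mem_of (V := (scalarStabilizer A (pinkAlgebra tr c ρ H)).toAddSubgroup)
    (isClosed_scalarStabilizer isClosed_pinkAlgebra) fun x hx y hy => ?_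
  have hc := D.mem_scalarStabilizer_half
  exact Subring.sub_mem _ (D.tr_mem_scalarStabilizer (H.mul_mem hx hy)) (Subring.mul_mem _
    (Subring.mul_mem _ (ofNat_mem _ 2) (Subring.mul_mem _ hc (D.tr_mem_scalarStabilizer hx)))
    (Subring.mul_mem _ hc (D.tr_mem_scalarStabilizer hy)))

theorem tr_mul_mem_maximalIdeal : ∀ u ∈ pinkAlgebra tr c ρ H,
    ∀ v ∈ pinkAlgebra tr c ρ H, tr (u * v) ∈ maximalIdeal A := by
  refine D.tr_mul_mem_of (V := (maximalIdeal A).toAddSubgroup)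
    (IsNoetherianRing.isClosed_ideal _) fun x hx y hy => ?_
  have h1 := D.tr_sub_two _ (H.mul_mem hx hy)
  have h2 := (maximalIdeal A).mul_mem_left (-c * tr (ρ y : E)) (D.tr_sub_two _ hx)
  have h3 := (maximalIdeal A).mul_mem_left (-c * 2) (D.tr_sub_two _ hy)
  have h4 := (maximalIdeal A).add_mem h1 ((maximalIdeal A).add_mem h2 h3)
  change _ ∈ maximalIdeal A
  convert h4 using 2
  linear_combination (-c * tr (ρ x : E) * tr (ρ y : E) - 2) * D.two_mul

omit D in
/-- The scalars in the maximal ideal that move each term of the descending central series of the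
Lie algebra one step down, except perhaps the first one, which they stabilize. -/
def _root_.lowering (L : AddSubgroup E) : Set A :=
  {a | a ∈ maximalIdeal A ∧ a ∈ scalarStabilizer A L ∧
    ∀ n, 1 ≤ n → ∀ w ∈ lieSeries L n, a • w ∈ lieSeries L (n + 1)}

omit D in
theorem _root_.lowering_add {L : AddSubgroup E} {a b : A} (ha : a ∈ lowering L)
    (hb : b ∈ lowering L) : a + b ∈ lowering L :=
  ⟨Ideal.add_mem _ ha.1 hb.1, Subring.add_mem _ ha.2.1 hb.2.1, fun n hn w hw => by
    rw [add_smul]; exact AddSubgroup.add_mem _ (ha.2.2 n hn w hw) (hb.2.2 n hn w hw)⟩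

omit D in
theorem _root_.lowering_mul {L : AddSubgroup E} (hL : IsClosed (L : Set E)) {a b : A}
    (ha : a ∈ scalarStabilizer A L) (hb : b ∈ lowering L) : a * b ∈ lowering L :=
  ⟨Ideal.mul_mem_left _ _ hb.1, Subring.mul_mem _ ha hb.2.1, fun n hn w hw => by
    rw [mul_smul]; exact smul_mem_lieSeries hL ha _ _ (hb.2.2 n hn w hw)⟩

theorem tr_mul_mem_lowering {u v : E} (hu : u ∈ pinkAlgebra tr c ρ H)
    (hv : v ∈ pinkAlgebra tr c ρ H) :
    tr (u * v) ∈ (lowering (pinkAlgebra tr c ρ H) : Set A) :=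
  ⟨D.tr_mul_mem_maximalIdeal u hu v hv, D.tr_mul_mem_scalarStabilizer u hu v hv,
    fun _ hn _ hw => tr_mul_smul_mem_lieSeries D.quadratic isClosed_pinkAlgebra D.bracket_mem
      D.tr_eq_zero D.two_mul D.mem_scalarStabilizer_half hn hu hv hw⟩

theorem isUnit_two_add {a : A} (ha : a ∈ maximalIdeal A) : IsUnit (2 + a) := by
  by_contra hn
  have h1 : 2 + a ∈ maximalIdeal A := hn
  have h2 := (maximalIdeal A).mul_mem_left c ((maximalIdeal A).sub_mem h1 ha)
  rw [add_sub_cancel_right, mul_comm, D.two_mul] at h2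
  exact (Ideal.ne_top_iff_one _).mp (maximalIdeal.isMaximal A).ne_top h2

/-- By Cayley-Hamilton, `(t - 2) (t + 2) = 2 tr (θ x * θ x)`, and the right-hand side is lowering.
The factor `t + 2` is a unit, and its inverse lies in the closed ring of stabilizing scalars. -/
theorem tr_sub_two_mem_lowering {x : G} (hx : x ∈ H) :
    tr (ρ x : E) - 2 ∈ (lowering (pinkAlgebra tr c ρ H) : Set A) := by
  have hm := D.tr_sub_two x hx
  set t := tr (ρ x : E) with ht
  have h1 : t * t - 4 = 2 * tr (tracelessPart tr c (ρ x : E) * tracelessPart tr c (ρ x : E)) := by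
    have h2 := D.quadratic.tr_mul_eq D.two_mul (ρ x : E) (ρ x : E)
    have h3 := congrArg (fun z => tr ((ρ x : E) * z)) (D.add_inv x hx)
    simp only [mul_add, Units.mul_inv, map_add, mul_smul_comm, mul_one, map_smul,
      D.quadratic.one, smul_eq_mul, ← ht] at h2 h3
    linear_combination 2 * h2 - 2 * h3 + (2 * t * t * c + t * t) * D.two_mul
  have h4 : IsUnit (t + 2) := by
    have h5 : t + 2 = 2 * (2 + c * (t - 2)) := by linear_combination (2 - t) * D.two_mul
    rw [h5]
    exact (IsUnit.of_mul_eq_one _ D.two_mul).mul (D.isUnit_two_add (Ideal.mul_mem_left _ _ hm))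
  obtain ⟨b, hb⟩ := h4.exists_right_inv
  have hbm : b ∈ scalarStabilizer A (pinkAlgebra tr c ρ H) :=
    mem_of_mul_eq_one (isClosed_scalarStabilizer isClosed_pinkAlgebra)
      (Subring.add_mem _ (D.tr_mem_scalarStabilizer hx) (ofNat_mem _ 2)) hb
  have h6 := lowering_mul isClosed_pinkAlgebra (Subring.mul_mem _ (ofNat_mem _ 2) hbm)
    (D.tr_mul_mem_lowering (mem_pinkAlgebra hx) (mem_pinkAlgebra hx))
  convert h6 using 1
  linear_combination (2 - t) * hb + b * h1

end IsPinkDatum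

/-- The units `x` of determinant `1` with traceless part in the `n`-th term of the descending
central series of `L` and with `tr x - 2` lowering. -/
structure IsInLayer {A E : Type*} [CommRing A] [IsLocalRing A] [Ring E] [Algebra A E]
    [TopologicalSpace E] [IsTopologicalRing E] (tr : E →ₗ[A] A) (c : A) (L : AddSubgroup E)
    (n : ℕ) (x : Eˣ) : Prop where
  add_inv : (x : E) + (x⁻¹ : Eˣ) = tr (x : E) • (1 : E)
  theta_mem : tracelessPart tr c (x : E) ∈ lieSeries L n
  tr_mem : tr (x : E) - 2 ∈ (lowering L : Set A)

namespace IsPinkDatum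

variable {A E G : Type*} [CommRing A] [IsLocalRing A] [IsNoetherianRing A] [TopologicalSpace A]
  [IsTopologicalRing A] [CompactSpace A] [T2Space A]
  [Ring E] [Algebra A E] [Module.Finite A E] [TopologicalSpace E] [IsTopologicalRing E]
  [ContinuousSMul A E] [T2Space E]
  [Group G] [TopologicalSpace G] [IsTopologicalGroup G] [CompactSpace G]
  {tr : E →ₗ[A] A} {c : A} {ρ : G →* Eˣ} {H : Subgroup G} (D : IsPinkDatum tr c ρ H)

local notation "𝓛" => pinkAlgebra tr c ρ H
local notation "θ" => tracelessPart tr c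

include D

theorem half_tr_sub_one (x : E) : c * tr x - 1 = c * (tr x - 2) := by
  linear_combination D.two_mul

theorem half_tr_mem {x : E} (hx : tr x - 2 ∈ (lowering 𝓛 : Set A)) :
    c * tr x - 1 ∈ (lowering 𝓛 : Set A) := by
  rw [D.half_tr_sub_one]
  exact lowering_mul isClosed_pinkAlgebra D.mem_scalarStabilizer_half hx

theorem half_tr_mem_scalarStabilizer {x : E} (hx : tr x - 2 ∈ (lowering 𝓛 : Set A)) :
    c * tr x ∈ scalarStabilizer A 𝓛 := by
  simpa using Subring.add_mem _ (D.half_tr_mem hx).2.1 (one_mem _)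

theorem lieSeries_le' (n : ℕ) : lieSeries 𝓛 n ≤ 𝓛 :=
  lieSeries_le isClosed_pinkAlgebra D.bracket_mem n

theorem lieSeries_succ_le' (n : ℕ) : lieSeries 𝓛 (n + 1) ≤ lieSeries 𝓛 n :=
  lieSeries_succ_le isClosed_pinkAlgebra D.bracket_mem n

theorem smul_mem' {a : A} (ha : a ∈ scalarStabilizer A 𝓛) {n : ℕ} {w : E}
    (hw : w ∈ lieSeries 𝓛 n) : a • w ∈ lieSeries 𝓛 n :=
  smul_mem_lieSeries isClosed_pinkAlgebra ha n w hw

theorem isInLayer_zero {g : G} (hg : g ∈ H) : IsInLayer tr c 𝓛 0 (ρ g) :=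
  ⟨D.add_inv g hg, mem_pinkAlgebra hg, D.tr_sub_two_mem_lowering hg⟩

theorem isInLayer_le {n : ℕ} {x : Eˣ} (hx : IsInLayer tr c 𝓛 n x) : IsInLayer tr c 𝓛 0 x :=
  ⟨hx.add_inv, D.lieSeries_le' n hx.theta_mem, hx.tr_mem⟩

theorem isInLayer_mul {n : ℕ} {x y : Eˣ} (hx : IsInLayer tr c 𝓛 n x)
    (hy : IsInLayer tr c 𝓛 n y) : IsInLayer tr c 𝓛 n (x * y) where
  add_inv := D.quadratic.add_inv_mul hx.add_inv hy.add_inv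
  theta_mem := by
    rw [Units.val_mul, D.quadratic.tracelessPart_mul D.two_mul]
    refine AddSubgroup.add_mem _ (AddSubgroup.add_mem _ ?_ ?_) ?_
    · exact D.smul_mem' (D.half_tr_mem_scalarStabilizer hx.tr_mem) hy.theta_mem
    · exact D.smul_mem' (D.half_tr_mem_scalarStabilizer hy.tr_mem) hx.theta_mem
    · exact D.smul_mem' D.mem_scalarStabilizer_half (D.lieSeries_succ_le' n
        (bracket_mem_lieSeries (D.lieSeries_le' n hx.theta_mem) hy.theta_mem))
  tr_mem := by
    rw [Units.val_mul, D.quadratic.tr_mul_eq D.two_mul]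
    have h1 := lowering_mul isClosed_pinkAlgebra
      (Subring.mul_mem _ D.mem_scalarStabilizer_half hx.tr_mem.2.1) hy.tr_mem
    have h2 := lowering_add h1 (lowering_add (lowering_add hx.tr_mem hy.tr_mem)
      (D.tr_mul_mem_lowering (D.lieSeries_le' n hx.theta_mem) (D.lieSeries_le' n hy.theta_mem)))
    convert h2 using 1
    linear_combination (c * tr (x : E) * tr (y : E) - 2 + tr (x : E) + tr (y : E)) * D.two_mul

theorem isInLayer_inv {n : ℕ} {x : Eˣ} (hx : IsInLayer tr c 𝓛 n x) :
    IsInLayer tr c 𝓛 n x⁻¹ where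
  add_inv := by rw [inv_inv, D.quadratic.tr_inv hx.add_inv, add_comm, hx.add_inv]
  theta_mem := by
    rw [D.quadratic.tracelessPart_inv D.two_mul hx.add_inv]
    exact AddSubgroup.neg_mem _ hx.theta_mem
  tr_mem := by rw [D.quadratic.tr_inv hx.add_inv]; exact hx.tr_mem

/-- From the layer `n = 1` on, the traceless part induces a homomorphism to the graded quotient. The
layer `0` is excluded because lowering scalars are only known to stabilize the first term. -/
theorem theta_mul_sub_mem {n : ℕ} (hn : 1 ≤ n) {x y : Eˣ} (hx : IsInLayer tr c 𝓛 n x)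
    (hy : IsInLayer tr c 𝓛 n y) :
    θ ((x * y : Eˣ) : E) - (θ (x : E) + θ (y : E)) ∈ lieSeries 𝓛 (n + 1) := by
  have h1 := (D.half_tr_mem hx.tr_mem).2.2 n hn _ hy.theta_mem
  have h2 := (D.half_tr_mem hy.tr_mem).2.2 n hn _ hx.theta_mem
  have h3 := D.smul_mem' D.mem_scalarStabilizer_half
    (bracket_mem_lieSeries (D.lieSeries_le' n hx.theta_mem) hy.theta_mem)
  have h4 := AddSubgroup.add_mem _ (AddSubgroup.add_mem _ h1 h2) h3
  rw [Units.val_mul, D.quadratic.tracelessPart_mul D.two_mul]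
  convert h4 using 1
  module

/-- Group commutators induce Lie brackets on the graded quotients. -/
theorem commutator_mem {n : ℕ} {x y : Eˣ} (hx : IsInLayer tr c 𝓛 0 x)
    (hy : IsInLayer tr c 𝓛 n y) :
    IsInLayer tr c 𝓛 (n + 1) (x * y * x⁻¹ * y⁻¹) ∧
      θ ((x * y * x⁻¹ * y⁻¹ : Eˣ) : E) - (θ (x : E) * θ (y : E) - θ (y : E) * θ (x : E)) ∈
        lieSeries 𝓛 (n + 2) := by
  have hy0 := D.isInLayer_le hy
  have h0 := D.isInLayer_mul (D.isInLayer_mul (D.isInLayer_mul hx hy0) (D.isInLayer_inv hx))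
    (D.isInLayer_inv hy0)
  have hw : θ (x : E) * θ (y : E) - θ (y : E) * θ (x : E) ∈ lieSeries 𝓛 (n + 1) :=
    bracket_mem_lieSeries hx.theta_mem hy.theta_mem
  have h1 := D.quadratic.tracelessPart_commutator D.two_mul hx.add_inv hy.add_inv rfl rfl rfl
  set w := θ (x : E) * θ (y : E) - θ (y : E) * θ (x : E)
  have h2 : ∀ z : E, z ∈ 𝓛 → w * z - z * w ∈ lieSeries 𝓛 (n + 2) := fun z hz => by
    rw [← neg_sub]; exact AddSubgroup.neg_mem _ (bracket_mem_lieSeries hz hw)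
  have h3 : θ ((x * y * x⁻¹ * y⁻¹ : Eˣ) : E) - w ∈ lieSeries 𝓛 (n + 2) := by
    rw [h1, add_sub_assoc, add_sub_cancel_left]
    refine AddSubgroup.sub_mem _ ?_ (D.smul_mem' D.mem_scalarStabilizer_half
      (AddSubgroup.add_mem _ ?_ ?_))
    · exact (lowering_mul isClosed_pinkAlgebra D.mem_scalarStabilizer_half
        (D.isInLayer_mul hy0 hx).tr_mem).2.2 _ (by omega) _ hw
    · exact D.smul_mem' (D.half_tr_mem_scalarStabilizer hy.tr_mem) (h2 _ hx.theta_mem)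
    · exact D.smul_mem' (D.half_tr_mem_scalarStabilizer hx.tr_mem) (h2 _ hy0.theta_mem)
  refine ⟨⟨h0.add_inv, ?_, h0.tr_mem⟩, h3⟩
  have := AddSubgroup.add_mem _ (D.lieSeries_succ_le' _ h3) hw
  rwa [sub_add_cancel] at this

/-- The traceless parts of the elements of `H` in the `n`-th layer generate the `n`-th term of the
descending central series modulo the next one. -/
theorem lieSeries_le_of (n : ℕ) : ∀ V : AddSubgroup E, IsClosed (V : Set E) →
    lieSeries 𝓛 (n + 1) ≤ V → (∀ g ∈ H, IsInLayer tr c 𝓛 n (ρ g) → θ (ρ g : E) ∈ V) →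
    lieSeries 𝓛 n ≤ V := by
  induction n with
  | zero => exact fun V hV _ hg => pinkAlgebra_le hV fun g h => hg g h (D.isInLayer_zero h)
  | succ n ih =>
    intro V hV hle hg
    -- For fixed `x`, the `v` with `[θ x, v] ∈ V` form a closed group to which the induction
    -- hypothesis applies: `[θ x, θ y]` is the traceless part of the commutator of `x` and `y`, up
    -- to the next term of the series.
    have h1 : ∀ g ∈ H, lieSeries 𝓛 n ≤ V.comap (bracketHom (θ (ρ g : E))) := by
      intro x hx
      refine ih _ (isClosed_comap_bracketHom hV _)
        (fun w hw => hle (bracket_mem_lieSeries (mem_pinkAlgebra hx) hw)) fun y hy hyn => ?_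
      obtain ⟨h2, h3⟩ := D.commutator_mem (D.isInLayer_zero hx) hyn
      have h4 := hg (x * y * x⁻¹ * y⁻¹)
        (H.mul_mem (H.mul_mem (H.mul_mem hx hy) (H.inv_mem hx)) (H.inv_mem hy))
      simp only [map_mul, map_inv] at h4
      have h5 := AddSubgroup.sub_mem _ (h4 h2) (hle h3)
      rw [sub_sub_cancel] at h5
      exact h5
    refine closedBracket_le hV fun u hu v hv => ?_
    suffices 𝓛 ≤ V.comap (bracketHom v) by
      have h2 := AddSubgroup.neg_mem _ (AddSubgroup.mem_comap.mp (this hu))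
      rwa [bracketHom_apply, neg_sub] at h2
    refine pinkAlgebra_le (isClosed_comap_bracketHom hV _) fun x hx => ?_
    have h2 := AddSubgroup.neg_mem _ (AddSubgroup.mem_comap.mp (h1 x hx hv))
    rwa [bracketHom_apply, neg_sub] at h2

/-- Modulo the next term, the traceless parts of the elements of `H` in layer `n` form a group
because `θ` is additive there. This group is closed by compactness, and `lieSeries_le_of` makes it
everything. -/
theorem exists_approx {n : ℕ} (hn : 1 ≤ n) {x : Eˣ} (hx : IsInLayer tr c 𝓛 n x) :
    ∃ g ∈ H, IsInLayer tr c 𝓛 (n + 1) (ρ g⁻¹ * x) := by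
  have : CompactSpace E := Module.Finite.compactSpace A E
  have hcl := isClosed_lieSeries (isClosed_pinkAlgebra (tr := tr) (c := c) (ρ := ρ) (H := H))
  have hmem : ∀ g ∈ H, θ (ρ g : E) ∈ lieSeries 𝓛 n → IsInLayer tr c 𝓛 n (ρ g) :=
    fun g hg h => ⟨D.add_inv g hg, h, D.tr_sub_two_mem_lowering hg⟩
  let V : AddSubgroup E :=
    { carrier := {w | ∃ g ∈ H, θ (ρ g : E) ∈ lieSeries 𝓛 n ∧
        w - θ (ρ g : E) ∈ lieSeries 𝓛 (n + 1)}
      zero_mem' := ⟨1, H.one_mem, by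
        have : θ (1 : E) = 0 := by simpa using D.quadratic.tracelessPart_smul_one D.two_mul 1
        simp [this]⟩
      add_mem' := by
        rintro a b ⟨g, hg, hgn, ha⟩ ⟨k, hk, hkn, hb⟩
        have h1 := D.theta_mul_sub_mem hn (hmem g hg hgn) (hmem k hk hkn)
        have h2 := (D.isInLayer_mul (hmem g hg hgn) (hmem k hk hkn)).theta_mem
        rw [← map_mul] at h1 h2
        refine ⟨g * k, H.mul_mem hg hk, h2, ?_⟩
        have h3 := AddSubgroup.sub_mem _ (AddSubgroup.add_mem _ ha hb) h1
        convert h3 using 1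
        abel
      neg_mem' := by
        rintro a ⟨g, hg, hgn, ha⟩
        refine ⟨g⁻¹, H.inv_mem hg, ?_, ?_⟩
        · rw [D.theta_inv hg]; exact AddSubgroup.neg_mem _ hgn
        · rw [D.theta_inv hg, neg_sub_neg, ← neg_sub]
          exact AddSubgroup.neg_mem _ ha }
  have hV : IsClosed (V : Set E) := by
    let S : Set (G × E) := {q | q.1 ∈ H ∧ θ (ρ q.1 : E) ∈ lieSeries 𝓛 n ∧
      q.2 ∈ lieSeries 𝓛 (n + 1)}
    have hρ := D.continuous_theta.comp D.continuous_rho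
    have hS : IsClosed S := (D.isClosed.preimage continuous_fst).inter
      (((hcl n).preimage (hρ.comp continuous_fst)).inter ((hcl (n + 1)).preimage continuous_snd))
    have hVS : (V : Set E) = (fun q : G × E => θ (ρ q.1 : E) + q.2) '' S := by
      ext w
      constructor
      · rintro ⟨g, hg, hgn, hw⟩
        exact ⟨(g, w - θ (ρ g : E)), ⟨hg, hgn, hw⟩, add_sub_cancel _ _⟩
      · rintro ⟨⟨g, l⟩, ⟨hg, hgn, hl⟩, rfl⟩
        exact ⟨g, hg, hgn, by simpa using hl⟩
    rw [hVS]
    exact (hS.isCompact.image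
      ((hρ.comp continuous_fst).add continuous_snd)).isClosed
  have h1 : lieSeries 𝓛 n ≤ V := by
    refine D.lieSeries_le_of n V hV (fun w hw => ⟨1, H.one_mem, ?_⟩) fun g hg hgn =>
      ⟨g, hg, hgn.theta_mem, by simp⟩
    have : θ (1 : E) = 0 := by simpa using D.quadratic.tracelessPart_smul_one D.two_mul 1
    simp [this, hw]
  obtain ⟨g, hg, hgn, hw⟩ := h1 hx.theta_mem
  have hi := D.isInLayer_inv (hmem g hg hgn)
  rw [← map_inv] at hi
  have hix := D.isInLayer_mul hi hx
  refine ⟨g, hg, hix.add_inv, ?_, hix.tr_mem⟩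
  have h2 := AddSubgroup.add_mem _ (D.theta_mul_sub_mem hn hi hx) hw
  rw [D.theta_inv hg] at h2
  convert h2 using 1
  abel

/-- Such an `x` is the scalar `s = tr x / 2`, with `s ^ 2 = 1`; since `s + 1 = 2 + (tr x - 2) / 2`
is a unit, `s = 1`. -/
theorem eq_one_of_theta_eq_zero {x : Eˣ} (hx : IsInLayer tr c 𝓛 0 x) (h0 : θ (x : E) = 0) :
    x = 1 := by
  have h1 : (x : E) = (c * tr (x : E)) • (1 : E) := by
    rwa [tracelessPart_apply, sub_eq_zero] at h0
  have h2 := congrArg (fun z => (x : E) * z) hx.add_inv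
  simp only [mul_add, Units.mul_inv, mul_smul_comm, mul_one] at h2
  set t := tr (x : E) with ht
  have h3 : (c * t) • (c * t) • (1 : E) + 1 = t • (c * t) • (1 : E) := by
    have h4 : (x : E) * x = (c * t) • (c * t) • (1 : E) := by
      rw [h1, smul_mul_assoc, one_mul]
    rw [← h4, h2, ← h1]
  obtain ⟨b, hb⟩ := (D.isUnit_two_add (Ideal.mul_mem_left _ c hx.tr_mem.1)).exists_left_inv
  have h5 : c * t - 1 = b * (t * (c * t) - (c * t) * (c * t) - 1) := by
    linear_combination (1 - c * t) * hb + b * (1 - c * t + c * t * t) * D.two_mul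
  have h6 : (c * t - 1) • (1 : E) = 0 := by
    have h7 : (c * t - 1) • (1 : E) =
        b • (t • (c * t) • (1 : E) - (c * t) • (c * t) • (1 : E) - 1) := by
      rw [h5]; module
    rw [h7, ← h3]; simp
  rw [sub_smul, one_smul, ← h1, sub_eq_zero] at h6
  exact Units.ext h6

/-- **Pink's theorem**: the image of `H` contains every unit of determinant `1` with traceless
part in the closed derived Lie algebra and with `tr x - 2` lowering. -/
theorem exists_eq {x : Eˣ} (hx : IsInLayer tr c 𝓛 1 x) : ∃ g ∈ H, ρ g = x := by
  have hcl := isClosed_lieSeries (isClosed_pinkAlgebra (tr := tr) (c := c) (ρ := ρ) (H := H))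
  -- The approximations of `exists_approx`, multiplied together, show that these closed sets are
  -- nonempty; by compactness one `g` serves for every `n`.
  let T : ℕ → Set G := fun n => {g | g ∈ H ∧ θ ((ρ g⁻¹ * x : Eˣ) : E) ∈ lieSeries 𝓛 (n + 1)}
  have hT : ∀ n, IsClosed (T n) := by
    intro n
    refine D.isClosed.inter ((hcl (n + 1)).preimage (D.continuous_theta.comp ?_))
    simp only [Units.val_mul]
    exact (D.continuous_rho.comp continuous_inv).mul continuous_const
  have hne : ∀ n, ∃ g ∈ H, IsInLayer tr c 𝓛 (n + 1) (ρ g⁻¹ * x) := by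
    intro n
    induction n with
    | zero => exact ⟨1, H.one_mem, by simpa using hx⟩
    | succ n ih =>
      obtain ⟨g, hg, hgn⟩ := ih
      obtain ⟨k, hk, hkn⟩ := D.exists_approx (by omega) hgn
      exact ⟨g * k, H.mul_mem hg hk, by rwa [mul_inv_rev, map_mul, mul_assoc]⟩
  obtain ⟨g, hg⟩ := IsCompact.nonempty_iInter_of_sequence_nonempty_isCompact_isClosed T
    (fun n g hg => ⟨hg.1, D.lieSeries_succ_le' _ hg.2⟩)
    (fun n => (hne n).imp fun g hg => ⟨hg.1, hg.2.theta_mem⟩) (hT 0).isCompact hT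
  rw [Set.mem_iInter] at hg
  have hgH := (hg 0).1
  refine ⟨g, hgH, ?_⟩
  have h0 := D.isInLayer_mul (D.isInLayer_zero (H.inv_mem hgH)) (D.isInLayer_le hx)
  have h1 : θ ((ρ g⁻¹ * x : Eˣ) : E) = 0 := by
    have hH : IsHausdorff (maximalIdeal A) E := inferInstance
    refine hH.haus _ fun k => ?_
    rw [SModEq.zero]
    -- Two steps down the series gain one power of the maximal ideal, so the terms of the series
    -- intersect in zero.
    refine (lieSeries_le_pow_smul D.quadratic isClosed_pinkAlgebra D.bracket_mem D.tr_eq_zero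
      D.continuous_tr D.tr_mul_mem_maximalIdeal (fun k => IsNoetherianRing.isClosed_ideal _)
      (fun k => (Submodule.isCompact_of_fg (IsNoetherian.noetherian _)).isClosed) k).1 _ ?_
    cases k with
    | zero => exact D.lieSeries_le' _ (hg 0).2
    | succ k => exact (hg (2 * k + 1)).2
  have h2 := D.eq_one_of_theta_eq_zero h0 h1
  rwa [map_inv, inv_mul_eq_one] at h2

end IsPinkDatum

/-! ### Peirce decomposition and the action of a regular diagonal element -/

namespace IsQuadraticTrace

variable {A E : Type*} [CommRing A] [Ring E] [Algebra A E] {tr : E →ₗ[A] A}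
  (h : IsQuadraticTrace tr)

include h

/-- An idempotent of trace `1` has rank one. -/
theorem corner {e : E} (he : e * e = e) (ht : tr e = 1) (y : E) :
    e * y * e = tr (e * y) • e := by
  have h1 := congrArg (fun z => e * z * e) (h.polar e y)
  simp only [mul_add, add_mul, mul_smul_comm, smul_mul_assoc, mul_one] at h1
  have e1 : e * (e * y) * e = e * y * e := by rw [← mul_assoc, he]
  have e2 : e * (y * e) * e = e * y * e := by rw [mul_assoc, mul_assoc, he, mul_assoc]
  have e3 : e * e * e = e := by rw [he, he]
  rw [e1, e2, e3, he, ht] at h1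
  linear_combination (norm := module) h1

theorem tr_compl {e : E} (ht : tr e = 1) : tr (1 - e) = 1 := by
  rw [map_sub, h.one, ht]; ring

/-- Two upper triangular elements are proportional. -/
theorem smul_upper {e : E} (he : e * e = e) (ht : tr e = 1) (p q y : E) :
    tr (e * p * (1 - e) * q) • (e * y * (1 - e)) =
      tr ((1 - e) * (q * e * y)) • (e * p * (1 - e)) := by
  have hf : (1 - e) * (1 - e) = 1 - e := IsIdempotentElem.one_sub he
  have e1 := h.corner hf (h.tr_compl ht) (q * e * y)
  have e2 := h.corner he ht (p * (1 - e) * q)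
  have e0 : e * p * (1 - e) * q = e * (p * (1 - e) * q) := by simp only [mul_assoc]
  calc _ = tr (e * (p * (1 - e) * q)) • (e * y * (1 - e)) := by rw [e0]
    _ = (tr (e * (p * (1 - e) * q)) • e) * (y * (1 - e)) := by
        rw [smul_mul_assoc, ← mul_assoc e y (1 - e)]
    _ = e * p * ((1 - e) * (q * e * y) * (1 - e)) := by rw [← e2]; simp only [mul_assoc]
    _ = _ := by rw [e1, mul_smul_comm]

theorem peirce {e : E} (he : e * e = e) (ht : tr e = 1) {u : E} (hu : tr u = 0) :
    u = tr (e * u) • (e - (1 - e)) + e * u * (1 - e) + (1 - e) * u * e := by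
  have h1 := h.corner he ht u
  have h2 := h.corner (IsIdempotentElem.one_sub he) (h.tr_compl ht) u
  have h3 : tr ((1 - e) * u) = -tr (e * u) := by rw [sub_mul, one_mul, map_sub, hu, zero_sub]
  have h4 : u = e * u * e + (1 - e) * u * (1 - e) + e * u * (1 - e) + (1 - e) * u * e := by
    noncomm_ring
  rw [h3] at h2
  rw [h1, h2] at h4
  linear_combination (norm := module) h4

end IsQuadraticTrace

/-- The element `g₀` normalizes `H` and acts through `ρ` as a diagonal matrix with eigenvalues `α`
and `β`, the eigenprojection for `α` being `e`. -/
structure IsTorus {A E G : Type*} [CommRing A] [TopologicalSpace A] [IsTopologicalRing A] [Ring E]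
    [Algebra A E] [Group G]
    (tr : E →ₗ[A] A) (ρ : G →* Eˣ) (H : Subgroup G) (g₀ : G) (e : E) (α β : A) : Prop where
  idem : e * e = e
  tr_idem : tr e = 1
  rho_eq : (ρ g₀ : E) = α • e + β • (1 - e)
  conj_mem : ∀ g ∈ H, g₀ * g * g₀⁻¹ ∈ H
  left_mem : α ∈ (⊥ : Subring A).topologicalClosure
  right_mem : β ∈ (⊥ : Subring A).topologicalClosure
  isUnit_left : IsUnit α
  isUnit_right : IsUnit β
  isUnit_sub : IsUnit (α ^ 2 - β ^ 2)

theorem mul_compl_self {E : Type*} [Ring E] {e : E} (he : e * e = e) : e * (1 - e) = 0 := by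
  rw [mul_sub, mul_one, he, sub_self]

theorem compl_mul_self {E : Type*} [Ring E] {e : E} (he : e * e = e) : (1 - e) * e = 0 := by
  rw [sub_mul, one_mul, he, sub_self]

namespace IsTorus

variable {A E G : Type*} [CommRing A] [IsLocalRing A] [IsNoetherianRing A] [TopologicalSpace A]
  [IsTopologicalRing A] [CompactSpace A] [T2Space A]
  [Ring E] [Algebra A E] [Module.Finite A E] [TopologicalSpace E] [IsTopologicalRing E]
  [ContinuousSMul A E] [T2Space E]
  [Group G] [TopologicalSpace G] [IsTopologicalGroup G] [CompactSpace G]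
  {tr : E →ₗ[A] A} {c : A} {ρ : G →* Eˣ} {H : Subgroup G} (D : IsPinkDatum tr c ρ H)
  {g₀ : G} {e : E} {α β : A} (T : IsTorus tr ρ H g₀ e α β)

local notation "𝓛" => pinkAlgebra tr c ρ H
local notation "θ" => tracelessPart tr c

include D T

theorem symm : IsTorus tr ρ H g₀ (1 - e) β α where
  idem := IsIdempotentElem.one_sub T.idem
  tr_idem := D.quadratic.tr_compl T.tr_idem
  rho_eq := by rw [T.rho_eq, sub_sub_cancel, add_comm]
  conj_mem := T.conj_mem
  left_mem := T.right_mem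
  right_mem := T.left_mem
  isUnit_left := T.isUnit_right
  isUnit_right := T.isUnit_left
  isUnit_sub := by rw [← neg_sub]; exact T.isUnit_sub.neg

-- Since every closed subring contains the closure of `ℤ`, the eigenvalues of `g₀` stabilize the Lie
-- algebra. This is what regularity over the prime field provides.
omit D in
theorem mem_of_mem_bot {S : Subring A} (hS : IsClosed (S : Set A)) {a : A}
    (ha : a ∈ (⊥ : Subring A).topologicalClosure) : a ∈ S :=
  Subring.topologicalClosure_minimal _ bot_le hS ha

theorem conj_mem_pinkAlgebra : ∀ u ∈ 𝓛, (ρ g₀ : E) * u * ((ρ g₀)⁻¹ : Eˣ) ∈ 𝓛 := by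
  refine IsPinkDatum.pinkAlgebra_le (V := (𝓛).comap ((AddMonoidHom.mulRight
    (((ρ g₀)⁻¹ : Eˣ) : E)).comp (AddMonoidHom.mulLeft (ρ g₀ : E))))
    (IsPinkDatum.isClosed_pinkAlgebra.preimage
      ((continuous_const_mul _).mul continuous_const)) fun g hg => ?_
  change (ρ g₀ : E) * θ (ρ g : E) * ((ρ g₀)⁻¹ : Eˣ) ∈ 𝓛
  have hmem := IsPinkDatum.mem_pinkAlgebra (A := A) (E := E) (tr := tr) (c := c) (ρ := ρ)
    (T.conj_mem g hg)
  convert hmem using 1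
  simp only [map_mul, map_inv, Units.val_mul, tracelessPart_apply, mul_sub, sub_mul,
    mul_smul_comm, smul_mul_assoc, mul_one, Units.mul_inv]
  rw [D.quadratic.comm (_ * _), ← mul_assoc, Units.inv_mul, one_mul]

/-- Conjugation by `g₀` acts on the diagonal, upper and lower parts by `1`, `α/β` and `β/α`. Hence
`(Ad - 1)`, followed by `(Ad - β/α)`, maps `u` to `(α/β - 1) (α/β - β/α)` times its upper part. This
scalar is a unit since `α ^ 2 - β ^ 2` is, and its inverse stabilizes the Lie algebra. -/
theorem plus_mem {u : E} (hu : u ∈ 𝓛) : e * u * (1 - e) ∈ 𝓛 := by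
  have hcl := isClosed_scalarStabilizer (A := A)
    (IsPinkDatum.isClosed_pinkAlgebra (tr := tr) (c := c) (ρ := ρ) (H := H))
  obtain ⟨α', hα'⟩ := T.isUnit_left.exists_right_inv
  obtain ⟨β', hβ'⟩ := T.isUnit_right.exists_right_inv
  have hα := T.mem_of_mem_bot hcl T.left_mem
  have hβ := T.mem_of_mem_bot hcl T.right_mem
  have hα'm := mem_of_mul_eq_one hcl hα hα'
  have hβ'm := mem_of_mul_eq_one hcl hβ hβ'
  have hinv : (((ρ g₀)⁻¹ : Eˣ) : E) = α' • e + β' • (1 - e) := by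
    rw [← Units.mul_right_inj (ρ g₀), Units.mul_inv, T.rho_eq]
    simp only [mul_add, add_mul, smul_mul_assoc, mul_smul_comm, T.idem, mul_compl_self T.idem,
      compl_mul_self T.idem, (IsIdempotentElem.one_sub T.idem).eq]
    have e1 : β' • β • (1 : E) = (1 : E) := by rw [smul_smul, mul_comm, hβ', one_smul]
    have e2 : β' • β • e = e := by rw [smul_smul, mul_comm, hβ', one_smul]
    have e3 : α' • α • e = e := by rw [smul_smul, mul_comm, hα', one_smul]
    linear_combination (norm := module) e2 - e1 - e3
  let p := e * u * (1 - e)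
  let q := (1 - e) * u * e
  have hf := (IsIdempotentElem.one_sub T.idem).eq
  have Ad : ∀ w : E, w = tr (e * w) • (e - (1 - e)) + e * w * (1 - e) + (1 - e) * w * e →
      (ρ g₀ : E) * w * ((ρ g₀)⁻¹ : Eˣ) =
      tr (e * w) • (e - (1 - e)) + (α * β') • (e * w * (1 - e)) +
        (β * α') • ((1 - e) * w * e) := by
    intro w hw
    have e4 : (ρ g₀ : E) * w * ((ρ g₀)⁻¹ : Eˣ) = (α * α') • (e * w * e) +
      (α * β') • (e * w * (1 - e)) + (β * α') • ((1 - e) * w * e) +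
      (β * β') • ((1 - e) * w * (1 - e)) := by
      rw [hinv, T.rho_eq]
      simp only [mul_add, add_mul, smul_mul_assoc, mul_smul_comm]
      module
    rw [e4, hα', hβ']
    have e5 : e * w * e + (1 - e) * w * (1 - e) = w - e * w * (1 - e) - (1 - e) * w * e := by
      noncomm_ring
    linear_combination (norm := module) e5 + hw
  have hpu := D.quadratic.peirce T.idem T.tr_idem (D.tr_eq_zero u hu)
  have hbt : α * β' ∈ scalarStabilizer A 𝓛 := Subring.mul_mem _ hα hβ'm
  have hab : β * α' ∈ scalarStabilizer A 𝓛 := Subring.mul_mem _ hβ hα'm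
  have h1 := T.conj_mem_pinkAlgebra D u hu
  rw [Ad u hpu] at h1
  have hv := AddSubgroup.sub_mem _ h1 hu
  have hve : tr (e * u) • (e - (1 - e)) + (α * β') • p + (β * α') • q - u =
      (α * β' - 1) • p + (β * α' - 1) • q := by
    linear_combination (norm := module) -hpu
  change tr (e * u) • (e - (1 - e)) + (α * β') • p + (β * α') • q - u ∈ 𝓛 at hv
  rw [hve] at hv
  have hp1 : e * p * (1 - e) = p := by
    simp only [p, mul_assoc]; rw [hf, ← mul_assoc e e, T.idem]
  have hp2 : (1 - e) * p * e = 0 := by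
    simp only [p, ← mul_assoc]; rw [compl_mul_self T.idem]; simp
  have hq1 : e * q * (1 - e) = 0 := by
    simp only [q, ← mul_assoc]; rw [mul_compl_self T.idem]; simp
  have hq2 : (1 - e) * q * e = q := by
    simp only [q, mul_assoc]; rw [T.idem, ← mul_assoc (1 - e) (1 - e), hf]
  have hpt : tr (e * p) = 0 := by
    rw [show e * p = p by simp only [p, ← mul_assoc, T.idem], D.quadratic.comm, ← mul_assoc,
      compl_mul_self T.idem, zero_mul, map_zero]
  have hqt : tr (e * q) = 0 := by
    rw [show e * q = 0 by simp only [q, ← mul_assoc, mul_compl_self T.idem, zero_mul], map_zero]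
  have hAv := T.conj_mem_pinkAlgebra D _ hv
  have hadd : ∀ x y : A, (ρ g₀ : E) * (x • p + y • q) * ((ρ g₀)⁻¹ : Eˣ) =
      x • (α * β') • p + y • (β * α') • q := by
    intro x y
    have hp := Ad p (by rw [hp1, hp2, hpt]; module)
    have hq := Ad q (by rw [hq1, hq2, hqt]; module)
    rw [hp1, hp2, hpt] at hp
    rw [hq1, hq2, hqt] at hq
    simp only [mul_add, add_mul, smul_mul_assoc, mul_smul_comm]
    rw [hp, hq]
    module
  rw [hadd] at hAv
  have h2 := AddSubgroup.sub_mem _ hAv (hab _ hv)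
  have h3 : (α * β' - 1) • (α * β') • p + (β * α' - 1) • (β * α') • q -
      (β * α') • ((α * β' - 1) • p + (β * α' - 1) • q) =
      ((α * β' - 1) * (α * β' - β * α')) • p := by module
  rw [h3] at h2
  have hu1 : IsUnit ((α * β' - 1) * (α * β' - β * α')) := by
    have e1 : (α * β' - 1) * (α * β' - β * α') = (α ^ 2 - β ^ 2) * (α - β) * (β' * β' * α') := by
      have e2 : α * β' - 1 = (α - β) * β' := by linear_combination hβ'
      have e3 : α * β' - β * α' = (α ^ 2 - β ^ 2) * (β' * α') := by
        linear_combination (-α * β') * hα' + β * α' * hβ'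
      rw [e2, e3]; ring
    have e4 : IsUnit (α - β) := isUnit_of_mul_isUnit_left (y := α + β) (by
      rw [show (α - β) * (α + β) = α ^ 2 - β ^ 2 by ring]; exact T.isUnit_sub)
    have e5 : IsUnit α' := IsUnit.of_mul_eq_one α (by rw [mul_comm, hα'])
    have e6 : IsUnit β' := IsUnit.of_mul_eq_one β (by rw [mul_comm, hβ'])
    rw [e1]
    exact (T.isUnit_sub.mul e4).mul ((e6.mul e6).mul e5)
  obtain ⟨b, hb⟩ := hu1.exists_right_inv
  have hbm : b ∈ scalarStabilizer A 𝓛 := mem_of_mul_eq_one hcl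
    (Subring.mul_mem _ (Subring.sub_mem _ hbt (one_mem _)) (Subring.sub_mem _ hbt hab)) hb
  have h4 := hbm _ h2
  rwa [smul_smul, mul_comm, hb, one_smul] at h4

/-- If the traces of `G` generate `A` topologically, the upper triangular part of the Lie algebra
is an `A`-module. -/
theorem smul_plus_mem (hG : ∀ g : G, ∃ k ∈ H, ∃ n : ℕ, g = k * g₀ ^ n)
    (hgen : ∀ S : Subring A, IsClosed (S : Set A) → (∀ g, tr (ρ g : E) ∈ S) → S = ⊤) (a : A)
    {u : E} (hu : u ∈ 𝓛) : a • (e * u * (1 - e)) ∈ 𝓛 := by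
  have hf := (IsIdempotentElem.one_sub T.idem).eq
  have hid : ∀ (x : A) (w : E), x • (e * w * (1 - e)) = e * (x • (e * w * (1 - e))) * (1 - e) := by
    intro x w
    rw [mul_smul_comm, smul_mul_assoc]
    congr 1
    rw [← mul_assoc, ← mul_assoc, T.idem, mul_assoc _ (1 - e), hf]
  -- By `hid`, a multiple of an upper triangular element is its own upper part; this makes the
  -- stabilizing scalars closed under products.
  let S : Subring A :=
    { carrier := {a | ∀ u ∈ 𝓛, a • (e * u * (1 - e)) ∈ 𝓛}
      mul_mem' := fun {x y} hx hy u hu => by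
        rw [mul_smul, hid y]; exact hx _ (hy u hu)
      one_mem' := fun u hu => by rw [one_smul]; exact T.plus_mem D hu
      add_mem' := fun {x y} hx hy u hu => by
        rw [add_smul]; exact AddSubgroup.add_mem _ (hx u hu) (hy u hu)
      zero_mem' := fun u hu => by rw [zero_smul]; exact AddSubgroup.zero_mem _
      neg_mem' := fun {x} hx u hu => by rw [neg_smul]; exact AddSubgroup.neg_mem _ (hx u hu) }
  have hS : IsClosed (S : Set A) := by
    have : (S : Set A) = ⋂ u ∈ 𝓛, {a : A | a • (e * u * (1 - e)) ∈ 𝓛} := by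
      ext a; simp [S]
    rw [this]
    exact isClosed_biInter fun u _ => IsPinkDatum.isClosed_pinkAlgebra.preimage (by fun_prop)
  have hle : scalarStabilizer A 𝓛 ≤ S := fun x hx u hu => hx _ (T.plus_mem D hu)
  -- The upper part of `[w, e u (1 - e)]` is `2 tr(e w)` times `e u (1 - e)`: diagonal entries of
  -- the Lie algebra act on its upper part.
  have hy : ∀ w ∈ 𝓛, tr (e * w) ∈ S := by
    intro w hw u hu
    have h1 := T.plus_mem D (D.bracket_mem w hw _ (T.plus_mem D hu))
    have h2 := D.quadratic.corner T.idem T.tr_idem w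
    have h3 := D.quadratic.corner hf (D.quadratic.tr_compl T.tr_idem) w
    have h4 : tr ((1 - e) * w) = -tr (e * w) := by
      rw [sub_mul, one_mul, map_sub, D.tr_eq_zero w hw, zero_sub]
    have h5 : e * (w * (e * u * (1 - e)) - e * u * (1 - e) * w) * (1 - e) =
        (2 * tr (e * w)) • (e * u * (1 - e)) := by
      calc _ = e * w * e * u * ((1 - e) * (1 - e)) -
            e * e * u * ((1 - e) * w * (1 - e)) := by noncomm_ring
        _ = _ := by
          rw [h2, h3, h4, hf, T.idem]
          simp only [smul_mul_assoc, mul_smul_comm]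
          module
    rw [h5] at h1
    have h6 := D.mem_scalarStabilizer_half _ h1
    rwa [smul_smul, ← mul_assoc, mul_comm c, D.two_mul, one_mul] at h6
  -- Thus `S` contains the diagonal entries of `ρ k` for `k ∈ H`, and the trace of `ρ (k * g₀ ^ n)`
  -- combines these with powers of `α` and `β`.
  have htop := hgen S hS fun g => by
    obtain ⟨k, hk, n, rfl⟩ := hG g
    have h1 : ∀ n : ℕ, (ρ (g₀ ^ n) : E) = α ^ n • e + β ^ n • (1 - e) := by
      intro n
      induction n with
      | zero => simp
      | succ n ih =>
        rw [pow_succ, map_mul, Units.val_mul, ih, T.rho_eq]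
        simp only [mul_add, add_mul, smul_mul_assoc, mul_smul_comm, T.idem, hf,
          mul_compl_self T.idem, compl_mul_self T.idem]
        module
    have h2 : tr (ρ (k * g₀ ^ n) : E) = α ^ n * tr (e * (ρ k : E)) +
        β ^ n * (tr (ρ k : E) - tr (e * (ρ k : E))) := by
      rw [map_mul, Units.val_mul, h1, mul_add, mul_smul_comm, mul_smul_comm, map_add, map_smul,
        map_smul, D.quadratic.comm _ e, mul_sub, mul_one, map_sub, D.quadratic.comm _ e]
      rfl
    have h3 : tr (e * (ρ k : E)) = tr (e * θ (ρ k : E)) + c * tr (ρ k : E) := by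
      rw [tracelessPart_apply, mul_sub, mul_smul_comm, mul_one, map_sub, map_smul, T.tr_idem]
      simp
    have hk1 := hle (D.tr_mem_scalarStabilizer hk)
    have h4 : tr (e * (ρ k : E)) ∈ S := by
      rw [h3]
      exact S.add_mem (hy _ (IsPinkDatum.mem_pinkAlgebra hk))
        (S.mul_mem (hle D.mem_scalarStabilizer_half) hk1)
    rw [h2]
    exact S.add_mem (S.mul_mem (S.pow_mem (T.mem_of_mem_bot hS T.left_mem) n) h4)
      (S.mul_mem (S.pow_mem (T.mem_of_mem_bot hS T.right_mem) n) (S.sub_mem hk1 h4))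
  have : a ∈ S := htop ▸ Subring.mem_top a
  exact this u hu

/-- The image of `H` contains a congruence subgroup. -/
theorem exists_eq_of_sub_one (hG : ∀ g : G, ∃ k ∈ H, ∃ n : ℕ, g = k * g₀ ^ n)
    (hgen : ∀ S : Subring A, IsClosed (S : Set A) → (∀ g, tr (ρ g : E) ∈ S) → S = ⊤)
    {k₁ k₂ : G} (hk₁ : k₁ ∈ H) (hk₂ : k₂ ∈ H) {r : A}
    (hr : tr (e * (ρ k₁ : E) * (1 - e) * (ρ k₂ : E)) = r) {x : Eˣ}
    (hx : (x : E) + (x⁻¹ : Eˣ) = tr (x : E) • (1 : E)) {z : E} (hz : (x : E) - 1 = r ^ 3 • z) :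
    ∃ g ∈ H, ρ g = x := by
  have Q := D.quadratic
  have T' := T.symm D
  have hf := T'.idem
  have hPp := fun (a : A) (u : E) (hu : u ∈ 𝓛) => T.smul_plus_mem D hG hgen a hu
  have hPm : ∀ (a : A) (u : E), u ∈ 𝓛 → a • ((1 - e) * u * e) ∈ 𝓛 := fun a u hu => by
    simpa using T'.smul_plus_mem D hG hgen a hu
  have hcen : ∀ y : E, e * θ y * (1 - e) = e * y * (1 - e) := fun y => by
    rw [tracelessPart_apply, mul_sub e, sub_mul (e * y), mul_smul_comm, smul_mul_assoc, mul_one,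
      mul_compl_self T.idem, smul_zero, sub_zero]
  have hcen' : ∀ y : E, (1 - e) * θ y * e = (1 - e) * y * e := fun y => by
    rw [tracelessPart_apply, mul_sub (1 - e), sub_mul ((1 - e) * y), mul_smul_comm,
      smul_mul_assoc, mul_one, compl_mul_self T.idem, smul_zero, sub_zero]
  set l := e * (ρ k₁ : E) * (1 - e) with hl
  set m := (1 - e) * (ρ k₂ : E) * e with hm
  have hlm : ∀ a : A, a • l ∈ 𝓛 := fun a => by
    rw [hl, ← hcen]; exact hPp a _ (IsPinkDatum.mem_pinkAlgebra hk₁)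
  have hmm : ∀ a : A, a • m ∈ 𝓛 := fun a => by
    rw [hm, ← hcen']; exact hPm a _ (IsPinkDatum.mem_pinkAlgebra hk₂)
  have hlm1 : l * m = r • e := by
    have e1 := Q.corner T.idem T.tr_idem ((ρ k₁ : E) * (1 - e) * (ρ k₂ : E))
    have e2 : l * m = e * ((ρ k₁ : E) * (1 - e) * (ρ k₂ : E)) * e := by
      calc l * m = e * (ρ k₁ : E) * ((1 - e) * (1 - e)) * (ρ k₂ : E) * e := by
            simp only [hl, hm, mul_assoc]
        _ = _ := by rw [hf]; simp only [mul_assoc]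
    rw [e2, e1, ← hr, hl]
    simp only [mul_assoc]
  have hml1 : m * l = r • (1 - e) := by
    have e1 := Q.corner hf T'.tr_idem ((ρ k₂ : E) * e * (ρ k₁ : E))
    have e2 : m * l = (1 - e) * ((ρ k₂ : E) * e * (ρ k₁ : E)) * (1 - e) := by
      calc m * l = (1 - e) * (ρ k₂ : E) * (e * e) * (ρ k₁ : E) * (1 - e) := by
            simp only [hl, hm, mul_assoc]
        _ = _ := by rw [T.idem]; simp only [mul_assoc]
    rw [e2, e1, ← hr, hl]
    congr 1
    rw [show (1 - e) * ((ρ k₂ : E) * e * (ρ k₁ : E)) = ((1 - e) * (ρ k₂ : E)) * (e * (ρ k₁ : E)) by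
      simp only [mul_assoc], Q.comm]
    simp only [mul_assoc]
  have hplus : ∀ y : E, r • (e * y * (1 - e)) ∈ 𝓛 := fun y => by
    rw [← hr, Q.smul_upper T.idem T.tr_idem]
    exact hlm _
  have hminus : ∀ y : E, r • ((1 - e) * y * e) ∈ 𝓛 := fun y => by
    have e1 := Q.smul_upper hf T'.tr_idem (ρ k₂ : E) (ρ k₁ : E) y
    rw [sub_sub_cancel] at e1
    have e2 : tr ((1 - e) * (ρ k₂ : E) * e * (ρ k₁ : E)) = r := by
      rw [← hr, hl, Q.comm (e * (ρ k₁ : E) * (1 - e)), ← mul_assoc, ← mul_assoc,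
        Q.comm _ (1 - e)]
      simp only [mul_assoc]
    rw [← e2, e1]
    exact hmm _
  -- The diagonal direction is obtained as the bracket `[a l, m]`, since `l m = r e` and `m l = r (1
  -- - e)`.
  have hdiag : ∀ a : A, r • (a • (e - (1 - e))) ∈ 𝓛 := fun a => by
    have e1 := D.bracket_mem _ (hlm a) _ (hmm 1)
    convert e1 using 1
    rw [one_smul, smul_mul_assoc, mul_smul_comm, hlm1, hml1]
    module
  have hall : ∀ y : E, tr y = 0 → r • y ∈ 𝓛 := fun y hy => by
    rw [Q.peirce T.idem T.tr_idem hy, smul_add, smul_add]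
    exact AddSubgroup.add_mem _ (AddSubgroup.add_mem _ (hdiag _) (hplus y)) (hminus y)
  have htp : ∀ y : E, tr (e * y * (1 - e)) = 0 := fun y => by
    rw [Q.comm, ← mul_assoc, compl_mul_self T.idem, zero_mul, map_zero]
  have htm : ∀ y : E, tr ((1 - e) * y * e) = 0 := fun y => by
    rw [Q.comm, ← mul_assoc, mul_compl_self T.idem]; simp
  -- For the diagonal part, `l` and `m` each enter with a factor `r` and `[l, m]` contributes the
  -- third. The triangular parts are brackets with `r (e - (1 - e))`.
  have hder : ∀ y : E, tr y = 0 → r ^ 3 • y ∈ lieSeries 𝓛 1 := fun y hy => by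
    have hd := hdiag 1
    rw [one_smul] at hd
    rw [Q.peirce T.idem T.tr_idem hy, smul_add, smul_add]
    refine AddSubgroup.add_mem _ (AddSubgroup.add_mem _ ?_ ?_) ?_
    · have e1 := bracket_mem_lieSeries (n := 0) (hall ((tr (e * y)) • l)
        (by rw [map_smul, htp, smul_zero])) (hall m (htm _))
      convert e1 using 1
      simp only [smul_mul_assoc, mul_smul_comm]
      rw [hlm1, hml1]
      module
    · have e1 := bracket_mem_lieSeries (n := 0) hd (hall ((r * c) • (e * y * (1 - e)))
        (by rw [map_smul, htp, smul_zero]))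
      convert e1 using 1
      have e2 : (e - (1 - e)) * (e * y * (1 - e)) = e * y * (1 - e) := by
        rw [sub_mul, ← mul_assoc, ← mul_assoc, T.idem, ← mul_assoc, ← mul_assoc,
          compl_mul_self T.idem]; simp
      have e3 : (e * y * (1 - e)) * (e - (1 - e)) = -(e * y * (1 - e)) := by
        rw [mul_sub, mul_assoc _ (1 - e), mul_assoc _ (1 - e), hf, compl_mul_self T.idem]; simp
      simp only [smul_mul_assoc, mul_smul_comm]
      rw [e2, e3]
      have e4 : r ^ 3 • (e * y * (1 - e)) = r ^ 3 • (2 * c) • (e * y * (1 - e)) := by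
        rw [D.two_mul, one_smul]
      rw [e4]
      module
    · have e1 := bracket_mem_lieSeries (n := 0) hd (hall ((-r * c) • ((1 - e) * y * e))
        (by rw [map_smul, htm, smul_zero]))
      convert e1 using 1
      have e2 : (e - (1 - e)) * ((1 - e) * y * e) = -((1 - e) * y * e) := by
        rw [sub_mul, ← mul_assoc e, ← mul_assoc e, mul_compl_self T.idem,
          ← mul_assoc (1 - e) ((1 - e) * y), ← mul_assoc (1 - e) (1 - e), hf]; simp
      have e3 : ((1 - e) * y * e) * (e - (1 - e)) = (1 - e) * y * e := by
        rw [mul_sub, mul_assoc _ e, mul_assoc _ e, T.idem, mul_compl_self T.idem]; simp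
      simp only [smul_mul_assoc, mul_smul_comm]
      rw [e2, e3]
      have e4 : r ^ 3 • ((1 - e) * y * e) = r ^ 3 • (2 * c) • ((1 - e) * y * e) := by
        rw [D.two_mul, one_smul]
      rw [e4]
      module
  have hxz : (x : E) = 1 + r ^ 3 • z := by rw [← hz]; abel
  refine D.exists_eq ⟨hx, ?_, ?_⟩
  · have h1 : θ (1 : E) = 0 := by simpa using Q.tracelessPart_smul_one D.two_mul 1
    rw [hxz, map_add, h1, zero_add, map_smul]
    exact hder _ (Q.tr_tracelessPart D.two_mul z)
  -- The number `tr x - 2 = r ^ 3 tr z` is the trace of a product of two elements of the Lie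
  -- algebra, hence lowering.
  · have e1 : tr (x : E) - 2 = tr (((r ^ 2 * tr z) • l) * ((1 : A) • m)) := by
      rw [one_smul, smul_mul_assoc, hlm1, map_smul, map_smul, T.tr_idem, hxz, map_add, Q.one,
        map_smul]
      simp only [smul_eq_mul]
      ring
    rw [e1]
    exact D.tr_mul_mem_lowering (hlm _) (hmm _)

end IsTorus

/-! ### Off-diagonal products and congruence subgroups in generalized matrix algebras -/

/-- Four times the discriminant-scaled product of the upper right entry of `g` and the lower left
entry of `h`, in a basis where `g₀` is diagonal with eigenvalues `α` and `β`. -/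
def offDiagonal {G A : Type*} [Group G] [CommRing A] (t : G → A) (g₀ : G) (α β : A) (g h : G) : A :=
  α * t (g₀ * g * h) - t (g₀ * g * g₀ * h) - α * β * t (g * h) + β * t (g * g₀ * h)

namespace IsQuadraticTrace

variable {A E : Type*} [CommRing A] [Ring E] [Algebra A E] {tr : E →ₗ[A] A}
  (h : IsQuadraticTrace tr)

include h

/-- The scalar turns any upper triangular element into a multiple of `e p (1 - e)`, by `smul_upper`,
and any lower one into a multiple of `(1 - e) q e`; the diagonal corners are spanned by `e` and `1 -
e`. -/
theorem smul_mem_subalgebra {e : E} (he : e * e = e) (ht : tr e = 1) {S : Subalgebra A E}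
    (heS : e ∈ S) {p q : E} (hp : p ∈ S) (hq : q ∈ S) (z : E) :
    tr (e * p * (1 - e) * q) • z ∈ S := by
  have hf : (1 - e) * (1 - e) = 1 - e := IsIdempotentElem.one_sub he
  have hfS : 1 - e ∈ S := S.sub_mem S.one_mem heS
  have h1 := h.corner he ht z
  have h2 := h.corner hf (h.tr_compl ht) z
  have h3 := h.smul_upper he ht p q z
  have h4 := h.smul_upper hf (h.tr_compl ht) q p z
  rw [sub_sub_cancel] at h4
  have h5 : tr ((1 - e) * q * e * p) = tr (e * p * (1 - e) * q) := by
    have e1 : (1 - e) * q * e * p = ((1 - e) * q) * (e * p) := by simp only [mul_assoc]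
    have e2 : e * p * (1 - e) * q = (e * p) * ((1 - e) * q) := by simp only [mul_assoc]
    rw [e1, e2, h.comm]
  rw [h5] at h4
  have h6 : z = e * z * e + (1 - e) * z * (1 - e) + e * z * (1 - e) + (1 - e) * z * e := by
    noncomm_ring
  rw [h6, smul_add, smul_add, smul_add, h1, h2, h3, h4]
  exact S.add_mem (S.add_mem (S.add_mem (S.smul_mem (S.smul_mem heS _) _)
    (S.smul_mem (S.smul_mem hfS _) _)) (S.smul_mem (S.mul_mem (S.mul_mem heS hp) hfS) _))
    (S.smul_mem (S.mul_mem (S.mul_mem hfS hq) heS) _)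

/-- The spectral projection attached to a root `α` of the characteristic polynomial of `x`. -/
theorem exists_projection {x : E} {α β δ : A} (hx : tr x = α + β)
    (hxx : x * x = tr x • x - (α * β) • (1 : E)) (hδ : (α - β) * δ = 1) {e : E}
    (hedef : e = δ • (x - β • (1 : E))) :
    e * e = e ∧ tr e = 1 ∧ x = α • e + β • (1 - e) := by
  refine ⟨?_, ?_, ?_⟩
  · have e1 : e * e = (δ * δ) • (x * x - (2 * β) • x + (β * β) • (1 : E)) := by
      rw [hedef]
      simp only [smul_mul_assoc, mul_smul_comm, sub_mul, mul_sub, one_mul, mul_one]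
      module
    have e2 : (δ * ((α - β) * δ)) • (x - β • (1 : E)) = δ • (x - β • (1 : E)) := by
      rw [hδ, mul_one]
    rw [e1, hxx, hx, hedef]
    linear_combination (norm := module) e2
  · rw [hedef, map_smul, map_sub, map_smul, hx, h.one, smul_eq_mul, smul_eq_mul]
    linear_combination hδ
  · have e2 : ((α - β) * δ) • (x - β • (1 : E)) = x - β • (1 : E) := by rw [hδ, one_smul]
    rw [hedef]
    linear_combination (norm := module) -e2

/-- Substituting `e = δ (ρ g₀ - β)` and `1 - e = δ (α - ρ g₀)` shows that these products depend on
`t` alone, not on the representation with trace `t`. -/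
theorem offDiagonal_eq {G : Type*} [Group G] {t : G → A} {ρ : G →* Eˣ}
    (ht : ∀ g, tr (ρ g : E) = t g) {g₀ : G} {α β δ : A}
    (hδ : (α - β) * δ = 1) {e : E} (hedef : e = δ • ((ρ g₀ : E) - β • (1 : E))) (g k : G) :
    tr (e * (ρ g : E) * (1 - e) * (ρ k : E)) = δ * δ * offDiagonal t g₀ α β g k := by
  have e1 : (1 : E) - e = δ • (α • (1 : E) - (ρ g₀ : E)) := by
    have e2 : ((α - β) * δ) • (1 : E) = 1 := by rw [hδ, one_smul]
    rw [hedef]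
    linear_combination (norm := module) -e2
  rw [e1, hedef]
  simp only [offDiagonal, ← ht, map_mul, Units.val_mul, smul_mul_assoc, mul_smul_comm, sub_mul,
    mul_sub, one_mul, mul_one, map_smul, map_sub, smul_eq_mul]
  ring

end IsQuadraticTrace

namespace GMA

variable {A : Type u} [CommRing A] (R : GMA A)

/-- The trace as a linear map. -/
def trLinear : R.Alg →ₗ[A] A where
  toFun := Alg.tr
  map_add' x y := by simp [Alg.tr]; ring
  map_smul' r x := by simp [Alg.tr]; ring

theorem trLinear_apply (x : R.Alg) : R.trLinear x = x.tr := rfl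

theorem isQuadraticTrace : IsQuadraticTrace R.trLinear where
  one := by simp [trLinear_apply, Alg.tr]; norm_num
  comm x y := by simp [trLinear_apply, Alg.tr]; ring
  polar x y := by
    apply Alg.ext'
    · simp [trLinear_apply, Alg.tr]; ring
    · simp [trLinear_apply, Alg.tr]; module
    · simp [trLinear_apply, Alg.tr]; module
    · simp [trLinear_apply, Alg.tr]; ring

theorem mul_self_eq (x : R.Alg) : x * x = R.trLinear x • x - x.det • (1 : R.Alg) := by
  rw [eq_sub_iff_add_eq]
  apply Alg.ext'
  · simp [trLinear_apply, Alg.tr, Alg.det]; ring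
  · simp [trLinear_apply, Alg.tr]; module
  · simp [trLinear_apply, Alg.tr]; module
  · simp [trLinear_apply, Alg.tr, Alg.det]; ring

theorem add_inv_of_det_eq_one {x : R.Algˣ} (hx : (x : R.Alg).det = 1) :
    (x : R.Alg) + (x⁻¹ : R.Algˣ) = R.trLinear (x : R.Alg) • (1 : R.Alg) := by
  have h1 := congrArg (· * ((x⁻¹ : R.Algˣ) : R.Alg)) (R.mul_self_eq x)
  simp only [hx, one_smul, sub_mul, mul_assoc, smul_mul_assoc, Units.mul_inv, mul_one,
    one_mul] at h1
  exact eq_sub_iff_add_eq.mp h1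

theorem two_mul_det (x : R.Alg) : 2 * x.det = x.tr * x.tr - (x * x).tr := by
  simp [Alg.tr, Alg.det]; ring

variable {R}

/-- When `2` is invertible the determinant is a function of traces, so that faithfulness is the
nondegeneracy of the trace form. -/
theorem IsFaithful.eq_zero (hR : R.IsFaithful) {c : A} (hc : 2 * c = 1) {y : R.Alg}
    (hy : ∀ x, R.trLinear (y * x) = 0) : y = 0 := by
  refine hR y ?_ hy
  have h1 := R.two_mul_det y
  have h2 := hy 1
  have h3 := hy y
  rw [trLinear_apply] at h2 h3
  rw [mul_one] at h2
  rw [h2, h3] at h1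
  linear_combination c * h1 - y.det * hc

section

variable {G : Type v} [Group G] {t d : G → A} {ρ : G →* R.Algˣ}

theorem smul_mem_span (ht : ∀ g, (ρ g : R.Alg).tr = t g) (hd : ∀ g, (ρ g : R.Alg).det = d g)
    {α β δ : A} (hδ : (α - β) * δ = 1) {g₀ : G} (htg : t g₀ = α + β)
    (hdg : d g₀ = α * β) (k₁ k₂ : G) (z : R.Alg) :
    (δ * δ * offDiagonal t g₀ α β k₁ k₂) • z ∈
      Submodule.span A (Set.range fun g => (ρ g : R.Alg)) := by
  have Q := R.isQuadraticTrace
  obtain ⟨he, het, -⟩ := Q.exists_projection ((ht g₀).trans htg)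
    (by rw [R.mul_self_eq, hd, hdg]) hδ rfl
  rw [← Q.offDiagonal_eq (ρ := ρ) ht hδ rfl]
  let S : Subalgebra A R.Alg := Algebra.adjoin A (Set.range fun g => (ρ g : R.Alg))
  have hρ : ∀ g, (ρ g : R.Alg) ∈ S := fun g => Algebra.subset_adjoin ⟨g, rfl⟩
  have hS : Subalgebra.toSubmodule S = Submodule.span A (Set.range fun g => (ρ g : R.Alg)) := by
    have h1 : (Submonoid.closure (Set.range fun g => (ρ g : R.Alg)) : Set R.Alg) =
        Set.range fun g => (ρ g : R.Alg) := by
      have h2 : (Set.range fun g => (ρ g : R.Alg)) =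
          (MonoidHom.mrange ((Units.coeHom R.Alg).comp ρ) : Set R.Alg) := by
        ext; simp
      rw [h2, Submonoid.closure_eq]
    rw [Algebra.adjoin_eq_span, h1]
  rw [← hS]
  exact Q.smul_mem_subalgebra he het (S.smul_mem (S.sub_mem (hρ g₀) (S.smul_mem S.one_mem _)) _)
    (hρ k₁) (hρ k₂) z

/-- By `smul_mem_span`, one nonzero scalar carries the whole algebra into the span of the image;
over a domain, traces against the image therefore detect zero. -/
theorem eq_zero_of_tr_mul_rho [IsDomain A] (hR : R.IsFaithful)
    (ht : ∀ g, (ρ g : R.Alg).tr = t g) (hd : ∀ g, (ρ g : R.Alg).det = d g)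
    {c α β δ : A} (hc : 2 * c = 1) (hδ : (α - β) * δ = 1) {g₀ : G} (htg : t g₀ = α + β)
    (hdg : d g₀ = α * β) {k₁ k₂ : G} (hk : offDiagonal t g₀ α β k₁ k₂ ≠ 0) {y : R.Alg}
    (hy : ∀ g, R.trLinear (y * ρ g) = 0) : y = 0 := by
  refine hR.eq_zero hc fun z => ?_
  have h1 : Submodule.span A (Set.range fun g => (ρ g : R.Alg)) ≤
      LinearMap.ker (R.trLinear.comp (LinearMap.mulLeft A y)) := by
    rw [Submodule.span_le]
    rintro _ ⟨g, rfl⟩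
    exact hy g
  have h2 := h1 (smul_mem_span ht hd hδ htg hdg k₁ k₂ z)
  rw [LinearMap.mem_ker, LinearMap.comp_apply, LinearMap.mulLeft_apply, mul_smul_comm,
    map_smul, smul_eq_mul, mul_eq_zero] at h2
  refine h2.resolve_left (mul_ne_zero (mul_ne_zero ?_ ?_) hk) <;>
  · rintro rfl; simp at hδ

variable [TopologicalSpace A] [IsTopologicalRing A] [CompactSpace A] [T2Space A]
  [TopologicalSpace G] [IsTopologicalGroup G] [CompactSpace G]

/-- The topological consequences of the continuity of the trace of `ρ`. -/
theorem t2Space_and_continuous [IsDomain A] (hR : R.IsFaithful) [Module.Finite A R.Alg]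
    [τ : TopologicalSpace R.Alg] [IsModuleTopology A R.Alg] (htc : Continuous t)
    (ht : ∀ g, (ρ g : R.Alg).tr = t g) (hd : ∀ g, (ρ g : R.Alg).det = d g)
    {c α β δ : A} (hc : 2 * c = 1) (hδ : (α - β) * δ = 1) {g₀ : G} (htg : t g₀ = α + β)
    (hdg : d g₀ = α * β) {k₁ k₂ : G} (hk : offDiagonal t g₀ α β k₁ k₂ ≠ 0) :
    T2Space R.Alg ∧ Continuous fun g => (ρ g : R.Alg) := by
  have hTR : IsTopologicalRing R.Alg := IsModuleTopology.isTopologicalRing A R.Alg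
  have : CompactSpace R.Alg := Module.Finite.compactSpace A R.Alg
  -- This map embeds the compact algebra in `A ^ G`. The embedding gives the Hausdorff property and
  -- reduces the continuity of `ρ` to that of `t`.
  let Φ : R.Alg → G → A := fun y g => R.trLinear (y * ρ g)
  have hΦ : Continuous Φ := continuous_pi fun g =>
    IsModuleTopology.continuous_of_linearMap (R.trLinear.comp (LinearMap.mulRight A (ρ g : R.Alg)))
  have hinj : Function.Injective Φ := by
    intro x y hxy
    rw [← sub_eq_zero]
    refine eq_zero_of_tr_mul_rho hR ht hd hc hδ htg hdg hk fun g => ?_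
    rw [sub_mul, map_sub, sub_eq_zero]
    exact congrFun hxy g
  have hT2 : T2Space R.Alg := T2Space.of_injective_continuous hinj hΦ
  refine ⟨hT2, ?_⟩
  rw [(hΦ.isClosedEmbedding hinj).isInducing.continuous_iff]
  refine continuous_pi fun g => ?_
  have h1 : (fun k => Φ (ρ k : R.Alg) g) = fun k => t (k * g) := by
    ext k
    simp only [Φ]
    rw [← Units.val_mul, ← map_mul, trLinear_apply, ht]
  change Continuous fun k => Φ (ρ k : R.Alg) g
  rw [h1]
  exact htc.comp (continuous_mul_const g)

theorem isClosed_range [IsDomain A] (hR : R.IsFaithful) [Module.Finite A R.Alg]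
    (htc : Continuous t)
    (ht : ∀ g, (ρ g : R.Alg).tr = t g) (hd : ∀ g, (ρ g : R.Alg).det = d g)
    {c α β δ : A} (hc : 2 * c = 1) (hδ : (α - β) * δ = 1) {g₀ : G} (htg : t g₀ = α + β)
    (hdg : d g₀ = α * β) {k₁ k₂ : G} (hk : offDiagonal t g₀ α β k₁ k₂ ≠ 0) :
    IsClosed[(moduleTopology A R.Alg).induced Units.val] (ρ.range : Set R.Algˣ) := by
  let _ : TopologicalSpace R.Alg := moduleTopology A R.Alg
  have _ : IsModuleTopology A R.Alg := ⟨rfl⟩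
  obtain ⟨hT2, hcont⟩ := t2Space_and_continuous hR htc ht hd hc hδ htg hdg hk
  refine isClosed_induced_iff.mpr ⟨_, (isCompact_range hcont).isClosed, ?_⟩
  ext x
  constructor
  · rintro ⟨g, hg⟩
    exact ⟨g, Units.ext hg⟩
  · rintro ⟨g, rfl⟩
    exact ⟨g, rfl⟩

/-- The image is a congruence subgroup as soon as it is generically irreducible on `H`. -/
theorem isCongruenceSubgroup_range [IsDomain A] [IsLocalRing A] [IsNoetherianRing A]
    (hR : R.IsFaithful) [Module.Finite A R.Alg] (htc : Continuous t)
    (ht : ∀ g, (ρ g : R.Alg).tr = t g) (hd : ∀ g, (ρ g : R.Alg).det = d g)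
    {c α β δ : A} (hc : 2 * c = 1) (hδ : (α - β) * δ = 1) {g₀ : G} (htg : t g₀ = α + β)
    (hdg : d g₀ = α * β) {H : Subgroup G} (hH : IsClosed (H : Set G))
    (hconj : ∀ g ∈ H, g₀ * g * g₀⁻¹ ∈ H)
    (htH : ∀ g ∈ H, t g - 2 ∈ maximalIdeal A) (hdH : ∀ g ∈ H, d g = 1)
    (hα : α ∈ (⊥ : Subring A).topologicalClosure) (hβ : β ∈ (⊥ : Subring A).topologicalClosure)
    (huα : IsUnit α) (huβ : IsUnit β) (hu : IsUnit (α ^ 2 - β ^ 2))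
    (hG : ∀ g : G, ∃ k ∈ H, ∃ n : ℕ, g = k * g₀ ^ n)
    (hgen : ∀ S : Subring A, IsClosed (S : Set A) → (∀ g, t g ∈ S) → S = ⊤)
    {k₁ k₂ : G} (hk₁ : k₁ ∈ H) (hk₂ : k₂ ∈ H) (hk : offDiagonal t g₀ α β k₁ k₂ ≠ 0) :
    R.IsCongruenceSubgroup ρ.range := by
  refine ⟨isClosed_range hR htc ht hd hc hδ htg hdg hk,
    Ideal.span {(δ * δ * offDiagonal t g₀ α β k₁ k₂) ^ 3}, ?_, fun x hx hxI => ?_⟩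
  · rw [Ne, Ideal.span_singleton_eq_bot]
    refine pow_ne_zero _ (mul_ne_zero (mul_ne_zero ?_ ?_) hk) <;>
    · rintro rfl; simp at hδ
  let _ : TopologicalSpace R.Alg := moduleTopology A R.Alg
  have _ : IsModuleTopology A R.Alg := ⟨rfl⟩
  have hTR : IsTopologicalRing R.Alg := IsModuleTopology.isTopologicalRing A R.Alg
  obtain ⟨hT2, hcont⟩ := t2Space_and_continuous hR htc ht hd hc hδ htg hdg hk
  have Q := R.isQuadraticTrace
  obtain ⟨he, het, hρ⟩ := Q.exists_projection ((ht g₀).trans htg)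
    (by rw [R.mul_self_eq, hd, hdg]) hδ rfl
  have D : IsPinkDatum R.trLinear c ρ H :=
    { quadratic := Q
      two_mul := hc
      continuous_tr := IsModuleTopology.continuous_of_linearMap _
      continuous_rho := hcont
      isClosed := hH
      add_inv := fun g hg => R.add_inv_of_det_eq_one ((hd g).trans (hdH g hg))
      tr_sub_two := fun g hg => by rw [trLinear_apply, ht]; exact htH g hg }
  have T : IsTorus R.trLinear ρ H g₀ _ α β :=
    { idem := he
      tr_idem := het
      rho_eq := hρ
      conj_mem := hconj
      left_mem := hα
      right_mem := hβ
      isUnit_left := huα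
      isUnit_right := huβ
      isUnit_sub := hu }
  rw [Submodule.ideal_span_singleton_smul, Submodule.mem_smul_pointwise_iff_exists] at hxI
  obtain ⟨z, -, hz⟩ := hxI
  obtain ⟨g, -, hg⟩ := T.exists_eq_of_sub_one D hG (fun S hS h => hgen S hS fun g => by
    rw [← ht]; exact h g) hk₁ hk₂ (Q.offDiagonal_eq (ρ := ρ) ht hδ rfl k₁ k₂)
    (R.add_inv_of_det_eq_one hx) hz.symm
  exact ⟨g, hg⟩

end

end GMA

/-! ### From pseudo-representations to faithful generalized matrix algebras -/

namespace IsPseudoRep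

variable {G : Type v} [Group G] {A : Type u} [CommRing A] {t d : G → A} (h : IsPseudoRep t d)

include h

theorem d_mul (x y : G) : d (x * y) = d x * d y := by
  obtain ⟨χ, hχ⟩ := h.d_hom
  simp [hχ]

theorem d_one : d 1 = 1 := by
  obtain ⟨χ, hχ⟩ := h.d_hom
  simp [hχ]

theorem isUnit_d (x : G) : IsUnit (d x) := by
  obtain ⟨χ, hχ⟩ := h.d_hom
  exact hχ x ▸ (χ x).isUnit

theorem two_mul_d (x : G) : 2 * d x = t x * t x - t (x * x) := by
  have h1 := h.t_mul x x
  rw [mul_inv_cancel, h.t_one] at h1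
  linear_combination h1

/-- The polarized Cayley-Hamilton identity. -/
theorem frobenius (x y z : G) : t (x * y * z) + t (y * x * z) =
    t x * t (y * z) + t y * t (x * z) + (t (x * y) - t x * t y) * t z := by
  have h1 := h.t_mul z (x * y)
  have h2 := h.t_mul (z * y⁻¹) x
  have h3 := h.t_mul z y
  have h4 := h.t_mul (x * z) y
  have e1 : z * (x * y)⁻¹ = z * y⁻¹ * x⁻¹ := by group
  rw [e1, h.d_mul] at h1
  rw [h.t_central (z * y⁻¹) x] at h2
  rw [mul_assoc x z y⁻¹] at h4
  rw [h.t_central (x * y) z, h.t_central y z, h.t_central x z, h.t_central (y * x) z]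
  have e2 : t (x * z * y) = t (z * (y * x)) := by
    rw [mul_assoc, h.t_central, mul_assoc]
  rw [e2] at h4
  rw [h.t_central x z] at h4
  linear_combination h1 - d y * h2 + h4 - t x * h3

/-- A pseudo-representation is the trace of a representation in an algebra with a quadratic
trace. -/
theorem exists_isQuadraticTrace : ∃ (E : Type (max u v)) (_ : Ring E) (_ : Algebra A E)
    (tr : E →ₗ[A] A) (ρ : G →* Eˣ), IsQuadraticTrace tr ∧ ∀ g, tr (ρ g : E) = t g := by
  let T : MonoidAlgebra A G →ₗ[A] A :=
    (Finsupp.linearCombination A t).comp (MonoidAlgebra.coeffLinearEquiv A).toLinearMap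
  have hT : ∀ g, T (MonoidAlgebra.of A G g) = t g := fun g => by
    simp [T]
  have hof : ∀ x y, MonoidAlgebra.of A G x * MonoidAlgebra.of A G y = MonoidAlgebra.of A G (x * y) :=
    fun x y => (map_mul _ x y).symm
  have hcomm : ∀ x y, T (x * y) = T (y * x) := by
    intro x y
    induction x using MonoidAlgebra.induction_on with
    | of x =>
      induction y using MonoidAlgebra.induction_on with
      | of y => rw [hof, hof, hT, hT, h.t_central]
      | add y z hy hz => rw [mul_add, add_mul, map_add, map_add, hy, hz]
      | smul r y hy => rw [mul_smul_comm, smul_mul_assoc, map_smul, map_smul, hy]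
    | add x z hx hz => rw [mul_add, add_mul, map_add, map_add, hx, hz]
    | smul r x hx => rw [mul_smul_comm, smul_mul_assoc, map_smul, map_smul, hx]
  have hpolar : ∀ x y z, T (x * y * z) + T (y * x * z) =
      T x * T (y * z) + T y * T (x * z) + (T (x * y) - T x * T y) * T z := by
    intro x y z
    induction x using MonoidAlgebra.induction_on with
    | of x =>
      induction y using MonoidAlgebra.induction_on with
      | of y =>
        induction z using MonoidAlgebra.induction_on with
        | of z => simp only [hof, hT]; exact h.frobenius x y z
        | add z w hz hw => simp only [mul_add, map_add]; linear_combination hz + hw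
        | smul r z hz =>
          simp only [mul_smul_comm, map_smul, smul_eq_mul]; linear_combination r * hz
      | add y w hz hw => simp only [mul_add, add_mul, map_add]; linear_combination hz + hw
      | smul r z hz =>
        simp only [mul_smul_comm, smul_mul_assoc, map_smul, smul_eq_mul]; linear_combination r * hz
    | add y w hz hw => simp only [mul_add, add_mul, map_add]; linear_combination hz + hw
    | smul r z hz =>
      simp only [mul_smul_comm, smul_mul_assoc, map_smul, smul_eq_mul]; linear_combination r * hz
  -- The radical of the trace form: modulo `K` the scalar identity `hpolar` becomes the
  -- Cayley-Hamilton identity.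
  let K : Ideal (MonoidAlgebra A G) :=
    { carrier := {f | ∀ z, T (f * z) = 0}
      add_mem' := fun {x y} hx hy z => by rw [add_mul, map_add, hx, hy, add_zero]
      zero_mem' := fun z => by rw [zero_mul, map_zero]
      smul_mem' := fun r x hx z => by
        rw [smul_eq_mul, mul_assoc, hcomm, mul_assoc, hx] }
  have : K.IsTwoSided := ⟨fun b ha z => by rw [mul_assoc]; exact ha _⟩
  have hK : K.restrictScalars A ≤ LinearMap.ker T := fun x hx => by
    have := hx 1
    rwa [mul_one] at this
  let tr : (MonoidAlgebra A G ⧸ K) →ₗ[A] A := (K.restrictScalars A).liftQ T hK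
  have htr : ∀ x, tr (Ideal.Quotient.mk K x) = T x := fun x => rfl
  let ρ : G →* (MonoidAlgebra A G ⧸ K)ˣ :=
    MonoidHom.toHomUnits ((Ideal.Quotient.mk K).toMonoidHom.comp (MonoidAlgebra.of A G))
  refine ⟨MonoidAlgebra A G ⧸ K, inferInstance, inferInstance, tr, ρ, ⟨?_, ?_, ?_⟩, fun g => hT g⟩
  · rw [← map_one (Ideal.Quotient.mk K), htr, ← map_one (MonoidAlgebra.of A G), hT, h.t_one]
  · intro x y
    obtain ⟨x, rfl⟩ := Ideal.Quotient.mk_surjective x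
    obtain ⟨y, rfl⟩ := Ideal.Quotient.mk_surjective y
    rw [← map_mul, ← map_mul, htr, htr, hcomm]
  · intro x y
    obtain ⟨x, rfl⟩ := Ideal.Quotient.mk_surjective x
    obtain ⟨y, rfl⟩ := Ideal.Quotient.mk_surjective y
    rw [← map_mul, ← map_mul, htr, htr, htr, ← map_add]
    have e1 : T x • Ideal.Quotient.mk K y + T y • Ideal.Quotient.mk K x +
        (T (x * y) - T x * T y) • (1 : MonoidAlgebra A G ⧸ K) =
        Ideal.Quotient.mk K (T x • y + T y • x + (T (x * y) - T x * T y) • 1) := rfl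
    rw [e1, Ideal.Quotient.eq]
    intro z
    have h1 := hpolar x y z
    simp only [sub_mul, add_mul, smul_mul_assoc, one_mul, map_sub, map_add, map_smul, smul_eq_mul]
    linear_combination h1

end IsPseudoRep

namespace IsQuadraticTrace

variable {A E : Type*} [CommRing A] [Ring E] [Algebra A E] {tr : E →ₗ[A] A}
  (h : IsQuadraticTrace tr)

include h

/-- The products of off-diagonal entries form a matrix of rank one. -/
theorem tr_mul_tr {e : E} (he : e * e = e) (ht : tr e = 1) (p q p' q' : E) :
    tr (e * p * (1 - e) * q) * tr (e * p' * (1 - e) * q') =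
      tr (e * p * (1 - e) * q') * tr (e * p' * (1 - e) * q) := by
  have h1 := congrArg (fun z => tr (z * q')) (h.smul_upper he ht p q p')
  have h2 : tr ((1 - e) * (q * e * p')) = tr (e * p' * (1 - e) * q) := by
    have e1 : (1 - e) * (q * e * p') = ((1 - e) * q) * (e * p') := by simp only [mul_assoc]
    rw [e1, h.comm]; simp only [mul_assoc]
  simp only [smul_mul_assoc, map_smul, smul_eq_mul, h2] at h1
  linear_combination h1

theorem tr_upper_mul {e : E} (he : e * e = e) (ht : tr e = 1) (p q r : E) :
    tr (e * (p * q) * (1 - e) * r) = tr (e * p) * tr (e * q * (1 - e) * r) +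
      tr ((1 - e) * q) * tr (e * p * (1 - e) * r) := by
  have h1 := h.corner he ht p
  have h2 := h.corner (IsIdempotentElem.one_sub he) (h.tr_compl ht) q
  have e1 : e * (p * q) * (1 - e) * r =
      (e * p * e) * q * (1 - e) * r + e * p * ((1 - e) * q * (1 - e)) * r := by noncomm_ring
  rw [e1, h1, h2]
  simp only [smul_mul_assoc, mul_smul_comm, map_add, map_smul, smul_eq_mul]

theorem tr_lower_mul {e : E} (he : e * e = e) (ht : tr e = 1) (p q r : E) :
    tr (e * r * (1 - e) * (p * q)) = tr (e * q) * tr (e * r * (1 - e) * p) +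
      tr ((1 - e) * p) * tr (e * r * (1 - e) * q) := by
  have h1 := h.corner he ht (r * (1 - e) * p)
  have h2 := h.corner (IsIdempotentElem.one_sub he) (h.tr_compl ht) p
  have e1 : e * r * (1 - e) * (p * q) =
      e * (r * (1 - e) * p) * e * q + e * r * ((1 - e) * p * (1 - e)) * q := by noncomm_ring
  rw [e1, h1, h2]
  simp only [smul_mul_assoc, mul_smul_comm, map_add, map_smul, smul_eq_mul]
  simp only [mul_assoc]
  ring

theorem tr_mul_diag {e : E} (p q : E) :
    tr (e * (p * q)) = tr (e * p * e * q) + tr (e * p * (1 - e) * q) := by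
  rw [← map_add]; congr 1; noncomm_ring

end IsQuadraticTrace

/-- A representation with an idempotent of trace one and a nonzero product of off-diagonal entries
comes from a faithful generalized matrix algebra of finite type. -/
theorem IsQuadraticTrace.exists_gma {A : Type u} {E : Type*} [CommRing A] [IsDomain A] [IsNoetherianRing A] [Ring E]
    [Algebra A E] {tr : E →ₗ[A] A} (h : IsQuadraticTrace tr) {G : Type*} [Group G] {ρ : G →* Eˣ}
    {e : E} (he : e * e = e) (ht : tr e = 1)
    {g₁ g₂ : G} (hr : tr (e * (ρ g₁ : E) * (1 - e) * (ρ g₂ : E)) ≠ 0) :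
    ∃ (R : GMA A) (ρ' : G →* R.Algˣ), R.IsFaithful ∧ Module.Finite A R.Alg ∧
      ∀ g, (ρ' g : R.Alg).tr = tr (ρ g : E) := by
  let x : G → G → A := fun g k => tr (e * (ρ g : E) * (1 - e) * (ρ k : E))
  have hx : ∀ g k g' k', x g k * x g' k' = x g k' * x g' k :=
    fun g k g' k' => h.tr_mul_tr he ht _ _ _ _
  let r := x g₁ g₂
  -- Fixing `g₁` and `g₂` realizes the entries inside `A`, as `b(g) = x g g₂` and `c(k) = x g₁ k`.
  -- By rank one `b(g) c(k) = r * x g k`, so the pairing of `B` and `C` has to be the product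
  -- divided by `r`.
  let B : Ideal A := Ideal.span (Set.range fun g => x g g₂)
  let C : Ideal A := Ideal.span (Set.range fun g => x g₁ g)
  have hBC : ∀ b ∈ B, ∀ c ∈ C, r ∣ b * c := by
    intro b hb c hc
    rw [← Ideal.mem_span_singleton]
    refine (Ideal.mul_le.mp ?_) b hb c hc
    rw [Ideal.span_mul_span, Ideal.span_le]
    intro y hy
    obtain ⟨_, ⟨g, rfl⟩, _, ⟨k, rfl⟩, rfl⟩ := hy
    simp only [SetLike.mem_coe, Ideal.mem_span_singleton]
    exact ⟨x g k, by rw [hx g g₂ g₁ k, mul_comm]⟩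
  choose m hm using fun (b : B) (c : C) => hBC b b.2 c c.2
  have hr' : r ≠ 0 := hr
  let R : GMA A :=
    { B := B
      C := C
      m := LinearMap.mk₂ A m
        (fun b b' c => mul_left_cancel₀ hr' (by
          rw [mul_add, ← hm, ← hm, ← hm]; push_cast; ring))
        (fun s b c => mul_left_cancel₀ hr' (by
          rw [smul_eq_mul, mul_left_comm, ← hm, ← hm]; push_cast [smul_eq_mul]; ring))
        (fun b c c' => mul_left_cancel₀ hr' (by
          rw [mul_add, ← hm, ← hm, ← hm]; push_cast; ring))
        (fun s b c => mul_left_cancel₀ hr' (by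
          rw [smul_eq_mul, mul_left_comm, ← hm, ← hm]; push_cast [smul_eq_mul]; ring))
      assoc_B := fun b b' c => Subtype.ext (mul_left_cancel₀ hr' (by
        simp only [LinearMap.mk₂_apply, Submodule.coe_smul, smul_eq_mul]
        rw [← mul_assoc, ← hm, ← mul_assoc, ← hm]; ring))
      assoc_C := fun b c c' => Subtype.ext (mul_left_cancel₀ hr' (by
        simp only [LinearMap.mk₂_apply, Submodule.coe_smul, smul_eq_mul]
        rw [← mul_assoc, ← hm, ← mul_assoc, ← hm]; ring)) }
  have hmR : ∀ (b : B) (c : C), r * R.m b c = b * c := fun b c => (hm b c).symm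
  let bb : G → R.B := fun g => (⟨x g g₂, Ideal.subset_span ⟨g, rfl⟩⟩ : B)
  let cc : G → R.C := fun g => (⟨x g₁ g, Ideal.subset_span ⟨g, rfl⟩⟩ : C)
  have hmx : ∀ g k, R.m (bb g) (cc k) = x g k := fun g k => mul_left_cancel₀ hr' (by
    rw [hmR]; change x g g₂ * x g₁ k = x g₁ g₂ * x g k; rw [hx g g₂, mul_comm])
  have hf := IsIdempotentElem.one_sub he
  let f : G →* R.Alg :=
    { toFun := fun g => GMA.Alg.mk (tr (e * (ρ g : E))) (bb g) (cc g) (tr ((1 - e) * (ρ g : E)))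
      map_one' := by
        apply GMA.Alg.ext'
        · simp [ht]
        · refine Subtype.ext ?_
          change tr (e * (ρ 1 : E) * (1 - e) * (ρ g₂ : E)) = 0
          rw [map_one, Units.val_one, mul_one, mul_compl_self he, zero_mul, map_zero]
        · refine Subtype.ext ?_
          change tr (e * (ρ g₁ : E) * (1 - e) * (ρ 1 : E)) = 0
          rw [map_one, Units.val_one, mul_one, mul_assoc, h.comm, mul_assoc, compl_mul_self he,
            mul_zero, map_zero]
        · simp [h.one, ht]; norm_num
      map_mul' := fun g k => by
        apply GMA.Alg.ext'
        · simp only [GMA.Alg.a_mk, GMA.Alg.a_mul, GMA.Alg.b_mk, GMA.Alg.c_mk, hmx, map_mul,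
            Units.val_mul]
          rw [h.tr_mul_diag, h.corner he ht, smul_mul_assoc, map_smul, smul_eq_mul]
        · refine Subtype.ext ?_
          change tr (e * (ρ (g * k) : E) * (1 - e) * (ρ g₂ : E)) =
            tr (e * (ρ g : E)) * x k g₂ + tr ((1 - e) * (ρ k : E)) * x g g₂
          rw [map_mul ρ, Units.val_mul, h.tr_upper_mul he ht]
        · refine Subtype.ext ?_
          change tr (e * (ρ g₁ : E) * (1 - e) * (ρ (g * k) : E)) =
            tr (e * (ρ k : E)) * x g₁ g + tr ((1 - e) * (ρ g : E)) * x g₁ k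
          rw [map_mul ρ, Units.val_mul, h.tr_lower_mul he ht]
        · simp only [GMA.Alg.d_mk, GMA.Alg.d_mul, GMA.Alg.b_mk, GMA.Alg.c_mk, hmx, map_mul,
            Units.val_mul]
          rw [h.tr_mul_diag, h.corner hf (h.tr_compl ht), smul_mul_assoc, map_smul, smul_eq_mul,
            sub_sub_cancel]
          congr 1
          change _ = tr (e * (ρ k : E) * (1 - e) * (ρ g : E))
          rw [mul_assoc ((1 - e) * (ρ g : E)), h.comm]
          simp only [mul_assoc] }
  refine ⟨R, f.toHomUnits, ?_, ?_, fun g => ?_⟩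
  · rintro y - hy
    have h1 := hy (GMA.Alg.mk 1 0 0 0)
    have h2 := hy (GMA.Alg.mk 0 0 0 1)
    have h3 := hy (GMA.Alg.mk 0 (bb g₁) 0 0)
    have h4 := hy (GMA.Alg.mk 0 0 (cc g₂) 0)
    simp only [GMA.Alg.tr, GMA.Alg.a_mul, GMA.Alg.d_mul, GMA.Alg.a_mk, GMA.Alg.b_mk,
      GMA.Alg.c_mk, GMA.Alg.d_mk, map_zero, LinearMap.zero_apply, mul_zero, mul_one, add_zero,
      zero_add] at h1 h2 h3 h4
    refine GMA.Alg.ext' h1 (Subtype.ext ?_) (Subtype.ext ?_) h2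
    · have h5 := hmR y.b (cc g₂)
      rw [h4, mul_zero] at h5
      exact ((mul_eq_zero.mp h5.symm).resolve_right hr')
    · have h5 := hmR (bb g₁) y.c
      rw [h3, mul_zero] at h5
      exact ((mul_eq_zero.mp h5.symm).resolve_left hr')
  · exact inferInstanceAs (Module.Finite A (A × B × C × A))
  · change tr (e * (ρ g : E)) + tr ((1 - e) * (ρ g : E)) = _
    rw [← map_add, ← add_mul, add_sub_cancel, one_mul]

/-! ### Closed subrings of compact noetherian local rings -/

section CompactLocal

variable {A : Type*} [CommRing A] [IsLocalRing A] [IsNoetherianRing A] [TopologicalSpace A]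
  [IsTopologicalRing A] [CompactSpace A] [T2Space A]

theorem eq_zero_of_forall_mem_maximalIdeal_pow {a : A} (h : ∀ n, a ∈ maximalIdeal A ^ n) :
    a = 0 := by
  have h1 : a ∈ (⨅ n : ℕ, maximalIdeal A ^ n) := by simpa using h
  rwa [Ideal.iInf_pow_eq_bot_of_isLocalRing _ (maximalIdeal.isMaximal A).ne_top] at h1

theorem isClosed_maximalIdeal_pow (n : ℕ) :
    IsClosed ((maximalIdeal A ^ n : Ideal A) : Set A) :=
  IsNoetherianRing.isClosed_ideal _

/-- The powers of the maximal ideal are open; they are also compact with intersection zero, so one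
of them enters any given neighbourhood of zero. -/
theorem hasBasis_nhds_zero_maximalIdeal_pow :
    (𝓝 (0 : A)).HasBasis (fun _ : ℕ => True) fun n => ((maximalIdeal A ^ n : Ideal A) : Set A) := by
  refine ⟨fun U => ⟨fun hU => ?_, ?_⟩⟩
  swap
  · rintro ⟨n, -, hn⟩
    exact Filter.mem_of_superset ((isOpen_maximalIdeal_pow A n).mem_nhds (zero_mem _)) hn
  have h1 : Directed (· ⊇ ·) fun n : ℕ => ((maximalIdeal A ^ n : Ideal A) : Set A) :=
    directed_of_isDirected_le fun _ _ h => Ideal.pow_le_pow_right h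
  obtain ⟨n, hn⟩ := exists_subset_nhds_of_isCompact' h1
    (fun n => (isClosed_maximalIdeal_pow n).isCompact) isClosed_maximalIdeal_pow
    (U := U) (fun x hx => by
      rw [eq_zero_of_forall_mem_maximalIdeal_pow (fun n => Set.mem_iInter.mp hx n)]
      exact hU)
  exact ⟨n, trivial, hn⟩

theorem mem_of_forall_sub_mem_maximalIdeal_pow {S : Set A} (hS : IsClosed S) {a : A}
    (h : ∀ n, ∃ s ∈ S, s - a ∈ maximalIdeal A ^ n) : a ∈ S := by
  rw [← hS.closure_eq, mem_closure_iff_nhds]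
  intro U hU
  have h1 : (fun x => x + a) ⁻¹' U ∈ 𝓝 (0 : A) :=
    (continuous_add_const a).continuousAt.preimage_mem_nhds (by rwa [zero_add])
  obtain ⟨n, -, hn⟩ := hasBasis_nhds_zero_maximalIdeal_pow.mem_iff.mp h1
  obtain ⟨s, hs, hsa⟩ := h n
  have h2 := hn hsa
  rw [Set.mem_preimage, sub_add_cancel] at h2
  exact ⟨s, h2, hs⟩

/-- Nested closed cosets meet by compactness. Completeness is what Hensel's lemma asks for. -/
theorem isAdicComplete_maximalIdeal : IsAdicComplete (maximalIdeal A) A where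
  toIsHausdorff := inferInstance
  prec' := by
    intro f hf
    simp only [smul_eq_mul, Ideal.mul_top, SModEq.sub_mem] at hf ⊢
    let C : ℕ → Set A := fun n => {x | f n - x ∈ maximalIdeal A ^ n}
    have hC : ∀ n, IsClosed (C n) := fun n =>
      (isClosed_maximalIdeal_pow n).preimage (by fun_prop)
    obtain ⟨L, hL⟩ := IsCompact.nonempty_iInter_of_sequence_nonempty_isCompact_isClosed C
      (fun n x hx => by
        have h1 := hf (Nat.le_succ n)
        have h2 : f (n + 1) - x ∈ maximalIdeal A ^ n := Ideal.pow_le_pow_right (Nat.le_succ n) hx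
        simpa [C] using add_mem h1 h2)
      (fun n => ⟨f n, by simp [C]⟩) (hC 0).isCompact hC
    exact ⟨L, fun n => Set.mem_iInter.mp hL n⟩

/-- A closed subring of a compact noetherian local ring is local, and the inclusion is local. -/
theorem Subring.isLocalHom_subtype_of_isClosed {S : Subring A} (hS : IsClosed (S : Set A)) :
    IsLocalHom S.subtype where
  map_nonunit a ha := by
    obtain ⟨b, hb⟩ := ha.exists_right_inv
    exact IsUnit.of_mul_eq_one (⟨b, mem_of_mul_eq_one hS a.2 hb⟩ : S) (Subtype.ext hb)

/-- The ring `S` is a quotient of a power series ring over `ℤ`, evaluated at `p` and at the `a i`.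
Modulo the ideal generated by these values `S` is the image of `ℤ`, and completeness lifts this
surjectivity. -/
theorem Subring.isNoetherianRing_of_isClosed {S : Subring A} (hS : IsClosed (S : Set A))
    {p : ℕ} (hp : p ≠ 0) (hpm : (p : A) ∈ maximalIdeal A) {ι : Type*} [Finite ι] (a : ι → A)
    (haS : ∀ i, a i ∈ S) (ham : ∀ i, a i ∈ maximalIdeal A)
    (hSle : S ≤ (Subring.closure (Set.range a)).topologicalClosure) : IsNoetherianRing S := by
  have hcS : CompactSpace S := isCompact_iff_compactSpace.mp hS.isCompact
  let J : ℕ → Ideal S := fun n => (maximalIdeal A ^ n).comap S.subtype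
  have hbasis : (𝓝 (0 : S)).HasBasis (fun _ : ℕ => True) fun n => (J n : Set S) := by
    rw [nhds_subtype_eq_comap]
    exact hasBasis_nhds_zero_maximalIdeal_pow.comap _
  have hlin : IsLinearTopology S S := IsLinearTopology.mk_of_hasBasis S hbasis
  let _ : UniformSpace S := IsTopologicalAddGroup.rightUniformSpace S
  have _ : IsUniformAddGroup S := isUniformAddGroup_of_addCommGroup
  -- The extra variable takes the value `p`. Then only `p` classes of integers occur modulo the
  -- ideal, which makes the set `T` of elements congruent to an integer closed.
  let b : Option ι → S := fun i => i.elim (p : S) fun i => ⟨a i, haS i⟩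
  have hbm : ∀ i, (b i : A) ∈ maximalIdeal A := by
    rintro (_ | i)
    · simpa [b] using hpm
    · exact ham i
  have hb : MvPowerSeries.HasEval b := by
    refine ⟨fun i => ?_, by simp⟩
    rw [IsTopologicallyNilpotent, hbasis.tendsto_right_iff]
    intro n _
    filter_upwards [Filter.eventually_ge_atTop n] with k hk
    change ((b i ^ k : S) : A) ∈ maximalIdeal A ^ n
    rw [Subring.coe_pow]
    exact Ideal.pow_le_pow_right hk (Ideal.pow_mem_pow (hbm i) k)
  let f : MvPowerSeries (Option ι) ℤ →+* S :=
    MvPowerSeries.eval₂Hom (φ := Int.castRingHom S) continuous_of_discreteTopology hb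
  have hfX : ∀ i, f (MvPowerSeries.X i) = b i := fun i => by
    rw [MvPowerSeries.coe_eval₂Hom, MvPowerSeries.eval₂_X]
  let I : Ideal (MvPowerSeries (Option ι) ℤ) := Ideal.span (Set.range MvPowerSeries.X)
  have hmap : I.map f = Ideal.span (Set.range b) := by
    rw [Ideal.map_span, ← Set.range_comp]
    congr 2
    ext1 i
    exact hfX i
  have hle : I.map f ≤ J 1 := by
    rw [hmap, Ideal.span_le]
    rintro _ ⟨i, rfl⟩
    change (b i : A) ∈ maximalIdeal A ^ 1
    rw [pow_one]; exact hbm i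
  have haus : IsHausdorff (I.map f) S := by
    refine ⟨fun x hx => Subtype.ext (eq_zero_of_forall_mem_maximalIdeal_pow fun n => ?_)⟩
    have h1 := hx n
    rw [SModEq.zero, smul_eq_mul, Ideal.mul_top] at h1
    have h2 : J 1 ^ n ≤ J n := by
      refine (Ideal.le_comap_pow _ _).trans ?_
      rw [pow_one]
    exact h2 (Ideal.pow_right_mono hle n h1)
  refine isNoetherianRing_of_surjective _ _ f (surjective_of_mk_map_comp_surjective (I := I) f ?_)
  intro y
  obtain ⟨y, rfl⟩ := Ideal.Quotient.mk_surjective y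
  have hIcl : IsClosed ((I.map f : Ideal S) : Set S) := by
    refine (Ideal.isCompact_of_fg ?_).isClosed
    rw [hmap]
    exact ⟨(Set.finite_range b).toFinset, by simp⟩
  let T : Subring S := ((Ideal.Quotient.mk (I.map f)).comp (Int.castRingHom S)).range.comap
    (Ideal.Quotient.mk (I.map f))
  have hTmem : ∀ s : S, s ∈ T ↔ ∃ k : ℤ, s - k ∈ I.map f := by
    intro s
    constructor
    · rintro ⟨k, hk⟩
      exact ⟨k, Ideal.Quotient.eq.mp hk.symm⟩
    · rintro ⟨k, hk⟩
      exact ⟨k, (Ideal.Quotient.eq.mpr hk).symm⟩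
  have hpI : (p : S) ∈ I.map f := by
    rw [hmap]; exact Ideal.subset_span ⟨none, rfl⟩
  have hTcl : IsClosed (T : Set S) := by
    have h1 : (T : Set S) = ⋃ k ∈ Finset.range p, {s : S | s - (k : S) ∈ I.map f} := by
      ext s
      simp only [SetLike.mem_coe, hTmem, Set.mem_iUnion, Finset.mem_range, Set.mem_ofPred_eq,
        exists_prop]
      constructor
      · rintro ⟨k, hk⟩
        have hp0 : (p : ℤ) ≠ 0 := by exact_mod_cast hp
        refine ⟨(k % p).toNat, ?_, ?_⟩
        · have := Int.emod_lt_of_pos k (by omega : (0 : ℤ) < p)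
          have := Int.emod_nonneg k hp0
          omega
        · have h2 : (((k % p).toNat : ℕ) : S) = ((k % p : ℤ) : S) := by
            rw [← Int.cast_natCast, Int.toNat_of_nonneg (Int.emod_nonneg k hp0)]
          have h3 : ((k : ℤ) : S) = ((k % p : ℤ) : S) + p * ((k / p : ℤ) : S) := by
            exact_mod_cast congrArg (Int.cast : ℤ → S) (Int.emod_add_mul_ediv k p).symm
          rw [h2]
          rw [h3] at hk
          have h4 := Ideal.mul_mem_right ((k / p : ℤ) : S) _ hpI
          have h5 := add_mem hk h4
          rwa [← sub_sub, sub_add_cancel] at h5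
      · rintro ⟨k, -, hk⟩
        exact ⟨k, by simpa using hk⟩
    rw [h1]
    exact isClosed_biUnion_finset fun k _ => hIcl.preimage (by fun_prop)
  have hT : S ≤ T.map S.subtype := by
    have h1 : IsClosed ((T.map S.subtype : Subring A) : Set A) := by
      rw [Subring.coe_map]
      exact (hTcl.isCompact.image continuous_subtype_val).isClosed
    refine hSle.trans (Subring.topologicalClosure_minimal _ ?_ h1)
    rw [Subring.closure_le]
    rintro _ ⟨i, rfl⟩
    refine ⟨⟨a i, haS i⟩, (hTmem _).mpr ⟨0, ?_⟩, rfl⟩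
    rw [Int.cast_zero, sub_zero, hmap]
    exact Ideal.subset_span ⟨some i, rfl⟩
  obtain ⟨z, hz, hzy⟩ := hT y.2
  have hzy' : z = y := Subtype.ext hzy
  obtain ⟨k, hk⟩ := (hTmem z).mp hz
  rw [hzy'] at hk
  refine ⟨(k : MvPowerSeries (Option ι) ℤ), ?_⟩
  rw [RingHom.comp_apply, map_intCast]
  exact (Ideal.Quotient.eq.mpr hk).symm

end CompactLocal

/-! ### Matrix entries -/

/-- `a`, `d` and `x` are the diagonal entries and the products of off-diagonal entries of a
representation by generalized matrices of size two. -/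
structure IsMatrixEntries {G A : Type*} [Group G] [CommRing A] (a d : G → A) (x : G → G → A) :
    Prop where
  one_a : a 1 = 1
  one_d : d 1 = 1
  one_left : ∀ g, x 1 g = 0
  one_right : ∀ g, x g 1 = 0
  mul_a : ∀ g k, a (g * k) = a g * a k + x g k
  mul_d : ∀ g k, d (g * k) = d g * d k + x k g
  mul_left : ∀ g k l, x (g * k) l = a g * x k l + d k * x g l
  mul_right : ∀ g k l, x l (g * k) = a k * x l g + d g * x l k
  rank_one : ∀ g k g' k', x g k * x g' k' = x g k' * x g' k

/-- The upper left entry of `g` in a basis where `g₀` is diagonal, with second eigenvalue `β` and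
inverse difference of eigenvalues `δ`. -/
def diagEntry {G A : Type*} [Group G] [CommRing A] (t : G → A) (g₀ : G) (β δ : A) (g : G) : A :=
  δ * (t (g₀ * g) - β * t g)

/-- The identities are computed with an idempotent of the quadratic algebra of
`exists_isQuadraticTrace`; once proved, they refer to `t` only. -/
theorem IsPseudoRep.isMatrixEntries {G : Type v} [Group G] {A : Type u} [CommRing A] {t d : G → A}
    (h : IsPseudoRep t d) {c : A} (hc : 2 * c = 1) {g₀ : G} {α β δ : A} (hδ : (α - β) * δ = 1)
    (htg : t g₀ = α + β) (hdg : d g₀ = α * β) :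
    IsMatrixEntries (diagEntry t g₀ β δ) (diagEntry t g₀ α (-δ))
        (fun g k => δ * δ * offDiagonal t g₀ α β g k) ∧
      (∀ g, diagEntry t g₀ β δ g + diagEntry t g₀ α (-δ) g = t g) ∧
      diagEntry t g₀ β δ g₀ = α ∧ diagEntry t g₀ α (-δ) g₀ = β ∧
      (∀ g, offDiagonal t g₀ α β g₀ g = 0) ∧ (∀ g, offDiagonal t g₀ α β g g₀ = 0) := by
  obtain ⟨E, _, _, tr, ρ, Q, ht⟩ := h.exists_isQuadraticTrace
  have hsq : (ρ g₀ : E) * ρ g₀ = tr (ρ g₀ : E) • (ρ g₀ : E) - (α * β) • (1 : E) := by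
    have h1 := Q.sq (ρ g₀ : E) c hc
    have h2 := h.two_mul_d g₀
    rw [← Units.val_mul, ← map_mul ρ] at h1 ⊢
    simp only [ht] at h1 ⊢
    have h3 : d g₀ = c * (t g₀ * t g₀ - t (g₀ * g₀)) := by
      linear_combination c * h2 - d g₀ * hc
    rw [h1, ← hdg, h3]
  obtain ⟨e, hedef⟩ : ∃ e : E, e = δ • ((ρ g₀ : E) - β • (1 : E)) := ⟨_, rfl⟩
  obtain ⟨he, het, hρ⟩ := Q.exists_projection ((ht g₀).trans htg) hsq hδ hedef
  have hf := (IsIdempotentElem.one_sub he).eq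
  have hx : ∀ g k, δ * δ * offDiagonal t g₀ α β g k = tr (e * (ρ g : E) * (1 - e) * (ρ k : E)) :=
    fun g k => (Q.offDiagonal_eq (ρ := ρ) ht hδ hedef g k).symm
  have ha : ∀ g, diagEntry t g₀ β δ g = tr (e * (ρ g : E)) := fun g => by
    simp only [diagEntry, hedef, ← ht, map_mul, Units.val_mul, smul_mul_assoc, sub_mul, one_mul,
      map_smul, map_sub, smul_eq_mul]
  have hd : ∀ g, diagEntry t g₀ α (-δ) g = tr ((1 - e) * (ρ g : E)) := fun g => by
    rw [sub_mul, one_mul, map_sub, ← ha, ht]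
    simp only [diagEntry]
    linear_combination t g * hδ
  have hunit : IsUnit (δ * δ) := by
    have : IsUnit δ := IsUnit.of_mul_eq_one (α - β) (by rw [mul_comm, hδ])
    exact this.mul this
  have hsum : ∀ g, diagEntry t g₀ β δ g + diagEntry t g₀ α (-δ) g = t g := fun g => by
    rw [ha, hd, ← map_add, ← add_mul, add_sub_cancel, one_mul, ht]
  have heg : e * (ρ g₀ : E) = α • e := by
    rw [hρ, mul_add, mul_smul_comm, mul_smul_comm, he, mul_compl_self he, smul_zero, add_zero]
  have hfg : (1 - e) * (ρ g₀ : E) = β • (1 - e) := by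
    rw [hρ, mul_add, mul_smul_comm, mul_smul_comm, hf, compl_mul_self he, smul_zero, zero_add]
  have hag : diagEntry t g₀ β δ g₀ = α := by
    rw [ha, heg, map_smul, het, smul_eq_mul, mul_one]
  refine ⟨⟨?_, ?_, ?_, ?_, ?_, ?_, ?_, ?_, ?_⟩, hsum, hag, ?_, ?_, ?_⟩
  · rw [ha, map_one, Units.val_one, mul_one, het]
  · rw [hd, map_one, Units.val_one, mul_one, Q.tr_compl het]
  · intro g
    rw [hx, map_one, Units.val_one, mul_one, mul_compl_self he, zero_mul, map_zero]
  · intro g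
    rw [hx, map_one, Units.val_one, mul_one, mul_assoc, Q.comm, mul_assoc, compl_mul_self he,
      mul_zero, map_zero]
  · intro g k
    rw [ha, ha, ha, hx, map_mul ρ, Units.val_mul, Q.tr_mul_diag, Q.corner he het, smul_mul_assoc,
      map_smul, smul_eq_mul]
  · intro g k
    rw [hd, hd, hd, hx, map_mul ρ, Units.val_mul, Q.tr_mul_diag, Q.corner hf (Q.tr_compl het),
      smul_mul_assoc, map_smul, smul_eq_mul, sub_sub_cancel]
    congr 1
    rw [mul_assoc ((1 - e) * (ρ g : E)), Q.comm]
    simp only [mul_assoc]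
  · intro g k l
    rw [hx, hx, hx, ha, hd, map_mul ρ, Units.val_mul, Q.tr_upper_mul he het]
  · intro g k l
    rw [hx, hx, hx, ha, hd, map_mul ρ, Units.val_mul, Q.tr_lower_mul he het]
  · intro g k g' k'
    rw [hx, hx, hx, hx, Q.tr_mul_tr he het]
  · have h1 := hsum g₀
    rw [hag, htg] at h1
    exact add_left_cancel h1
  · intro g
    refine hunit.mul_left_cancel ?_
    rw [hx, heg, smul_mul_assoc, mul_compl_self he, smul_zero, zero_mul, map_zero, mul_zero]
  · intro g
    refine hunit.mul_left_cancel ?_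
    rw [hx, mul_assoc, hfg, mul_smul_comm, map_smul, mul_assoc, Q.comm, mul_assoc,
      compl_mul_self he, mul_zero, map_zero, smul_zero, mul_zero]

namespace IsMatrixEntries

variable {G A : Type*} [Group G] [CommRing A] {a d : G → A} {x : G → G → A}
  (h : IsMatrixEntries a d x)

include h

theorem symm : IsMatrixEntries d a fun g k => x k g where
  one_a := h.one_d
  one_d := h.one_a
  one_left := h.one_right
  one_right := h.one_left
  mul_a := h.mul_d
  mul_d := h.mul_a
  mul_left g k l := by rw [h.mul_right]; ring
  mul_right g k l := by rw [h.mul_left]; ring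
  rank_one g k g' k' := by rw [h.rank_one]; ring

/-- Nonzero values `x g k` and `x k' g'` with `g`, `g'` in `H` would have the product `x g g' * x k'
k`, which is zero. -/
theorem eq_zero_or_eq_zero [IsDomain A] {H : Set G} (hH : ∀ g ∈ H, ∀ k ∈ H, x g k = 0) :
    (∀ g ∈ H, ∀ k, x g k = 0) ∨ ∀ g ∈ H, ∀ k, x k g = 0 := by
  by_contra! hcon
  obtain ⟨⟨g, hg, k, hk⟩, g', hg', k', hk'⟩ := hcon
  have h1 := h.rank_one g k k' g'
  rw [hH g hg g' hg', zero_mul] at h1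
  exact (mul_ne_zero hk hk') h1

/-- If the lower left entries vanish on `H`, they also vanish on the elements whose commutator with
a diagonal element is in `H`. -/
theorem eq_zero_of_mul_eq [IsDomain A] {H : Set G} (hH : ∀ k ∈ H, ∀ g, x g k = 0) {g₀ : G}
    (h0 : ∀ g, x g g₀ = 0) (hu : ∀ k ∈ H, a g₀ - d g₀ * d k ≠ 0) {g k : G} (hk : k ∈ H)
    (hg : g * g₀ = g₀ * (k * g)) (l : G) : x l g = 0 := by
  have h1 := h.mul_right g g₀ l
  rw [hg, h.mul_right, h.mul_right, h0, hH k hk] at h1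
  have h2 : (a g₀ - d g₀ * d k) * x l g = 0 := by linear_combination -h1
  exact (mul_eq_zero.mp h2).resolve_left (hu k hk)

/-- Induction on words closes as soon as the off-diagonal products of a word with the generators are
tracked on both sides. -/
theorem mem_of_mem_closure {F : Set G} {S : Subring A} (ha : ∀ g ∈ F, a g ∈ S)
    (hd : ∀ g ∈ F, d g ∈ S) (hx : ∀ g ∈ F, ∀ k ∈ F, x g k ∈ S) {g : G}
    (hg : g ∈ Submonoid.closure F) : a g ∈ S ∧ d g ∈ S := by
  have key : ∀ g ∈ Submonoid.closure F, a g ∈ S ∧ d g ∈ S ∧ ∀ k ∈ F, x g k ∈ S ∧ x k g ∈ S := by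
    intro g hg
    induction hg using Submonoid.closure_induction_right with
    | one => exact ⟨by rw [h.one_a]; exact S.one_mem, by rw [h.one_d]; exact S.one_mem,
        fun k _ => by rw [h.one_left, h.one_right]; exact ⟨S.zero_mem, S.zero_mem⟩⟩
    | mul_right g _ s hs ih =>
      obtain ⟨h1, h2, h3⟩ := ih
      refine ⟨?_, ?_, fun k hk => ⟨?_, ?_⟩⟩
      · rw [h.mul_a]; exact S.add_mem (S.mul_mem h1 (ha s hs)) (h3 s hs).1
      · rw [h.mul_d]; exact S.add_mem (S.mul_mem h2 (hd s hs)) (h3 s hs).2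
      · rw [h.mul_left]
        exact S.add_mem (S.mul_mem h1 (hx s hs k hk)) (S.mul_mem (hd s hs) (h3 k hk).1)
      · rw [h.mul_right]
        exact S.add_mem (S.mul_mem (ha s hs) (h3 k hk).2) (S.mul_mem h2 (hx k hk s hs))
  exact ⟨(key g hg).1, (key g hg).2.1⟩

end IsMatrixEntries

/-! ### Factorization through the maximal pro-`p` quotient -/

section ProP

theorem Ideal.span_singleton_sup_sq_le {R : Type*} [CommRing R] {y : R} {J K : Ideal R}
    (h : y * y ∈ J ⊔ K) : (Ideal.span {y} ⊔ J) ^ 2 ≤ J ⊔ K := by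
  rw [pow_two, Ideal.mul_le]
  intro r hr s hs
  obtain ⟨r₁, hr₁, r₂, hr₂, rfl⟩ := Submodule.mem_sup.mp hr
  obtain ⟨s₁, hs₁, s₂, hs₂, rfl⟩ := Submodule.mem_sup.mp hs
  obtain ⟨u, rfl⟩ := Ideal.mem_span_singleton'.mp hr₁
  obtain ⟨v, rfl⟩ := Ideal.mem_span_singleton'.mp hs₁
  have e : (u * y + r₂) * (v * y + s₂) = u * v * (y * y) + ((u * y + r₂) * s₂ + v * y * r₂) := by
    ring
  rw [e]
  exact add_mem (Ideal.mul_mem_left _ _ h)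
    (Ideal.mem_sup_left (add_mem (Ideal.mul_mem_left _ _ hs₂) (Ideal.mul_mem_left _ _ hr₂)))

theorem Ideal.sup_pow_le {R : Type*} [CommRing R] (J K : Ideal R) (n : ℕ) :
    (J ⊔ K) ^ n ≤ J ^ n ⊔ K := by
  induction n with
  | zero => simp
  | succ n ih =>
    rw [pow_succ, pow_succ]
    refine (Ideal.mul_mono_left ih).trans ?_
    rw [Ideal.sup_mul, Ideal.mul_sup (J ^ n)]
    have h1 : J ^ n * K ≤ K := Ideal.mul_le.mpr fun _ _ _ hs => K.mul_mem_left _ hs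
    have h2 : K * (J ⊔ K) ≤ K := Ideal.mul_le.mpr fun _ hr _ _ => K.mul_mem_right _ hr
    exact sup_le (sup_le le_sup_left (h1.trans le_sup_right)) (h2.trans le_sup_right)

-- Let `X` act as `ρ k`. The ideal `I = (X - 1, J)` of `A[X]` contains `p`, and `I ^ 2` lies in `J
-- A[X]` plus the annihilator `K`, because `(X - 1) ^ 2` is `(t k - 2) X` plus the characteristic
-- polynomial. As `X ^ p ^ (2 n)` is `1` modulo `I ^ (2 n)`, it is `1` modulo `J ^ n A[X]` and the
-- annihilator.
open Polynomial in
theorem IsPseudoRep.exists_pow_sub_mem {G : Type v} [Group G] {A : Type u} [CommRing A]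
    {t d : G → A} (h : IsPseudoRep t d) {c : A} (hc : 2 * c = 1) {J : Ideal A} {p : ℕ}
    [Fact p.Prime]
    (hp : (p : A) ∈ J) {k : G} (hd : d k = 1) (ht : t k - 2 ∈ J) (n : ℕ) :
    ∃ j : ℕ, ∀ g, t (k ^ p ^ j * g) - t g ∈ J ^ n := by
  obtain ⟨E, _, _, tr, ρ, Q, htr⟩ := h.exists_isQuadraticTrace
  have hsq : (ρ k : E) * ρ k = t k • (ρ k : E) - (1 : E) := by
    have h1 := Q.sq (ρ k : E) c hc
    have h2 := h.two_mul_d k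
    rw [← Units.val_mul, ← map_mul, htr, htr, ← h2, hd, mul_one, mul_comm c, hc, one_smul] at h1
    rw [← Units.val_mul, ← map_mul, h1]
  let ev : A[X] →ₐ[A] E := aeval (ρ k : E)
  let K : Ideal A[X] := RingHom.ker ev
  let J' : Ideal A[X] := J.map C
  let I : Ideal A[X] := Ideal.span {X - 1} ⊔ J'
  have hI : I ^ 2 ≤ J' ⊔ K := by
    have h1 : (X - 1 : A[X]) * (X - 1) ∈ J' ⊔ K := by
      have e1 : (X - 1 : A[X]) * (X - 1) = C (t k - 2) * X + (X * X - C (t k) * X + 1) := by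
        rw [map_sub, C_ofNat]; ring
      rw [e1]
      refine add_mem (Ideal.mem_sup_left (Ideal.mul_mem_right _ _ (Ideal.mem_map_of_mem _ ht)))
        (Ideal.mem_sup_right ?_)
      rw [RingHom.mem_ker]
      simp only [ev, map_add, map_sub, map_mul, aeval_X, aeval_C, map_one, hsq]
      rw [Algebra.smul_def]; abel
    exact Ideal.span_singleton_sup_sq_le h1
  have hpI : (p : A[X]) ∈ I := by
    refine Ideal.mem_sup_right ?_
    have := Ideal.mem_map_of_mem (C : A →+* A[X]) hp
    rwa [map_natCast] at this
  have h1 : (X : A[X]) ≡ 1 [SMOD I] := by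
    rw [SModEq.sub_mem]
    exact Ideal.mem_sup_left (Ideal.mem_span_singleton_self _)
  have h2 := SModEq.pow_pow_add_one hpI (m := 2 * n) h1
  rw [SModEq.sub_mem, one_pow] at h2
  have h3 : (X : A[X]) ^ p ^ (2 * n) - 1 ∈ J' ^ n ⊔ K := by
    refine Ideal.sup_pow_le J' K n (Ideal.pow_right_mono hI n ?_)
    rw [← pow_mul]
    exact Ideal.pow_le_pow_right (Nat.le_succ _) h2
  obtain ⟨f, hf, q, hq, hfq⟩ := Submodule.mem_sup.mp h3
  refine ⟨2 * n, fun g => ?_⟩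
  have h4 : t (k ^ p ^ (2 * n) * g) - t g = tr (ev f * (ρ g : E)) := by
    have h5 := congrArg ev hfq
    rw [map_add, (RingHom.mem_ker).mp hq, add_zero, map_sub, map_pow, map_one, aeval_X] at h5
    rw [h5, sub_mul, one_mul, map_sub, htr, ← htr, map_mul, map_pow, Units.val_mul,
      Units.val_pow_eq_pow_val]
  have h6 : J' ^ n = (J ^ n).map C := (Ideal.map_pow _ _ _).symm
  rw [h6, Ideal.mem_map_C_iff] at hf
  rw [h4, aeval_eq_sum_range, Finset.sum_mul, map_sum]
  refine Ideal.sum_mem _ fun i _ => ?_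
  rw [smul_mul_assoc, map_smul, smul_eq_mul]
  exact Ideal.mul_mem_right _ _ (hf i)

/-- Modulo each power of the maximal ideal, the `k` whose multiplication leaves `t` unchanged form
an open normal subgroup of `p`-power index, which contains the kernel. -/
theorem IsPseudoRep.t_mul_of_mem_proPKernel {G : Type v} [Group G] [TopologicalSpace G]
    [IsTopologicalGroup G] [CompactSpace G] {A : Type u} [CommRing A] [IsLocalRing A]
    [IsNoetherianRing A] [TopologicalSpace A]
    [IsTopologicalRing A] [CompactSpace A] [T2Space A] {t d : G → A} (h : IsPseudoRep t d) {c : A}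
    (hc : 2 * c = 1) (htc : Continuous t) {p : ℕ} [Fact p.Prime] (hp : (p : A) ∈ maximalIdeal A)
    {H : Subgroup G} (hH : IsOpen (H : Set G)) (hd : ∀ k ∈ H, d k = 1)
    (ht : ∀ k ∈ H, t k - 2 ∈ maximalIdeal A) {n : H} (hn : n ∈ proPKernel p H) (g : G) :
    t (n * g) = t g := by
  rw [← sub_eq_zero]
  refine eq_zero_of_forall_mem_maximalIdeal_pow fun i => ?_
  have hcH : CompactSpace H :=
    isCompact_iff_compactSpace.mp (Subgroup.isClosed_of_isOpen H hH).isCompact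
  let N : Subgroup H :=
    { carrier := {k | ∀ g : G, t (k * g) - t g ∈ maximalIdeal A ^ i}
      mul_mem' := fun {k l} hk hl g => by
        have h1 := add_mem (hk (l * g)) (hl g)
        rwa [sub_add_sub_cancel, ← mul_assoc] at h1
      one_mem' := fun g => by simp
      inv_mem' := fun {k} hk g => by
        have h1 := hk (((k⁻¹ : H) : G) * g)
        rw [← mul_assoc, ← Subgroup.coe_mul, mul_inv_cancel, Subgroup.coe_one, one_mul] at h1
        rw [← neg_sub]
        exact neg_mem h1 }
  have hNn : N.Normal := ⟨fun k hk l g => by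
    have h1 := hk ((l : G)⁻¹ * g * l)
    have e1 : t (((l * k * l⁻¹ : H) : G) * g) = t (k * ((l : G)⁻¹ * g * l)) := by
      push_cast
      rw [mul_assoc, mul_assoc, h.t_central]
      simp only [mul_assoc]
    have e2 : t ((l : G)⁻¹ * g * l) = t g := by
      rw [mul_assoc, h.t_central, mul_assoc, mul_inv_cancel, mul_one]
    rw [e2] at h1
    rw [e1]
    exact h1⟩
  have hNo : IsOpen (N : Set H) := by
    refine Subgroup.isOpen_of_mem_nhds N (g := 1) ?_
    have h1 : ∀ᶠ k : H in 𝓝 1, ∀ g ∈ (Set.univ : Set G), t (k * g) - t g ∈ maximalIdeal A ^ i := by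
      refine isCompact_univ.eventually_forall_of_forall_eventually fun g _ => ?_
      have h2 : Continuous fun z : H × G => t (z.1 * z.2) - t z.2 := by fun_prop
      have h3 := (isOpen_maximalIdeal_pow A i).preimage h2
      refine h3.mem_nhds ?_
      simp
    filter_upwards [h1] with k hk g
    exact hk g trivial
  have hfin : Finite (H ⧸ N) := Subgroup.quotient_finite_of_isOpen N hNo
  have hpg : IsPGroup p (H ⧸ N) := by
    intro q
    obtain ⟨k, rfl⟩ := QuotientGroup.mk_surjective q
    obtain ⟨j, hj⟩ := h.exists_pow_sub_mem hc hp (hd k k.2) (ht k k.2) i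
    refine ⟨j, ?_⟩
    rw [← QuotientGroup.mk_pow, QuotientGroup.eq_one_iff]
    intro g
    push_cast
    exact hj g
  have h4 : ∃ k : ℕ, N.index = p ^ k := IsPGroup.iff_card.mp hpg
  have h5 : proPKernel p H ≤ N := sInf_le ⟨hNn, hNo, h4⟩
  exact h5 hn g

end ProP

/-! ### Transport of the finiteness condition -/

theorem exists_finite_dense_of_surjective {p : ℕ} {H : Type*} {K : Type*} [Group H] [Group K]
    [TopologicalSpace H] [TopologicalSpace K] (f : H →* K) (hf : Continuous f)
    (hs : Function.Surjective f)
    (h : ∃ S : Set (H ⧸ proPKernel p H), S.Finite ∧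
      Dense ((Subgroup.closure S : Subgroup (H ⧸ proPKernel p H)) : Set (H ⧸ proPKernel p H))) :
    ∃ S : Set (K ⧸ proPKernel p K), S.Finite ∧
      Dense ((Subgroup.closure S : Subgroup (K ⧸ proPKernel p K)) : Set (K ⧸ proPKernel p K)) := by
  obtain ⟨S, hS, hd⟩ := h
  have hle : proPKernel p H ≤ (proPKernel p K).comap f := by
    intro n hn
    rw [Subgroup.mem_comap, proPKernel, Subgroup.mem_sInf]
    rintro N ⟨hN, hNo, k, hk⟩
    rw [proPKernel, Subgroup.mem_sInf] at hn
    exact hn (N.comap f) ⟨hN.comap f, hNo.preimage hf, k, by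
      rw [Subgroup.index_comap_of_surjective N hs, hk]⟩
  let F := QuotientGroup.map (proPKernel p H) (proPKernel p K) f hle
  have hF : Continuous F :=
    (QuotientGroup.continuous_mk.comp hf).quotient_lift _
  have hFs : Function.Surjective F := by
    intro y
    obtain ⟨y, rfl⟩ := QuotientGroup.mk_surjective y
    obtain ⟨x, rfl⟩ := hs y
    exact ⟨x, rfl⟩
  refine ⟨F '' S, hS.image F, ?_⟩
  rw [← MonoidHom.map_closure, Subgroup.coe_map]
  exact hFs.denseRange.dense_image hF hd

theorem SatisfiesPFiniteness.subgroup {p : ℕ} {G : Type v} [Group G] [TopologicalSpace G]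
    (h : SatisfiesPFiniteness p G) {K : Subgroup G} (hK : IsOpen (K : Set G)) :
    SatisfiesPFiniteness p K := by
  intro H hH
  have hH' : IsOpen ((H.map K.subtype : Subgroup G) : Set G) := by
    rw [Subgroup.coe_map]
    exact hK.isOpenMap_subtype_val _ hH
  let e := H.equivMapOfInjective K.subtype K.subtype_injective
  have he : ∀ x : H.map K.subtype, ((e.symm x : K) : G) = x := fun x => by
    conv_rhs => rw [← e.apply_symm_apply x]
    rfl
  refine exists_finite_dense_of_surjective e.symm.toMonoidHom ?_ e.symm.surjective (h _ hH')
  refine continuous_induced_rng.mpr (continuous_induced_rng.mpr ?_)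
  exact continuous_subtype_val.congr fun x => (he x).symm

/-! ### Topological generation of the traces -/

/-- For fixed `n`, the value `t (k * g₀ ^ n)` depends continuously on the class of `k` in the
maximal pro-`p` quotient of `H`. Words in finitely many generators are dense there, and on words
this value is a polynomial in the matrix entries of the generators. -/
theorem IsPseudoRep.exists_finite_generators {G : Type v} [Group G] [TopologicalSpace G]
    [IsTopologicalGroup G] [CompactSpace G] {A : Type u} [CommRing A] [IsLocalRing A]
    [IsNoetherianRing A] [TopologicalSpace A]
    [IsTopologicalRing A] [CompactSpace A] [T2Space A] {t d : G → A} (h : IsPseudoRep t d) {c : A}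
    (hc : 2 * c = 1) (htc : Continuous t) {p : ℕ} [Fact p.Prime] (hp : (p : A) ∈ maximalIdeal A)
    (hG : SatisfiesPFiniteness p G)
    {H : Subgroup G} (hH : IsOpen (H : Set G)) (hd : ∀ k ∈ H, d k = 1)
    (ht : ∀ k ∈ H, t k - 2 ∈ maximalIdeal A)
    {a a' : G → A} {x : G → G → A} (ha : IsMatrixEntries a a' x) (hat : ∀ g, a g + a' g = t g)
    (g₀ : G) :
    ∃ F : Set G, F.Finite ∧ F ⊆ Subgroup.closure (H ∪ {g₀} : Set G) ∧
      ∀ S : Subring A, IsClosed (S : Set A) → (∀ g ∈ F, a g ∈ S) → (∀ g ∈ F, a' g ∈ S) →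
        (∀ g ∈ F, ∀ k ∈ F, x g k ∈ S) → ∀ k ∈ H, ∀ n : ℕ, t (k * g₀ ^ n) ∈ S := by
  obtain ⟨S₀, hS₀, hdense⟩ := hG H hH
  let T : Set H := Quotient.out '' S₀
  -- With the inverses included, every element of the generated group is a monoid word, as
  -- `mem_of_mem_closure` requires.
  let T' : Set G := H.subtype '' (T ∪ T⁻¹)
  have hTf : T.Finite := hS₀.image _
  have hT' : T'.Finite := (hTf.union hTf.inv).image _
  refine ⟨T' ∪ {g₀}, hT'.union (Set.finite_singleton g₀), ?_, ?_⟩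
  · rintro g (⟨k, -, rfl⟩ | rfl)
    · exact Subgroup.subset_closure (Or.inl k.2)
    · exact Subgroup.subset_closure (Or.inr rfl)
  intro S hS h1 h2 h3 k hk n
  have hwd : ∀ (k l : H), k⁻¹ * l ∈ proPKernel p H → t (k * g₀ ^ n) = t (l * g₀ ^ n) := by
    intro k l hkl
    have h4 : k * (k⁻¹ * l) * k⁻¹ ∈ proPKernel p H := (proPKernel_normal p H).conj_mem _ hkl k
    rw [← h.t_mul_of_mem_proPKernel hc htc hp hH hd ht h4]
    congr 1
    push_cast
    group
  let f : H ⧸ proPKernel p H → A :=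
    Quotient.lift (fun k : H => t (k * g₀ ^ n))
      fun k l hkl => hwd k l (QuotientGroup.leftRel_apply.mp hkl)
  have hf : Continuous f := Continuous.quotient_lift (by fun_prop) _
  have hcl : IsClosed (f ⁻¹' S) := hS.preimage hf
  have hsub : ((Subgroup.closure S₀ : Subgroup (H ⧸ proPKernel p H)) : Set _) ⊆ f ⁻¹' S := by
    intro q hq
    have e1 : S₀ = QuotientGroup.mk' (proPKernel p H) '' T := by
      ext q
      constructor
      · intro hq
        exact ⟨Quotient.out q, ⟨q, hq, rfl⟩, QuotientGroup.out_eq' q⟩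
      · rintro ⟨_, ⟨q', hq', rfl⟩, rfl⟩
        rwa [show QuotientGroup.mk' (proPKernel p H) (Quotient.out q') = q' from
          QuotientGroup.out_eq' q']
    rw [e1, ← MonoidHom.map_closure] at hq
    obtain ⟨γ, hγ, rfl⟩ := hq
    have hγ' : γ ∈ Submonoid.closure (T ∪ T⁻¹) := by
      rw [← Subgroup.closure_toSubmonoid]; exact hγ
    have h4 : (γ : G) ∈ Submonoid.closure (T' ∪ {g₀}) := by
      refine Submonoid.closure_mono Set.subset_union_left ?_
      have h5 := Submonoid.mem_map_of_mem (H.subtype : H →* G) hγ'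
      rwa [MonoidHom.map_mclosure] at h5
    have h5 : g₀ ∈ Submonoid.closure (T' ∪ {g₀}) :=
      Submonoid.subset_closure (Set.mem_union_right T' (Set.mem_singleton g₀))
    have h6 : (γ : G) * g₀ ^ n ∈ Submonoid.closure (T' ∪ {g₀}) :=
      Submonoid.mul_mem _ h4 (Submonoid.pow_mem _ h5 n)
    obtain ⟨h7, h8⟩ := ha.mem_of_mem_closure h1 h2 h3 h6
    change t (γ * g₀ ^ n) ∈ S
    rw [← hat]
    exact S.add_mem h7 h8
  have huniv := hcl.closure_subset_iff.mpr hsub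
  rw [hdense.closure_eq] at huniv
  exact huniv (Set.mem_univ (QuotientGroup.mk (⟨k, hk⟩ : H)))

/-! ### Witt vectors of prime fields -/

/-- Successive approximation of the residue by integers. It is used to show that these Witt vectors
map into a closed subring. -/
theorem WittVector.exists_eq_intCast_add {p : ℕ} [Fact p.Prime] {k : Type*} [Field k] [CharP k p]
    [PerfectRing k p] (hk : ∀ x : k, ∃ n : ℤ, (n : k) = x) (x : WittVector p k) (m : ℕ) :
    ∃ (n : ℤ) (y : WittVector p k), x = n + (p : WittVector p k) ^ m * y := by
  induction m with
  | zero => exact ⟨0, x, by simp⟩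
  | succ m ih =>
    obtain ⟨n, y, hxy⟩ := ih
    obtain ⟨r, hr⟩ := hk (WittVector.constantCoeff y)
    have h1 : y - (r : WittVector p k) ∈ Ideal.span {(p : WittVector p k)} := by
      rw [WittVector.mem_span_p_iff_coeff_zero_eq_zero, ← WittVector.constantCoeff_apply, map_sub,
        map_intCast, hr, sub_self]
    obtain ⟨z, hz⟩ := Ideal.mem_span_singleton'.mp h1
    refine ⟨n + p ^ m * r, z, ?_⟩
    push_cast
    rw [hxy]
    linear_combination (-(p : WittVector p k) ^ m) * hz

/-! ### Elements with prescribed Teichmüller eigenvalues -/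

section Teichmuller

theorem pow_pow_eq_self {M : Type*} [Monoid M] {z : M} {p : ℕ} (hz : z ^ p = z) (k : ℕ) :
    z ^ p ^ k = z := by
  induction k with
  | zero => simp
  | succ k ih => rw [pow_succ, pow_mul, ih, hz]

variable {A : Type*} [CommRing A] [IsLocalRing A] [IsNoetherianRing A] [TopologicalSpace A]
  [IsTopologicalRing A] [CompactSpace A] [T2Space A] {p : ℕ} [Fact p.Prime]

/-- The element `α` is the limit of the integers `n ^ p ^ k`, since congruences improve under `p`-th
powers. -/
theorem mem_topologicalClosure_bot_of_pow_eq (hp : (p : A) ∈ maximalIdeal A) {α : A}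
    (hα : α ^ p = α) {n : ℤ} (hn : residue A α = n) : α ∈ (⊥ : Subring A).topologicalClosure := by
  refine mem_of_forall_sub_mem_maximalIdeal_pow (Subring.isClosed_topologicalClosure _) fun k =>
    ⟨(n : A) ^ p ^ k, Subring.le_topologicalClosure _ (pow_mem (intCast_mem _ n) _), ?_⟩
  have h1 : (n : A) ≡ α [SMOD maximalIdeal A] := by
    rw [SModEq.sub_mem, ← residue_eq_zero_iff, map_sub, hn, map_intCast, sub_self]
  have h2 := SModEq.pow_pow_add_one hp h1 k
  rw [SModEq.sub_mem, pow_pow_eq_self hα] at h2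
  exact Ideal.pow_le_pow_right (Nat.le_succ k) h2

/-- The element `g₀` is a limit point of the `g ^ p ^ k`. By Hensel's lemma the characteristic
polynomial of `g` has roots `r`, `s` congruent to `α`, `β`; their `p ^ k`-th powers converge to `α`
and `β`, while `ρ (g ^ p ^ k)` stays constant. -/
theorem IsPseudoRep.exists_teichmuller {G : Type v} [Group G] [TopologicalSpace G]
    [IsTopologicalGroup G] [CompactSpace G] {t d : G → A} (h : IsPseudoRep t d) (htc : Continuous t) (hdc : Continuous d)
    (hp : (p : A) ∈ maximalIdeal A) {Q : Type*} [Group Q] {ρ : G →* Q}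
    (hρ : IsOpen (ρ.ker : Set G)) {g : G} (hg : ρ g ^ p = ρ g) {α β : A} (hα : α ^ p = α)
    (hβ : β ^ p = β) (htg : residue A (t g) = residue A (α + β))
    (hdg : residue A (d g) = residue A (α * β)) (hαβ : IsUnit (α - β)) :
    ∃ g₀, ρ g₀ = ρ g ∧ t g₀ = α + β ∧ d g₀ = α * β := by
  have hcomp : IsAdicComplete (maximalIdeal A) A := isAdicComplete_maximalIdeal
  have hres : ∀ x y : A, residue A x = residue A y ↔ x - y ∈ maximalIdeal A := fun x y => by
    rw [← residue_eq_zero_iff, map_sub, sub_eq_zero]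
  obtain ⟨r, hr, hrα⟩ := HenselianRing.is_henselian (I := maximalIdeal A)
    (Polynomial.X ^ 2 - Polynomial.C (t g) * Polynomial.X + Polynomial.C (d g)) (by monicity!) α
    (by
      rw [← residue_eq_zero_iff]
      simp only [Polynomial.eval_add, Polynomial.eval_sub, Polynomial.eval_mul,
        Polynomial.eval_pow, Polynomial.eval_X, Polynomial.eval_C, map_add, map_sub, map_mul,
        map_pow, htg, hdg]
      ring)
    (by
      refine IsUnit.map _ ?_
      simp only [Polynomial.derivative_add, Polynomial.derivative_sub, Polynomial.derivative_mul,
        Polynomial.derivative_X_pow, Polynomial.derivative_C, Polynomial.derivative_X,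
        Polynomial.eval_add, Polynomial.eval_sub, Polynomial.eval_mul,
        Polynomial.eval_pow, Polynomial.eval_X, Polynomial.eval_C]
      rw [← isUnit_map_iff (residue A)] at hαβ ⊢
      convert hαβ using 1
      have h2 : residue A 2 = 2 := map_ofNat _ 2
      simp [htg, h2]
      ring)
  have hr' : r * r - t g * r + d g = 0 := by
    simpa [Polynomial.IsRoot, pow_two] using hr
  let s := t g - r
  have hrs : r * s = d g := by simp only [s]; linear_combination -hr'
  have hsβ : s - β ∈ maximalIdeal A := by
    rw [← hres] at hrα ⊢
    simp only [s, map_sub, htg, map_add, hrα]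
    ring
  have htn : ∀ n : ℕ, t (g ^ n) = r ^ n + s ^ n := by
    have key : ∀ n : ℕ, t (g ^ n) = r ^ n + s ^ n ∧ t (g ^ (n + 1)) = r ^ (n + 1) + s ^ (n + 1) := by
      intro n
      induction n with
      | zero => simp [h.t_one, s]; norm_num
      | succ n ih =>
        refine ⟨ih.2, ?_⟩
        have h1 := h.t_mul (g ^ (n + 1)) g
        rw [← pow_succ, pow_succ g n, mul_inv_cancel_right, ← pow_succ g n, ih.1, ih.2] at h1
        have h2 : t g = r + s := by simp [s]
        rw [h2, ← hrs] at h1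
        linear_combination h1
    exact fun n => (key n).1
  have hdn : ∀ n : ℕ, d (g ^ n) = (r * s) ^ n := by
    intro n
    induction n with
    | zero => simp [h.d_one]
    | succ n ih => rw [pow_succ, h.d_mul, ih, hrs, pow_succ]
  let C : ℕ → Set G := fun n => closure {y | ∃ k, n ≤ k ∧ y = g ^ p ^ k}
  obtain ⟨g₀, hg₀⟩ := IsCompact.nonempty_iInter_of_sequence_nonempty_isCompact_isClosed C
    (fun n => closure_mono fun y ⟨k, hk, hy⟩ => ⟨k, (Nat.le_succ n).trans hk, hy⟩)
    (fun n => ⟨_, subset_closure ⟨n, le_rfl, rfl⟩⟩) isClosed_closure.isCompact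
    (fun n => isClosed_closure)
  have hmem : ∀ (n : ℕ) (K : Set G), IsClosed K → (∀ k, n ≤ k → g ^ p ^ k ∈ K) → g₀ ∈ K :=
    fun n K hK hk => closure_minimal (by rintro _ ⟨k, hnk, rfl⟩; exact hk k hnk) hK
      (Set.mem_iInter.mp hg₀ n)
  have hsm : ∀ {x y : A}, x - y ∈ maximalIdeal A → y ^ p = y → ∀ k n : ℕ, n ≤ k →
      x ^ p ^ k - y ∈ maximalIdeal A ^ n := by
    intro x y hxy hy k n hnk
    have h1 := SModEq.pow_pow_add_one hp (SModEq.sub_mem.mpr hxy) k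
    rw [SModEq.sub_mem, pow_pow_eq_self hy] at h1
    exact Ideal.pow_le_pow_right (hnk.trans (Nat.le_succ k)) h1
  refine ⟨g₀, ?_, ?_, ?_⟩
  · have hcl : IsClosed {y : G | g⁻¹ * y ∈ ρ.ker} :=
      (Subgroup.isClosed_of_isOpen _ hρ).preimage (continuous_const_mul _)
    have h1 := hmem 0 _ hcl fun k _ => by
      change ρ (g⁻¹ * g ^ p ^ k) = 1
      rw [map_mul, map_pow, pow_pow_eq_self hg, map_inv, inv_mul_cancel]
    have h2 : ρ (g⁻¹ * g₀) = 1 := h1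
    rw [map_mul, map_inv] at h2
    exact (inv_mul_eq_one.mp h2).symm
  · rw [← sub_eq_zero]
    refine eq_zero_of_forall_mem_maximalIdeal_pow fun n => ?_
    refine hmem n {y | t y - (α + β) ∈ maximalIdeal A ^ n}
      ((isClosed_maximalIdeal_pow n).preimage (by fun_prop)) fun k hk => ?_
    change t (g ^ p ^ k) - (α + β) ∈ maximalIdeal A ^ n
    rw [htn, add_sub_add_comm]
    exact add_mem (hsm hrα hα k n hk) (hsm hsβ hβ k n hk)
  · rw [← sub_eq_zero]
    refine eq_zero_of_forall_mem_maximalIdeal_pow fun n => ?_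
    refine hmem n {y | d y - α * β ∈ maximalIdeal A ^ n}
      ((isClosed_maximalIdeal_pow n).preimage (by fun_prop)) fun k hk => ?_
    change d (g ^ p ^ k) - α * β ∈ maximalIdeal A ^ n
    rw [hdn]
    refine hsm ?_ (by rw [mul_pow, hα, hβ]) k n hk
    have e : r * s - α * β = (r - α) * s + α * (s - β) := by ring
    rw [e]
    exact add_mem (Ideal.mul_mem_right _ _ hrα) (Ideal.mul_mem_left _ _ hsβ)

end Teichmuller

/-! ### Restriction of admissible pseudo-deformations -/

/-- A homomorphism to `GL₂` of a field with entries in a subfield comes from that subfield. -/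
theorem exists_generalLinearGroup_lift {k F : Type*} [Field k] [Field F] (ι : k →+* F)
    {K : Type*} [Group K] (ψ : K →* GL (Fin 2) F)
    (h : ∀ g i j, (ψ g : Matrix (Fin 2) (Fin 2) F) i j ∈ ι.range) :
    ∃ ψ₀ : K →* GL (Fin 2) k, ∀ g, Matrix.GeneralLinearGroup.map ι (ψ₀ g) = ψ g := by
  choose N hN using h
  have hmat : ∀ g, (Matrix.of (N g)).map ι = (ψ g : Matrix (Fin 2) (Fin 2) F) := fun g => by
    ext i j; exact hN g i j
  have hinj : Function.Injective fun M : Matrix (Fin 2) (Fin 2) k => M.map ι :=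
    Matrix.map_injective ι.injective
  have hone : Matrix.of (N 1) = 1 := hinj (by
    change (Matrix.of (N 1)).map ι = (1 : Matrix (Fin 2) (Fin 2) k).map ι
    rw [hmat, map_one, Matrix.map_one ι (map_zero ι) (map_one ι)]; rfl)
  have hmul : ∀ g g', Matrix.of (N (g * g')) = Matrix.of (N g) * Matrix.of (N g') := fun g g' =>
    hinj (by
      change (Matrix.of (N (g * g'))).map ι = (Matrix.of (N g) * Matrix.of (N g')).map ι
      rw [hmat, map_mul, Matrix.map_mul, hmat, hmat]; rfl)
  let f : K →* Matrix (Fin 2) (Fin 2) k :=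
    { toFun := fun g => Matrix.of (N g)
      map_one' := hone
      map_mul' := hmul }
  refine ⟨f.toHomUnits, fun g => Units.ext ?_⟩
  exact hmat g

section

variable {A : Type u} [CommRing A] [IsLocalRing A] [IsNoetherianRing A] [TopologicalSpace A]
  [IsTopologicalRing A] [CompactSpace A] [T2Space A] {G : Type v} [Group G] [TopologicalSpace G]
  {p : ℕ} [Fact p.Prime] {ρbar : G →* GL (Fin 2) (ResidueField A)} {t d : G → A}

theorem IsAdmissible.natCast_mem (hadm : IsAdmissible p ρbar t d) : (p : A) ∈ maximalIdeal A := by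
  have := hadm.charP_residueField
  rw [← residue_eq_zero_iff, map_natCast, CharP.cast_eq_zero]

theorem Matrix.GeneralLinearGroup.trace_conj {F : Type*} [Field F] (P M : GL (Fin 2) F) :
    ((P * M * P⁻¹ : GL (Fin 2) F) : Matrix (Fin 2) (Fin 2) F).trace =
      (M : Matrix (Fin 2) (Fin 2) F).trace := by
  rw [Units.val_mul, Matrix.trace_mul_comm, ← Units.val_mul, inv_mul_cancel_left]

theorem Matrix.GeneralLinearGroup.det_conj {F : Type*} [Field F] (P M : GL (Fin 2) F) :
    ((P * M * P⁻¹ : GL (Fin 2) F) : Matrix (Fin 2) (Fin 2) F).det =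
      (M : Matrix (Fin 2) (Fin 2) F).det := by
  rw [Units.val_mul, Matrix.det_mul_comm, ← Units.val_mul, inv_mul_cancel_left]

theorem Subfield.isClosed_comap_residue (k : Subfield (ResidueField A)) :
    IsClosed ((k.toSubring.comap (residue A) : Subring A) : Set A) := by
  refine AddSubgroup.isClosed_of_isOpen (k.toSubring.comap (residue A)).toAddSubgroup ?_
  refine AddSubgroup.isOpen_mono (H₁ := (maximalIdeal A).toAddSubgroup) ?_
    (isOpen_maximalIdeal A)
  intro a ha
  change residue A a ∈ k
  rw [(residue_eq_zero_iff a).mpr ha]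
  exact k.zero_mem

theorem IsAdmissible.residue_mem_bot (hadm : IsAdmissible p ρbar t d) {K : Subgroup G}
    {P : GL (Fin 2) (ResidueField A)}
    (hP : ∀ g ∈ K, ∀ i j, ((P * ρbar g * P⁻¹ : GL (Fin 2) (ResidueField A)) :
      Matrix (Fin 2) (Fin 2) (ResidueField A)) i j ∈ (⊥ : Subfield (ResidueField A)))
    {a : A} (ha : a ∈ (Subring.closure (t '' K)).topologicalClosure) :
    residue A a ∈ (⊥ : Subfield (ResidueField A)) := by
  refine Subring.topologicalClosure_minimal _ ?_ (Subfield.isClosed_comap_residue ⊥) ha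
  rw [Subring.closure_le]
  rintro _ ⟨g, hg, rfl⟩
  change residue A (t g) ∈ (⊥ : Subfield (ResidueField A))
  rw [hadm.residue_t, ← Matrix.GeneralLinearGroup.trace_conj P, Matrix.trace_fin_two]
  exact add_mem (hP g hg 0 0) (hP g hg 1 1)

/-- Residual matrices with entries in the prime field force the residue field of `A₀` to be prime.
Its Witt vectors then land in `A₀`, where the integers already are. The multiplicity-free condition
is left as a hypothesis because it is verified differently in the two cases where the theorem
produces a subgroup. -/
theorem IsAdmissible.exists_restrict (hadm : IsAdmissible p ρbar t d) {K : Subgroup G}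
    (hK : IsOpen (K : Set G)) {P : GL (Fin 2) (ResidueField A)}
    (hP : ∀ g ∈ K, ∀ i j, ((P * ρbar g * P⁻¹ : GL (Fin 2) (ResidueField A)) :
      Matrix (Fin 2) (Fin 2) (ResidueField A)) i j ∈ (⊥ : Subfield (ResidueField A)))
    {A₀ : Subring A} [IsLocalRing A₀] [IsLocalHom A₀.subtype] (hcl : IsClosed (A₀ : Set A))
    (ht : ∀ g : K, t g ∈ A₀) (hd : ∀ g : K, d g ∈ A₀)
    (hle : A₀ ≤ (Subring.closure (t '' K)).topologicalClosure) :
    ∃ ρbar₀ : K →* GL (Fin 2) (ResidueField A₀),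
      (∀ g, Matrix.GeneralLinearGroup.map (ResidueField.map A₀.subtype) (ρbar₀ g) =
        P * ρbar g * P⁻¹) ∧
      ((IsAbsolutelyIrreducibleRep ρbar₀ ∨ IsSumOfDistinctCharacters ρbar₀) →
        IsAdmissible p ρbar₀ (fun g => (⟨t g, ht g⟩ : A₀)) (fun g => (⟨d g, hd g⟩ : A₀))) := by
  have := hadm.charP_residueField
  have := hadm.finite_residueField
  have := hadm.isTopologicalGroup
  have := hadm.compactSpace_group
  have := hadm.t2Space_group
  have := hadm.totallyDisconnectedSpace_group
  let ι : ResidueField A₀ →+* ResidueField A := ResidueField.map A₀.subtype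
  have hι : Function.Injective ι := ι.injective
  have hιr : ∀ a : A₀, ι (residue A₀ a) = residue A a := fun a => ResidueField.map_residue _ a
  have hint : ∀ y : ResidueField A₀, ∃ n : ℤ, (n : ResidueField A₀) = y := fun y => by
    obtain ⟨a, rfl⟩ := residue_surjective y
    obtain ⟨n, hn⟩ := (mem_bot_iff_intCast p _).mp (hadm.residue_mem_bot hP (hle a.2))
    exact ⟨n, hι (by rw [map_intCast, hn, hιr])⟩
  have hrange : ∀ x ∈ (⊥ : Subfield (ResidueField A)), x ∈ ι.range := fun x hx => by
    obtain ⟨n, rfl⟩ := (mem_bot_iff_intCast p _).mp hx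
    exact ⟨n, map_intCast ι n⟩
  obtain ⟨ρbar₀, hρ⟩ := exists_generalLinearGroup_lift ι
    (((MulAut.conj P).toMonoidHom.comp ρbar).comp K.subtype)
    fun g i j => hrange _ (hP g g.2 i j)
  have hρ' : ∀ g : K, Matrix.GeneralLinearGroup.map ι (ρbar₀ g) = P * ρbar g * P⁻¹ := hρ
  refine ⟨ρbar₀, hρ', fun hmult => ?_⟩
  have hmat : ∀ g : K, (ρbar₀ g : Matrix (Fin 2) (Fin 2) (ResidueField A₀)).map ι =
      ((P * ρbar g * P⁻¹ : GL (Fin 2) (ResidueField A)) :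
        Matrix (Fin 2) (Fin 2) (ResidueField A)) := fun g => by
    rw [← hρ']; rfl
  have htr : ∀ g : K, ι (ρbar₀ g : Matrix (Fin 2) (Fin 2) (ResidueField A₀)).trace =
      (ρbar g : Matrix (Fin 2) (Fin 2) (ResidueField A)).trace := fun g => by
    rw [← Matrix.GeneralLinearGroup.trace_conj P, ← hmat, Matrix.trace_fin_two,
      Matrix.trace_fin_two, map_add]
    rfl
  have hdet : ∀ g : K, ι (ρbar₀ g : Matrix (Fin 2) (Fin 2) (ResidueField A₀)).det =
      (ρbar g : Matrix (Fin 2) (Fin 2) (ResidueField A)).det := fun g => by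
    rw [← Matrix.GeneralLinearGroup.det_conj P, ← hmat, RingHom.map_det]
    rfl
  have hchar : CharP (ResidueField A₀) p := (RingHom.charP_iff ι hι p).mpr inferInstance
  have hfin : Finite (ResidueField A₀) := Finite.of_injective ι hι
  obtain ⟨φ, hφ, hφd, hφt⟩ := hadm.constant_generated
  have hφA : ∀ x, φ (WittVector.map ι x) ∈ A₀ := fun x => by
    refine mem_of_forall_sub_mem_maximalIdeal_pow hcl fun m => ?_
    obtain ⟨n, y, hxy⟩ := WittVector.exists_eq_intCast_add hint x m
    refine ⟨n, intCast_mem A₀ n, ?_⟩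
    rw [hxy]
    simp only [map_add, map_mul, map_intCast, map_pow, map_natCast, sub_add_cancel_left]
    exact neg_mem (Ideal.mul_mem_right _ _ (Ideal.pow_mem_pow hadm.natCast_mem m))
  exact
    { isTopologicalRing := inferInstance
      compactSpace_ring := isCompact_iff_compactSpace.mp hcl.isCompact
      t2Space_ring := inferInstance
      finite_residueField := hfin
      charP_residueField := hchar
      isTopologicalGroup := inferInstance
      compactSpace_group :=
        isCompact_iff_compactSpace.mp (Subgroup.isClosed_of_isOpen K hK).isCompact
      t2Space_group := inferInstance
      totallyDisconnectedSpace_group := inferInstance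
      pFiniteness := hadm.pFiniteness.subgroup hK
      continuous_residual := by
        have h1 : (ρbar₀.ker : Set K) = Subtype.val ⁻¹' (ρbar.ker : Set G) := by
          ext g
          have hinj : Function.Injective (Matrix.GeneralLinearGroup.map (n := Fin 2) ι) := by
            intro x y hxy
            refine Units.ext (Matrix.map_injective hι ?_)
            exact congrArg Units.val hxy
          rw [Set.mem_preimage, SetLike.mem_coe, SetLike.mem_coe, MonoidHom.mem_ker,
            MonoidHom.mem_ker, ← map_eq_one_iff _ hinj, hρ', conj_eq_one_iff]
        rw [h1]
        exact hadm.continuous_residual.preimage continuous_subtype_val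
      multiplicityFree := hmult
      isPseudoRep :=
        { d_hom := by
            let f : K →* A₀ :=
              { toFun := fun g => ⟨d g, hd g⟩
                map_one' := Subtype.ext hadm.isPseudoRep.d_one
                map_mul' := fun g k => Subtype.ext (hadm.isPseudoRep.d_mul g k) }
            exact ⟨f.toHomUnits, fun g => rfl⟩
          t_central := fun x y => Subtype.ext (hadm.isPseudoRep.t_central x y)
          t_one := Subtype.ext hadm.isPseudoRep.t_one
          t_mul := fun x y => Subtype.ext (hadm.isPseudoRep.t_mul x y) }
      continuous_t := (hadm.continuous_t.comp continuous_subtype_val).subtype_mk _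
      continuous_d := (hadm.continuous_d.comp continuous_subtype_val).subtype_mk _
      residue_t := fun g => hι (by rw [hιr, htr]; exact hadm.residue_t g)
      residue_d := fun g => hι (by rw [hιr, hdet]; exact hadm.residue_d g)
      constant_generated := by
        refine ⟨(φ.comp (WittVector.map ι)).codRestrict A₀ hφA, fun x => hι ?_, fun g => ?_,
          fun x => ?_⟩
        · rw [hιr]
          change residue A (φ (WittVector.map ι x)) = _
          rw [hφ, WittVector.constantCoeff_apply, WittVector.map_coeff,
            WittVector.constantCoeff_apply]
        · obtain ⟨y, hy⟩ := hφd g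
          have h1 := hadm.residue_d g
          rw [hy, hφ, WittVector.constantCoeff_apply, WittVector.teichmuller_coeff_zero,
            ← hdet] at h1
          refine ⟨(ρbar₀ g : Matrix (Fin 2) (Fin 2) (ResidueField A₀)).det, Subtype.ext ?_⟩
          change d g = φ (WittVector.map ι _)
          rw [WittVector.map_teichmuller, hy, h1]
        · rw [closure_subtype]
          have h1 : (x : A) ∈ closure ((Subring.closure (t '' K) : Subring A) : Set A) :=
            hle x.2
          refine closure_mono ?_ h1
          rw [← Subring.coe_subtype, ← Subring.coe_map, SetLike.coe_subset_coe,
            Subring.closure_le]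
          rintro _ ⟨g, hg, rfl⟩
          exact ⟨⟨t g, ht ⟨g, hg⟩⟩, Subring.subset_closure (Or.inr ⟨⟨g, hg⟩, rfl⟩), rfl⟩ }

end

/-! ### The closed subring generated by traces, and the form of the conclusion -/

section TraceRing

variable {A : Type u} [CommRing A] [IsLocalRing A] [IsNoetherianRing A] [TopologicalSpace A]
  [IsTopologicalRing A] [CompactSpace A] [T2Space A] {G : Type v} [Group G] [TopologicalSpace G]

/-- The closed subring generated by the traces of a subgroup. -/
def traceRing (t : G → A) (K : Subgroup G) : Subring A :=
  (Subring.closure (t '' K)).topologicalClosure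

variable (t : G → A) (K : Subgroup G)

theorem isClosed_traceRing : IsClosed (traceRing t K : Set A) :=
  Subring.isClosed_topologicalClosure _

variable {t K} in
theorem mem_traceRing {g : G} (hg : g ∈ K) : t g ∈ traceRing t K :=
  Subring.le_topologicalClosure _ (Subring.subset_closure ⟨g, hg, rfl⟩)

variable {t K} in
theorem traceRing_le {S : Subring A} (hS : IsClosed (S : Set A)) (h : ∀ g ∈ K, t g ∈ S) :
    traceRing t K ≤ S :=
  Subring.topologicalClosure_minimal _
    (Subring.closure_le.mpr (by rintro _ ⟨g, hg, rfl⟩; exact h g hg)) hS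

instance : IsLocalHom (traceRing t K).subtype :=
  Subring.isLocalHom_subtype_of_isClosed (isClosed_traceRing t K)

instance : IsLocalRing (traceRing t K) := RingHom.domain_isLocalRing (traceRing t K).subtype

instance : CompactSpace (traceRing t K) :=
  isCompact_iff_compactSpace.mp (isClosed_traceRing t K).isCompact

theorem d_mem_traceRing {d : G → A} (h : IsPseudoRep t d) {c : A} (hc : 2 * c = 1) {g : G}
    (hg : g ∈ K) : d g ∈ traceRing t K := by
  have hc' : c ∈ traceRing t K := mem_of_mul_eq_one (isClosed_traceRing t K) (ofNat_mem _ 2) hc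
  have h1 : d g = c * (t g * t g - t (g * g)) := by
    linear_combination c * h.two_mul_d g - d g * hc
  rw [h1]
  exact mul_mem hc' (sub_mem (mul_mem (mem_traceRing hg) (mem_traceRing hg))
    (mem_traceRing (mul_mem hg hg)))

variable {t K} in
theorem IsPseudoRep.restrict_traceRing {d : G → A} (h : IsPseudoRep t d) {c : A} (hc : 2 * c = 1) :
    IsPseudoRep (fun g : K => (⟨t g, mem_traceRing g.2⟩ : traceRing t K))
      (fun g : K => (⟨d g, d_mem_traceRing t K h hc g.2⟩ : traceRing t K)) where
  d_hom := by
    let f : K →* traceRing t K :=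
      { toFun := fun g => ⟨d g, d_mem_traceRing t K h hc g.2⟩
        map_one' := Subtype.ext h.d_one
        map_mul' := fun g k => Subtype.ext (h.d_mul g k) }
    exact ⟨f.toHomUnits, fun g => rfl⟩
  t_central x y := Subtype.ext (h.t_central x y)
  t_one := Subtype.ext h.t_one
  t_mul x y := Subtype.ext (h.t_mul x y)

theorem eq_top_of_forall_mem {S : Subring (traceRing t K)} (hS : IsClosed (S : Set (traceRing t K)))
    (h : ∀ g : K, (⟨t g, mem_traceRing g.2⟩ : traceRing t K) ∈ S) : S = ⊤ := by
  have h1 : IsClosed ((S.map (traceRing t K).subtype : Subring A) : Set A) := by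
    rw [Subring.coe_map]
    exact (hS.isCompact.image continuous_subtype_val).isClosed
  have h2 := traceRing_le (K := K) h1 fun g hg => ⟨_, h ⟨g, hg⟩, rfl⟩
  rw [eq_top_iff]
  intro x _
  obtain ⟨y, hy, hyx⟩ := h2 x.2
  rwa [← show y = x from Subtype.ext hyx]

/-- The conclusion of the theorem: some restriction to an open subgroup has congruence-large
image over a subring. -/
def HasLargeRestriction (p : ℕ) [Fact p.Prime] (ρbar : G →* GL (Fin 2) (ResidueField A))
    (t d : G → A) : Prop :=
  ∃ (A₀ : Subring A) (_ : IsLocalRing A₀) (_ : IsLocalHom A₀.subtype) (Pi₀ : Subgroup G),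
    CompactSpace A₀ ∧ IsNoetherianRing A₀ ∧
    maximalIdeal A₀ = (maximalIdeal A).comap A₀.subtype ∧
    IsOpen (Pi₀ : Set G) ∧ ρbar.ker ≤ Pi₀ ∧
    ∃ (ht : ∀ g : Pi₀, t g ∈ A₀) (hd : ∀ g : Pi₀, d g ∈ A₀),
      (∀ g : Pi₀, IsUnit (⟨d g, hd g⟩ : A₀)) ∧
      ∃ ρbar₀ : Pi₀ →* GL (Fin 2) (ResidueField A₀),
        (∃ P : GL (Fin 2) (ResidueField A), ∀ g : Pi₀,
          Matrix.GeneralLinearGroup.map (ResidueField.map A₀.subtype) (ρbar₀ g) =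
            P * ρbar g * P⁻¹) ∧
        IsAdmissible p ρbar₀ (fun g => (⟨t g, ht g⟩ : A₀)) (fun g => (⟨d g, hd g⟩ : A₀)) ∧
        HasCongruenceLargeImage (fun g : Pi₀ => (⟨t g, ht g⟩ : A₀))
          (fun g : Pi₀ => (⟨d g, hd g⟩ : A₀))

variable {t K} {d : G → A} {p : ℕ} [Fact p.Prime] {ρbar : G →* GL (Fin 2) (ResidueField A)}

theorem IsAdmissible.hasLargeRestriction (hadm : IsAdmissible p ρbar t d) {c : A}
    (hc : 2 * c = 1) (hker : ρbar.ker ≤ K) {P : GL (Fin 2) (ResidueField A)}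
    (hP : ∀ g ∈ K, ∀ i j, ((P * ρbar g * P⁻¹ : GL (Fin 2) (ResidueField A)) :
      Matrix (Fin 2) (Fin 2) (ResidueField A)) i j ∈ (⊥ : Subfield (ResidueField A)))
    (hnoeth : IsNoetherianRing (traceRing t K))
    (hmult : ∀ ρbar₀ : K →* GL (Fin 2) (ResidueField (traceRing t K)),
      (∀ g, Matrix.GeneralLinearGroup.map (ResidueField.map (traceRing t K).subtype) (ρbar₀ g) =
        P * ρbar g * P⁻¹) → IsAbsolutelyIrreducibleRep ρbar₀ ∨ IsSumOfDistinctCharacters ρbar₀)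
    (hcong : HasCongruenceLargeImage (fun g : K => (⟨t g, mem_traceRing g.2⟩ : traceRing t K))
      (fun g : K => (⟨d g, d_mem_traceRing t K hadm.isPseudoRep hc g.2⟩ : traceRing t K))) :
    HasLargeRestriction p ρbar t d := by
  have := hadm.isTopologicalGroup
  have hK : IsOpen (K : Set G) := Subgroup.isOpen_mono hker hadm.continuous_residual
  obtain ⟨ρbar₀, hρ, h⟩ := hadm.exists_restrict hK hP (isClosed_traceRing t K)
    (fun g => mem_traceRing g.2) (fun g => d_mem_traceRing t K hadm.isPseudoRep hc g.2) le_rfl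
  refine ⟨traceRing t K, inferInstance, inferInstance, K, inferInstance, hnoeth, ?_, hK, hker,
    fun g => mem_traceRing g.2, fun g => d_mem_traceRing t K hadm.isPseudoRep hc g.2, fun g => ?_,
    ρbar₀, ⟨P, hρ⟩, h (hmult ρbar₀ hρ), hcong⟩
  · ext a
    rw [Ideal.mem_comap, mem_maximalIdeal, mem_maximalIdeal, mem_nonunits_iff, mem_nonunits_iff,
      isUnit_map_iff]
  · rw [← isUnit_map_iff (traceRing t K).subtype]
    exact hadm.isPseudoRep.isUnit_d g

end TraceRing

/-- Existence of a representation in a faithful generalized matrix algebra. -/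
theorem IsPseudoRep.exists_gma {G : Type v} [Group G] {A : Type u} [CommRing A] [IsDomain A]
    [IsNoetherianRing A] {t d : G → A} (h : IsPseudoRep t d) {c : A} (hc : 2 * c = 1) {g₀ : G}
    {α β δ : A} (hδ : (α - β) * δ = 1) (htg : t g₀ = α + β) (hdg : d g₀ = α * β) {k₁ k₂ : G}
    (hk : offDiagonal t g₀ α β k₁ k₂ ≠ 0) :
    ∃ (R : GMA A) (ρ : G →* R.Algˣ), R.IsFaithful ∧ Module.Finite A R.Alg ∧
      (∀ g, (ρ g : R.Alg).tr = t g) ∧ ∀ g, (ρ g : R.Alg).det = d g := by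
  obtain ⟨E, _, _, tr, ρ, Q, ht⟩ := h.exists_isQuadraticTrace
  have hd2 : ∀ g, d g = c * (t g * t g - t (g * g)) := fun g => by
    linear_combination c * h.two_mul_d g - d g * hc
  have hsq : (ρ g₀ : E) * ρ g₀ = tr (ρ g₀ : E) • (ρ g₀ : E) - (α * β) • (1 : E) := by
    have h1 := Q.sq (ρ g₀ : E) c hc
    rw [← Units.val_mul, ← map_mul ρ] at h1 ⊢
    simp only [ht] at h1 ⊢
    rw [h1, ← hdg, hd2]
  obtain ⟨he, het, -⟩ := Q.exists_projection ((ht g₀).trans htg) hsq hδ rfl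
  have hδ0 : δ ≠ 0 := by rintro rfl; simp at hδ
  obtain ⟨R, ρ', hR, hfin, htr⟩ := Q.exists_gma (ρ := ρ) he het (g₁ := k₁) (g₂ := k₂) (by
    rw [Q.offDiagonal_eq (ρ := ρ) ht hδ rfl]
    exact mul_ne_zero (mul_ne_zero hδ0 hδ0) hk)
  have htr' : ∀ g, (ρ' g : R.Alg).tr = t g := fun g => (htr g).trans (ht g)
  refine ⟨R, ρ', hR, hfin, htr', fun g => ?_⟩
  have h1 := R.two_mul_det (ρ' g : R.Alg)
  rw [← Units.val_mul, ← map_mul, htr', htr'] at h1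
  rw [hd2, ← h1, ← mul_assoc, mul_comm c, hc, one_mul]

/-! ### Lifting a regular element -/

section Torus

variable {A : Type u} [CommRing A] [IsLocalRing A] [IsNoetherianRing A] [TopologicalSpace A]
  [IsTopologicalRing A] [CompactSpace A] [T2Space A] {G : Type v} [Group G] [TopologicalSpace G]
  {p : ℕ} [Fact p.Prime] {ρbar : G →* GL (Fin 2) (ResidueField A)} {t d : G → A}

/-- The residual image of `g₀` is regular and its eigenvalues lift to `α` and `β`. -/
structure IsRegularElement (p : ℕ) {A : Type u} [CommRing A] [IsLocalRing A] {G : Type v} [Group G]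
    (ρbar : G →* GL (Fin 2) (ResidueField A)) (t d : G → A) (g₀ : G) (α β : A)
    (P : GL (Fin 2) (ResidueField A)) : Prop where
  diag : ((P * ρbar g₀ * P⁻¹ : GL (Fin 2) (ResidueField A)) :
    Matrix (Fin 2) (Fin 2) (ResidueField A)) = Matrix.diagonal ![residue A α, residue A β]
  pow_left : α ^ p = α
  pow_right : β ^ p = β
  t_eq : t g₀ = α + β
  d_eq : d g₀ = α * β
  left_ne : residue A α ≠ 0
  right_ne : residue A β ≠ 0
  sq_ne : residue A α ^ 2 ≠ residue A β ^ 2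

/-- The residual eigenvalues are in the prime field, so `ρbar g ^ p = ρbar g` and
`exists_teichmuller` applies without changing the residual image. -/
theorem IsAdmissible.exists_isRegularElement (hadm : IsAdmissible p ρbar t d)
    (hreg : IsRegularRep ρbar) : ∃ g₀ α β P, IsRegularElement p ρbar t d g₀ α β P := by
  have := hadm.charP_residueField
  have := hadm.isTopologicalGroup
  have := hadm.compactSpace_group
  obtain ⟨g, x, y, P, hx, hy, hx0, hy0, hxy, hP⟩ := hreg
  rw [Subfield.mem_bot_iff_pow_eq_self _ p] at hx hy
  obtain ⟨φ, hφ, -, -⟩ := hadm.constant_generated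
  have hres : ∀ z, residue A (φ (WittVector.teichmuller p z)) = z := fun z => by
    rw [hφ, WittVector.constantCoeff_apply, WittVector.teichmuller_coeff_zero]
  have hpow : ∀ z, z ^ p = z → φ (WittVector.teichmuller p z) ^ p = φ (WittVector.teichmuller p z) :=
    fun z hz => by rw [← map_pow, ← map_pow, hz]
  have hg : ρbar g ^ p = ρbar g := by
    rw [← MulAut.conj_apply] at hP
    refine (MulAut.conj P).injective ?_
    rw [map_pow]
    refine Units.ext ?_
    rw [Units.val_pow_eq_pow_val, hP, Matrix.diagonal_pow]
    congr 1
    ext i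
    fin_cases i
    · exact hx
    · exact hy
  have hsub : IsUnit (φ (WittVector.teichmuller p x) - φ (WittVector.teichmuller p y)) := by
    rw [← isUnit_map_iff (residue A), map_sub, hres, hres, isUnit_iff_ne_zero, sub_ne_zero]
    rintro rfl
    exact hxy rfl
  obtain ⟨g₀, hg₀, ht, hd⟩ := hadm.isPseudoRep.exists_teichmuller hadm.continuous_t
    hadm.continuous_d hadm.natCast_mem hadm.continuous_residual hg (hpow x hx) (hpow y hy)
    (by
      rw [hadm.residue_t, map_add, hres, hres, ← Matrix.GeneralLinearGroup.trace_conj P, hP,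
        Matrix.trace_fin_two]
      simp)
    (by
      rw [hadm.residue_d, map_mul, hres, hres, ← Matrix.GeneralLinearGroup.det_conj P, hP,
        Matrix.det_diagonal]
      simp) hsub
  refine ⟨g₀, _, _, P, ?_, hpow x hx, hpow y hy, ht, hd, ?_, ?_, ?_⟩
  · rw [hg₀, hP, hres, hres]
  · rwa [hres]
  · rwa [hres]
  · rwa [hres, hres]

theorem IsAdmissible.exists_half (hadm : IsAdmissible p ρbar t d) (hp : p ≠ 2) :
    ∃ c : A, 2 * c = 1 := by
  have := hadm.charP_residueField
  have h1 : IsUnit (2 : A) := by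
    rw [← isUnit_map_iff (residue A), map_ofNat, isUnit_iff_ne_zero]
    exact Ring.two_ne_zero (by rwa [← ringChar.eq (ResidueField A) p] at hp)
  exact h1.exists_right_inv

/-- The values of `d` are Teichmüller elements, hence determined by their residues. -/
theorem IsAdmissible.d_eq_one (hadm : IsAdmissible p ρbar t d) {g : G} (hg : g ∈ ρbar.ker) :
    d g = 1 := by
  obtain ⟨φ, hφ, hφd, -⟩ := hadm.constant_generated
  obtain ⟨x, hx⟩ := hφd g
  have h1 := hadm.residue_d g
  rw [hx, hφ, WittVector.constantCoeff_apply, WittVector.teichmuller_coeff_zero,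
    (MonoidHom.mem_ker).mp hg, Units.val_one, Matrix.det_one] at h1
  rw [hx, h1, map_one, map_one]

theorem IsAdmissible.t_sub_two_mem (hadm : IsAdmissible p ρbar t d) {g : G} (hg : g ∈ ρbar.ker) :
    t g - 2 ∈ maximalIdeal A := by
  rw [← residue_eq_zero_iff, map_sub, hadm.residue_t, (MonoidHom.mem_ker).mp hg, Units.val_one,
    Matrix.trace_one, map_ofNat]
  simp

namespace IsRegularElement

variable {g₀ : G} {α β : A} {P : GL (Fin 2) (ResidueField A)}
  (h : IsRegularElement p ρbar t d g₀ α β P)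

include h

theorem isUnit_left : IsUnit α := by
  rw [← isUnit_map_iff (residue A), isUnit_iff_ne_zero]; exact h.left_ne

theorem isUnit_right : IsUnit β := by
  rw [← isUnit_map_iff (residue A), isUnit_iff_ne_zero]; exact h.right_ne

theorem isUnit_sq_sub : IsUnit (α ^ 2 - β ^ 2) := by
  rw [← isUnit_map_iff (residue A), isUnit_iff_ne_zero, map_sub, map_pow, map_pow, sub_ne_zero]
  exact h.sq_ne

theorem exists_inv : ∃ δ : A, (α - β) * δ = 1 := by
  refine IsUnit.exists_right_inv (isUnit_of_mul_isUnit_left (y := α + β) ?_)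
  rw [show (α - β) * (α + β) = α ^ 2 - β ^ 2 by ring]
  exact h.isUnit_sq_sub

theorem residue_ne : residue A α ≠ residue A β := fun h1 => h.sq_ne (by rw [h1])

theorem left_mem [CharP (ResidueField A) p] (hp : (p : A) ∈ maximalIdeal A) :
    α ∈ (⊥ : Subring A).topologicalClosure := by
  have h1 : residue A α ∈ (⊥ : Subfield (ResidueField A)) := by
    rw [Subfield.mem_bot_iff_pow_eq_self _ p, ← map_pow, h.pow_left]
  obtain ⟨n, hn⟩ := (mem_bot_iff_intCast p _).mp h1
  exact mem_topologicalClosure_bot_of_pow_eq hp h.pow_left hn.symm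

theorem right_mem [CharP (ResidueField A) p] (hp : (p : A) ∈ maximalIdeal A) :
    β ∈ (⊥ : Subring A).topologicalClosure := by
  have h1 : residue A β ∈ (⊥ : Subfield (ResidueField A)) := by
    rw [Subfield.mem_bot_iff_pow_eq_self _ p, ← map_pow, h.pow_right]
  obtain ⟨n, hn⟩ := (mem_bot_iff_intCast p _).mp h1
  exact mem_topologicalClosure_bot_of_pow_eq hp h.pow_right hn.symm

theorem diag_pow (n : ℕ) : ((P * ρbar (g₀ ^ n) * P⁻¹ : GL (Fin 2) (ResidueField A)) :
    Matrix (Fin 2) (Fin 2) (ResidueField A)) =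
      Matrix.diagonal ![residue A α ^ n, residue A β ^ n] := by
  have h1 := h.diag
  rw [← MulAut.conj_apply] at h1 ⊢
  rw [map_pow, map_pow, Units.val_pow_eq_pow_val, h1, Matrix.diagonal_pow]
  congr 1
  ext i
  fin_cases i <;> rfl

end IsRegularElement

end Torus

/-! ### The generic case: a nonzero off-diagonal product on the residual kernel -/

section Core

variable {A : Type u} [CommRing A] [IsLocalRing A] [IsNoetherianRing A] [TopologicalSpace A]
  [IsTopologicalRing A] [CompactSpace A] [T2Space A] {G : Type v} [Group G] [TopologicalSpace G]
  {p : ℕ} [Fact p.Prime] {ρbar : G →* GL (Fin 2) (ResidueField A)} {t d : G → A}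
  {g₀ : G} {α β : A} {P : GL (Fin 2) (ResidueField A)}

theorem exists_eq_mul_pow {Q : Type*} [Group Q] [Finite Q] (ρ : G →* Q) {g : G}
    (hg : g ∈ (Subgroup.zpowers (ρ g₀)).comap ρ) : ∃ k ∈ ρ.ker, ∃ n : ℕ, g = k * g₀ ^ n := by
  obtain ⟨n, hn⟩ := mem_powers_iff_mem_zpowers.mpr (Subgroup.mem_comap.mp hg)
  refine ⟨g * (g₀ ^ n)⁻¹, ?_, n, by group⟩
  rw [MonoidHom.mem_ker, map_mul, map_inv, map_pow, mul_inv_eq_one]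
  exact hn.symm

theorem isSumOfDistinctCharacters_of_diagonal {k : Type*} [Field k] {K : Type*} [Group K]
    {ψ : K →* GL (Fin 2) k}
    (h₁ : ∀ g, (ψ g : Matrix (Fin 2) (Fin 2) k) 0 1 = 0)
    (h₂ : ∀ g, (ψ g : Matrix (Fin 2) (Fin 2) k) 1 0 = 0)
    (h₃ : ∃ g, (ψ g : Matrix (Fin 2) (Fin 2) k) 0 0 ≠ (ψ g : Matrix (Fin 2) (Fin 2) k) 1 1) :
    IsSumOfDistinctCharacters ψ := by
  let f : K →* k :=
    { toFun := fun g => (ψ g : Matrix (Fin 2) (Fin 2) k) 0 0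
      map_one' := by simp
      map_mul' := fun g g' => by
        simp [Matrix.mul_apply, Fin.sum_univ_two, h₁] }
  let f' : K →* k :=
    { toFun := fun g => (ψ g : Matrix (Fin 2) (Fin 2) k) 1 1
      map_one' := by simp
      map_mul' := fun g g' => by
        simp [Matrix.mul_apply, Fin.sum_univ_two, h₂] }
  refine ⟨f.toHomUnits, f'.toHomUnits, fun hff => ?_, 1, fun g => ?_⟩
  · obtain ⟨g, hg⟩ := h₃
    exact hg (congrArg Units.val (DFunLike.congr_fun hff g))
  · rw [one_mul, inv_one, mul_one]
    ext i j
    fin_cases i <;> fin_cases j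
    · rfl
    · exact h₁ g
    · exact h₂ g
    · rfl

theorem IsRegularElement.diagonal_of_mem [Finite (ResidueField A)]
    (h : IsRegularElement p ρbar t d g₀ α β P) {g : G}
    (hg : g ∈ (Subgroup.zpowers (ρbar g₀)).comap ρbar) :
    ∃ n : ℕ, ((P * ρbar g * P⁻¹ : GL (Fin 2) (ResidueField A)) :
      Matrix (Fin 2) (Fin 2) (ResidueField A)) =
        Matrix.diagonal ![residue A α ^ n, residue A β ^ n] := by
  obtain ⟨k, hk, n, rfl⟩ := exists_eq_mul_pow ρbar hg
  refine ⟨n, ?_⟩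
  rw [map_mul, (MonoidHom.mem_ker).mp hk, one_mul]
  exact h.diag_pow n

theorem IsRegularElement.entry_mem_bot [Finite (ResidueField A)] [CharP (ResidueField A) p]
    (h : IsRegularElement p ρbar t d g₀ α β P) :
    ∀ g ∈ (Subgroup.zpowers (ρbar g₀)).comap ρbar, ∀ i j,
      ((P * ρbar g * P⁻¹ : GL (Fin 2) (ResidueField A)) :
      Matrix (Fin 2) (Fin 2) (ResidueField A)) i j ∈ (⊥ : Subfield (ResidueField A)) := by
  intro g hg i j
  obtain ⟨n, hn⟩ := h.diagonal_of_mem hg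
  have hα : residue A α ∈ (⊥ : Subfield (ResidueField A)) := by
    rw [Subfield.mem_bot_iff_pow_eq_self _ p, ← map_pow, h.pow_left]
  have hβ : residue A β ∈ (⊥ : Subfield (ResidueField A)) := by
    rw [Subfield.mem_bot_iff_pow_eq_self _ p, ← map_pow, h.pow_right]
  rw [hn]
  fin_cases i <;> fin_cases j
  · simpa using pow_mem hα n
  · simp
  · simp
  · simpa using pow_mem hβ n

/-- The entries of the finitely many generators, corrected by integers so as to lie in the maximal
ideal, generate the trace ring topologically. Such integers exist because the residues of the trace
ring are in the prime field. -/
theorem IsAdmissible.isNoetherianRing_traceRing (hadm : IsAdmissible p ρbar t d) {c : A}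
    (hc : 2 * c = 1) (h : IsRegularElement p ρbar t d g₀ α β P) :
    IsNoetherianRing (traceRing t ((Subgroup.zpowers (ρbar g₀)).comap ρbar)) := by
  have := hadm.charP_residueField
  have := hadm.finite_residueField
  have := hadm.isTopologicalGroup
  have := hadm.compactSpace_group
  let K := (Subgroup.zpowers (ρbar g₀)).comap ρbar
  have hker : ρbar.ker ≤ K := fun g hg => by
    rw [Subgroup.mem_comap, (MonoidHom.mem_ker).mp hg]; exact one_mem _
  have hg₀ : g₀ ∈ K := Subgroup.mem_zpowers (ρbar g₀)
  have hcl := isClosed_traceRing t K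
  obtain ⟨δ, hδ⟩ := h.exists_inv
  have hα : α ∈ traceRing t K :=
    Subring.topologicalClosure_minimal _ bot_le hcl (h.left_mem hadm.natCast_mem)
  have hβ : β ∈ traceRing t K :=
    Subring.topologicalClosure_minimal _ bot_le hcl (h.right_mem hadm.natCast_mem)
  have hδm : δ ∈ traceRing t K := mem_of_mul_eq_one hcl (sub_mem hα hβ) hδ
  obtain ⟨hM, hsum, -⟩ := hadm.isPseudoRep.isMatrixEntries hc hδ h.t_eq h.d_eq
  obtain ⟨F, hF, hFK, hgen⟩ := hadm.isPseudoRep.exists_finite_generators hc hadm.continuous_t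
    hadm.natCast_mem hadm.pFiniteness hadm.continuous_residual (fun k hk => hadm.d_eq_one hk)
    (fun k hk => hadm.t_sub_two_mem hk) hM hsum g₀
  have hFK' : ∀ g ∈ F, g ∈ K := fun g hg => by
    refine (Subgroup.closure_le K).mpr ?_ (hFK hg)
    rintro k (hk | rfl)
    · exact hker hk
    · exact hg₀
  have hta : ∀ {g}, g ∈ K → ∀ ε ∈ traceRing t K, ∀ γ ∈ traceRing t K,
      diagEntry t g₀ γ ε g ∈ traceRing t K := fun {g} hg ε hε γ hγ =>
    mul_mem hε (sub_mem (mem_traceRing (mul_mem hg₀ hg)) (mul_mem hγ (mem_traceRing hg)))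
  let V : Set A := (diagEntry t g₀ β δ '' F ∪ diagEntry t g₀ α (-δ) '' F) ∪
    Set.image2 (fun g k => δ * δ * offDiagonal t g₀ α β g k) F F
  have hV : V.Finite := ((hF.image _).union (hF.image _)).union (hF.image2 _ hF)
  have hVA : ∀ v ∈ V, v ∈ traceRing t K := by
    rintro v ((⟨g, hg, rfl⟩ | ⟨g, hg, rfl⟩) | ⟨g, hg, k, hk, rfl⟩)
    · exact hta (hFK' g hg) _ hδm _ hβ
    · exact hta (hFK' g hg) _ (neg_mem hδm) _ hα
    · have h1 := hFK' g hg
      have h2 := hFK' k hk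
      refine mul_mem (mul_mem hδm hδm) (add_mem (sub_mem (sub_mem (mul_mem hα (mem_traceRing ?_))
        (mem_traceRing ?_)) (mul_mem (mul_mem hα hβ) (mem_traceRing ?_)))
        (mul_mem hβ (mem_traceRing ?_)))
      · exact mul_mem (mul_mem hg₀ h1) h2
      · exact mul_mem (mul_mem (mul_mem hg₀ h1) hg₀) h2
      · exact mul_mem h1 h2
      · exact mul_mem (mul_mem h1 hg₀) h2
  have hn : ∀ v : V, ∃ n : ℤ, (n : ResidueField A) = residue A v := fun v =>
    (mem_bot_iff_intCast p _).mp (hadm.residue_mem_bot h.entry_mem_bot (hVA v v.2))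
  choose n hn using hn
  have := hV.to_subtype
  refine Subring.isNoetherianRing_of_isClosed hcl (Fact.out : p.Prime).ne_zero hadm.natCast_mem
    (fun v : V => (v : A) - n v) (fun v => sub_mem (hVA v v.2) (intCast_mem _ _))
    (fun v => by rw [← residue_eq_zero_iff, map_sub, map_intCast, hn, sub_self]) ?_
  refine traceRing_le (Subring.isClosed_topologicalClosure _) fun g hg => ?_
  obtain ⟨k, hk, m, rfl⟩ := exists_eq_mul_pow ρbar hg
  have hVS : ∀ v ∈ V, v ∈ (Subring.closure
      (Set.range fun v : V => (v : A) - n v)).topologicalClosure := fun v hv => by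
    refine Subring.le_topologicalClosure _ ?_
    have h1 : v = (v - n ⟨v, hv⟩) + n ⟨v, hv⟩ := by ring
    rw [h1]
    exact add_mem (Subring.subset_closure ⟨⟨v, hv⟩, rfl⟩) (intCast_mem _ _)
  refine hgen _ (Subring.isClosed_topologicalClosure _)
    (fun g hg => hVS _ (Or.inl (Or.inl ⟨g, hg, rfl⟩)))
    (fun g hg => hVS _ (Or.inl (Or.inr ⟨g, hg, rfl⟩)))
    (fun g hg k hk => hVS _ (Or.inr ⟨g, hg, k, hk, rfl⟩)) k hk m

/-- The preimage of the cyclic group of `ρbar g₀` consists of products of elements of the kernel and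
powers of `g₀`, the situation of `GMA.isCongruenceSubgroup_range`. Residually it carries two
characters, which differ at `g₀`. -/
theorem IsRegularElement.hasLargeRestriction [IsDomain A] (hadm : IsAdmissible p ρbar t d) {c : A}
    (hc : 2 * c = 1) (h : IsRegularElement p ρbar t d g₀ α β P) {k₁ k₂ : G} (hk₁ : k₁ ∈ ρbar.ker)
    (hk₂ : k₂ ∈ ρbar.ker) (hk : offDiagonal t g₀ α β k₁ k₂ ≠ 0) :
    HasLargeRestriction p ρbar t d := by
  have := hadm.charP_residueField
  have := hadm.finite_residueField
  have := hadm.isTopologicalGroup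
  have := hadm.compactSpace_group
  let K := (Subgroup.zpowers (ρbar g₀)).comap ρbar
  have hker : ρbar.ker ≤ K := fun g hg => by
    rw [Subgroup.mem_comap, (MonoidHom.mem_ker).mp hg]; exact one_mem _
  have hKo : IsOpen (K : Set G) := Subgroup.isOpen_mono hker hadm.continuous_residual
  have hcK : CompactSpace K :=
    isCompact_iff_compactSpace.mp (Subgroup.isClosed_of_isOpen K hKo).isCompact
  have hg₀ : g₀ ∈ K := Subgroup.mem_zpowers (ρbar g₀)
  have hcl := isClosed_traceRing t K
  have hnoeth : IsNoetherianRing (traceRing t K) := hadm.isNoetherianRing_traceRing hc h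
  obtain ⟨δ, hδ⟩ := h.exists_inv
  have hα : α ∈ traceRing t K :=
    Subring.topologicalClosure_minimal _ bot_le hcl (h.left_mem hadm.natCast_mem)
  have hβ : β ∈ traceRing t K :=
    Subring.topologicalClosure_minimal _ bot_le hcl (h.right_mem hadm.natCast_mem)
  have hδm : δ ∈ traceRing t K := mem_of_mul_eq_one hcl (sub_mem hα hβ) hδ
  have hcm : c ∈ traceRing t K := mem_of_mul_eq_one hcl (ofNat_mem _ 2) hc
  refine hadm.hasLargeRestriction hc hker h.entry_mem_bot hnoeth (fun ρbar₀ hρ => Or.inr ?_) ?_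
  · let ι : ResidueField (traceRing t K) →+* ResidueField A := ResidueField.map (traceRing t K).subtype
    have hmat : ∀ g i j, ι ((ρbar₀ g : Matrix (Fin 2) (Fin 2) (ResidueField (traceRing t K))) i j) =
      ((P * ρbar g * P⁻¹ : GL (Fin 2) (ResidueField A)) :
        Matrix (Fin 2) (Fin 2) (ResidueField A)) i j := fun g i j => by
      rw [← hρ]; rfl
    refine isSumOfDistinctCharacters_of_diagonal (fun g => ι.injective ?_)
      (fun g => ι.injective ?_) ⟨⟨g₀, hg₀⟩, fun heq => h.residue_ne ?_⟩
    · obtain ⟨n, hn⟩ := h.diagonal_of_mem g.2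
      rw [hmat, hn, map_zero]; simp
    · obtain ⟨n, hn⟩ := h.diagonal_of_mem g.2
      rw [hmat, hn, map_zero]; simp
    · have h1 := congrArg ι heq
      rw [hmat, hmat, h.diag] at h1
      simpa using h1
  · let t₀ : K → traceRing t K := fun g => ⟨t g, mem_traceRing g.2⟩
    let d₀ : K → traceRing t K := fun g => ⟨d g, d_mem_traceRing t K hadm.isPseudoRep hc g.2⟩
    have hps : IsPseudoRep t₀ d₀ := hadm.isPseudoRep.restrict_traceRing hc
    let α₀ : traceRing t K := ⟨α, hα⟩
    let β₀ : traceRing t K := ⟨β, hβ⟩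
    have hc₀ : 2 * (⟨c, hcm⟩ : traceRing t K) = 1 := Subtype.ext hc
    have hδ₀ : (α₀ - β₀) * ⟨δ, hδm⟩ = 1 := Subtype.ext hδ
    have htg : t₀ ⟨g₀, hg₀⟩ = α₀ + β₀ := Subtype.ext h.t_eq
    have hdg : d₀ ⟨g₀, hg₀⟩ = α₀ * β₀ := Subtype.ext h.d_eq
    have hk₀ : offDiagonal t₀ ⟨g₀, hg₀⟩ α₀ β₀ ⟨k₁, hker hk₁⟩ ⟨k₂, hker hk₂⟩ ≠ 0 := fun h0 =>
      hk (congrArg Subtype.val h0)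
    have hbot : ∀ {a : A} (ha : a ∈ traceRing t K), a ∈ (⊥ : Subring A).topologicalClosure →
        (⟨a, ha⟩ : traceRing t K) ∈ (⊥ : Subring (traceRing t K)).topologicalClosure := by
      intro a ha hab
      change _ ∈ closure _
      rw [closure_subtype]
      have h1 : a ∈ closure ((⊥ : Subring A) : Set A) := hab
      refine closure_mono ?_ h1
      rintro _ hb
      obtain ⟨n, rfl⟩ := Subring.mem_bot.mp hb
      exact ⟨n, intCast_mem _ n, rfl⟩
    refine ⟨hps.exists_gma hc₀ hδ₀ htg hdg hk₀, fun R ρ hR hfin ht hd => ?_⟩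
    refine GMA.isCongruenceSubgroup_range (H := ρbar.ker.subgroupOf K) hR
      ((hadm.continuous_t.comp continuous_subtype_val).subtype_mk _) ht hd hc₀ hδ₀ htg hdg
      ((Subgroup.isClosed_of_isOpen _ hadm.continuous_residual).preimage continuous_subtype_val)
      ?_ ?_ ?_ (hbot hα (h.left_mem hadm.natCast_mem)) (hbot hβ (h.right_mem hadm.natCast_mem))
      ?_ ?_ ?_ ?_ (fun S hS hS' => eq_top_of_forall_mem t K hS hS') hk₁ hk₂ hk₀
    · intro g hg
      exact (MonoidHom.normal_ker ρbar).conj_mem _ hg _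
    · intro g hg
      rw [← maximalIdeal_comap (traceRing t K).subtype]
      exact hadm.t_sub_two_mem hg
    · intro g hg
      exact Subtype.ext (hadm.d_eq_one hg)
    · exact (isUnit_map_iff (traceRing t K).subtype α₀).mp h.isUnit_left
    · exact (isUnit_map_iff (traceRing t K).subtype β₀).mp h.isUnit_right
    · exact (isUnit_map_iff (traceRing t K).subtype (α₀ ^ 2 - β₀ ^ 2)).mp h.isUnit_sq_sub
    · rintro ⟨g, hg⟩
      obtain ⟨k, hk, n, hgk⟩ := exists_eq_mul_pow ρbar hg
      exact ⟨⟨k, hker hk⟩, hk, n, Subtype.ext hgk⟩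

end Core

/-! ### Vanishing products on the kernel: reducible, dihedral and exceptional images -/

/-- Entries whose lower left products vanish on the image of `f` give two characters. -/
theorem IsMatrixEntries.exists_characters {G A Q : Type*} [Group G] [Group Q] [CommRing A]
    {a d : G → A} {x : G → G → A} (h : IsMatrixEntries a d x) (f : Q →* G)
    (hf : ∀ q l, x l (f q) = 0) :
    ∃ χ₁ χ₂ : Q →* Aˣ, (∀ q, (χ₁ q : A) = a (f q)) ∧ ∀ q, (χ₂ q : A) = d (f q) := by
  let f₁ : Q →* A :=
    { toFun := fun q => a (f q)
      map_one' := by rw [map_one, h.one_a]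
      map_mul' := fun q r => by rw [map_mul, h.mul_a, hf, add_zero] }
  let f₂ : Q →* A :=
    { toFun := fun q => d (f q)
      map_one' := by rw [map_one, h.one_d]
      map_mul' := fun q r => by rw [map_mul, h.mul_d, hf, add_zero] }
  exact ⟨f₁.toHomUnits, f₂.toHomUnits, fun q => rfl, fun q => rfl⟩

section Field

variable {F : Type*} [Field F]

theorem Matrix.eq_zero_of_commute_diagonal {M : Matrix (Fin 2) (Fin 2) F} {x y : F} (hxy : x ≠ y)
    (h : M * Matrix.diagonal ![x, y] = Matrix.diagonal ![x, y] * M) : M 0 1 = 0 ∧ M 1 0 = 0 := by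
  have h1 := congrFun (congrFun h 0) 1
  have h2 := congrFun (congrFun h 1) 0
  rw [Matrix.mul_diagonal, Matrix.diagonal_mul] at h1 h2
  simp at h1 h2
  constructor
  · by_contra h0
    exact hxy (mul_left_cancel₀ h0 (by rw [h1, mul_comm])).symm
  · by_contra h0
    exact hxy (mul_left_cancel₀ h0 (by rw [h2, mul_comm]))

theorem Matrix.commute_of_eq_zero {M N : Matrix (Fin 2) (Fin 2) F} (hM : M 0 1 = 0 ∧ M 1 0 = 0)
    (hN : N 0 1 = 0 ∧ N 1 0 = 0) : M * N = N * M := by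
  ext i j
  fin_cases i <;> fin_cases j <;>
    simp [Matrix.mul_apply, Fin.sum_univ_two, hM.1, hM.2, hN.1, hN.2, mul_comm]

theorem Matrix.trace_mul_scalar (M : Matrix (Fin 2) (Fin 2) F) (u : F) :
    (M * Matrix.scalar (Fin 2) u).trace = u * M.trace := by
  simp [Matrix.trace_fin_two, Matrix.mul_apply, Fin.sum_univ_two]; ring

theorem IsReducibleRep.map {G : Type*} [Group G] {F' : Type*} [Field F'] {ρ : G →* GL (Fin 2) F}
    (h : IsReducibleRep ρ) (ι : F →+* F') :
    IsReducibleRep ((Matrix.GeneralLinearGroup.map ι).comp ρ) := by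
  obtain ⟨w, hw, hρ⟩ := h
  refine ⟨ι ∘ w, fun h0 => hw ?_, fun g => ?_⟩
  · ext i
    exact ι.injective (by rw [Pi.zero_apply, map_zero]; exact congrFun h0 i)
  · obtain ⟨c, hc⟩ := hρ g
    refine ⟨ι c, ?_⟩
    ext i
    have h1 := congrArg ι (congrFun hc i)
    rw [RingHom.map_mulVec] at h1
    rw [Pi.smul_apply, smul_eq_mul, map_mul] at h1
    exact h1

end Field

section Small

variable {A : Type u} [CommRing A] [IsLocalRing A] [IsNoetherianRing A] [TopologicalSpace A]
  [IsTopologicalRing A] [CompactSpace A] [T2Space A] {G : Type v} [Group G] [TopologicalSpace G]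
  {p : ℕ} [Fact p.Prime] {ρbar : G →* GL (Fin 2) (ResidueField A)} {t d : G → A}
  {g₀ : G} {α β δ : A} {P : GL (Fin 2) (ResidueField A)}

theorem IsRegularElement.residue_diagEntry (h : IsRegularElement p ρbar t d g₀ α β P)
    (hadm : IsAdmissible p ρbar t d) {k : G} (hk : k ∈ ρbar.ker) (γ ε : A) :
    residue A (diagEntry t g₀ γ ε k) = residue A ε * residue A (α + β - 2 * γ) := by
  have h1 : residue A (t (g₀ * k)) = residue A (t g₀) := by
    rw [hadm.residue_t, hadm.residue_t, map_mul, (MonoidHom.mem_ker).mp hk, mul_one]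
  have h2 : residue A (t k) = residue A 2 := by
    rw [← sub_eq_zero, ← map_sub, residue_eq_zero_iff]; exact hadm.t_sub_two_mem hk
  rw [diagEntry, map_mul, map_sub, map_mul, h1, h2, h.t_eq, map_sub, map_mul, mul_comm (residue A γ)]

theorem IsRegularElement.residue_diagEntry_eq_one (h : IsRegularElement p ρbar t d g₀ α β P)
    (hadm : IsAdmissible p ρbar t d) (hδ : (α - β) * δ = 1) {k : G} (hk : k ∈ ρbar.ker) :
    residue A (diagEntry t g₀ β δ k) = 1 ∧ residue A (diagEntry t g₀ α (-δ) k) = 1 := by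
  rw [h.residue_diagEntry hadm hk, h.residue_diagEntry hadm hk, ← map_mul, ← map_mul,
    ← map_one (residue A)]
  constructor
  · congr 1; linear_combination hδ
  · congr 1; linear_combination hδ

/-- If the off-diagonal products vanish on the kernel of the residual representation, the
centralizer of the regular element carries two characters. -/
theorem IsRegularElement.exists_characters [IsDomain A]
    (h : IsRegularElement p ρbar t d g₀ α β P) (hadm : IsAdmissible p ρbar t d) {c : A}
    (hc : 2 * c = 1) (hδ : (α - β) * δ = 1)
    (hzero : ∀ k₁ ∈ ρbar.ker, ∀ k₂ ∈ ρbar.ker, offDiagonal t g₀ α β k₁ k₂ = 0)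
    {Q : Type*} [Group Q] (f : Q →* G)
    (hf : ∀ q, ρbar (f q) * ρbar g₀ = ρbar g₀ * ρbar (f q)) :
    ∃ χ₁ χ₂ : Q →* Aˣ, (∀ q, (χ₁ q : A) = diagEntry t g₀ β δ (f q)) ∧
      ∀ q, (χ₂ q : A) = diagEntry t g₀ α (-δ) (f q) := by
  obtain ⟨hM, -, hα, hβ, hl, hr⟩ := hadm.isPseudoRep.isMatrixEntries hc hδ h.t_eq h.d_eq
  -- The middle factor `k = g₀⁻¹ (f q) g₀ (f q)⁻¹` is a commutator; it lies in the residual kernel,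
  -- which is the input of `eq_zero_of_mul_eq`.
  have hcomm : ∀ q, f q * g₀ = g₀ * (g₀⁻¹ * f q * g₀ * (f q)⁻¹ * f q) := fun q => by group
  have hmem : ∀ q, g₀⁻¹ * f q * g₀ * (f q)⁻¹ ∈ ρbar.ker := fun q => by
    rw [MonoidHom.mem_ker, map_mul, map_mul, map_mul, map_inv, map_inv, mul_assoc (ρbar g₀)⁻¹, hf]
    group
  have hres : ∀ k ∈ ρbar.ker, residue A (diagEntry t g₀ β δ k) = 1 ∧
      residue A (diagEntry t g₀ α (-δ) k) = 1 := fun k hk =>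
    h.residue_diagEntry_eq_one hadm hδ hk
  rcases hM.eq_zero_or_eq_zero (H := ρbar.ker) (fun g hg k hk => by
    rw [hzero g hg k hk, mul_zero]) with h0 | h0
  · obtain ⟨χ₁, χ₂, h1, h2⟩ := hM.symm.exists_characters f fun q l =>
      hM.symm.eq_zero_of_mul_eq (H := ρbar.ker) (g₀ := g₀) (fun k hk g => h0 k hk g)
        -- Residually the scalar to be shown nonzero is `β - α`, the diagonal entries of the kernel
        -- being congruent to `1`.
        (fun g => by rw [hl, mul_zero]) (fun k hk h3 => by
          rw [hα, hβ] at h3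
          have h4 := congrArg (residue A) h3
          rw [map_sub, map_mul, (hres k hk).1, mul_one, map_zero, sub_eq_zero] at h4
          exact h.residue_ne h4.symm) (hmem q) (hcomm q) l
    exact ⟨χ₂, χ₁, h2, h1⟩
  · exact hM.exists_characters f fun q l =>
      hM.eq_zero_of_mul_eq (H := ρbar.ker) (g₀ := g₀) (fun k hk g => h0 k hk g)
        (fun g => by rw [hr, mul_zero]) (fun k hk h3 => by
          rw [hα, hβ] at h3
          have h4 := congrArg (residue A) h3
          rw [map_sub, map_mul, (hres k hk).2, mul_one, map_zero, sub_eq_zero] at h4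
          exact h.residue_ne h4) (hmem q) (hcomm q) l

theorem IsRegularElement.isSumOfTwoCharacters [IsDomain A]
    (h : IsRegularElement p ρbar t d g₀ α β P) (hadm : IsAdmissible p ρbar t d) {c : A}
    (hc : 2 * c = 1) (hδ : (α - β) * δ = 1)
    (hzero : ∀ k₁ ∈ ρbar.ker, ∀ k₂ ∈ ρbar.ker, offDiagonal t g₀ α β k₁ k₂ = 0)
    {Q : Type*} [Group Q] [TopologicalSpace Q] (f : Q →* G) (hfc : Continuous f)
    (hf : ∀ q, ρbar (f q) * ρbar g₀ = ρbar g₀ * ρbar (f q)) :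
    IsSumOfTwoCharacters fun q => t (f q) := by
  have := hadm.isTopologicalGroup
  have htc := hadm.continuous_t
  obtain ⟨χ₁, χ₂, h1, h2⟩ := h.exists_characters hadm hc hδ hzero f hf
  obtain ⟨-, hsum, -⟩ := hadm.isPseudoRep.isMatrixEntries hc hδ h.t_eq h.d_eq
  refine ⟨χ₁, χ₂, ?_, ?_, fun q => ?_⟩
  · simp only [h1, diagEntry]; fun_prop
  · simp only [h2, diagEntry]; fun_prop
  · rw [h1, h2, hsum]

/-- On the kernel `t = χ₁ + χ₂` and `d = 1`, so both factor through the quotient by the common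
kernel of `χ₁` and `χ₂`. -/
theorem IsRegularElement.isVirtuallyAbelian [IsDomain A]
    (h : IsRegularElement p ρbar t d g₀ α β P) (hadm : IsAdmissible p ρbar t d) {c : A}
    (hc : 2 * c = 1) (hδ : (α - β) * δ = 1)
    (hzero : ∀ k₁ ∈ ρbar.ker, ∀ k₂ ∈ ρbar.ker, offDiagonal t g₀ α β k₁ k₂ = 0) :
    IsVirtuallyAbelian t d := by
  obtain ⟨χ₁, χ₂, h1, h2⟩ := h.exists_characters hadm hc hδ hzero ρbar.ker.subtype fun q => by
    rw [Subgroup.coe_subtype, (MonoidHom.mem_ker).mp q.2, one_mul, mul_one]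
  obtain ⟨-, hsum, -⟩ := hadm.isPseudoRep.isMatrixEntries hc hδ h.t_eq h.d_eq
  let χ := χ₁.prod χ₂
  refine ⟨ρbar.ker, hadm.continuous_residual, χ.ker, inferInstance, ?_, fun q => t q.out,
    fun q => d q.out, fun k => ⟨?_, ?_⟩⟩
  · intro x y
    obtain ⟨x, rfl⟩ := QuotientGroup.mk_surjective x
    obtain ⟨y, rfl⟩ := QuotientGroup.mk_surjective y
    rw [← QuotientGroup.mk_mul, ← QuotientGroup.mk_mul, QuotientGroup.eq, MonoidHom.mem_ker]
    simp only [map_mul, map_inv]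
    rw [mul_comm (χ y), inv_mul_cancel]
  · have h3 : χ (k : ρbar.ker ⧸ χ.ker).out = χ k := by
      have h4 := QuotientGroup.eq.mp (QuotientGroup.out_eq' (k : ρbar.ker ⧸ χ.ker))
      rw [MonoidHom.mem_ker, map_mul, map_inv, inv_mul_eq_one] at h4
      exact h4
    have h5 : ∀ k : ρbar.ker, t k = (χ k).1 + (χ k).2 := fun k => by
      change _ = (χ₁ k : A) + χ₂ k
      rw [h1, h2, hsum]; rfl
    change t k = t _
    rw [h5, h5, h3]
  · change d k = d _
    rw [hadm.d_eq_one k.2, hadm.d_eq_one (Subtype.property _)]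

theorem IsRegularElement.add_ne_zero (h : IsRegularElement p ρbar t d g₀ α β P) :
    residue A α + residue A β ≠ 0 := fun h0 => h.sq_ne (by
  rw [← sub_eq_zero, sq_sub_sq, h0, zero_mul])

theorem IsRegularElement.eq_zero_of_commute (h : IsRegularElement p ρbar t d g₀ α β P) {g : G}
    (hg : ρbar g * ρbar g₀ = ρbar g₀ * ρbar g) :
    ((P * ρbar g * P⁻¹ : GL (Fin 2) (ResidueField A)) :
      Matrix (Fin 2) (Fin 2) (ResidueField A)) 0 1 = 0 ∧
    ((P * ρbar g * P⁻¹ : GL (Fin 2) (ResidueField A)) :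
      Matrix (Fin 2) (Fin 2) (ResidueField A)) 1 0 = 0 := by
  refine Matrix.eq_zero_of_commute_diagonal h.residue_ne ?_
  rw [← h.diag, ← Units.val_mul, ← Units.val_mul]
  congr 1
  rw [← MulAut.conj_apply, ← MulAut.conj_apply, ← map_mul (MulAut.conj P),
    ← map_mul (MulAut.conj P), hg]

theorem IsRegularElement.commute_of_commute (h : IsRegularElement p ρbar t d g₀ α β P) {g k : G}
    (hg : ρbar g * ρbar g₀ = ρbar g₀ * ρbar g) (hk : ρbar k * ρbar g₀ = ρbar g₀ * ρbar k) :
    ρbar g * ρbar k = ρbar k * ρbar g := by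
  refine (MulAut.conj P).injective (Units.ext ?_)
  rw [map_mul, map_mul, Units.val_mul, Units.val_mul]
  exact Matrix.commute_of_eq_zero (h.eq_zero_of_commute hg) (h.eq_zero_of_commute hk)

theorem IsAdmissible.commute_of_isReducibleRep (hadm : IsAdmissible p ρbar t d)
    (hred : IsReducibleRep ρbar) (g k : G) : ρbar g * ρbar k = ρbar k * ρbar g := by
  rcases hadm.multiplicityFree with h | ⟨χ₁, χ₂, -, P, hP⟩
  · exact absurd (hred.map _) h
  · refine (MulAut.conj P).injective (Units.ext ?_)
    rw [map_mul, map_mul, Units.val_mul, Units.val_mul, MulAut.conj_apply, MulAut.conj_apply, hP, hP,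
      Matrix.diagonal_mul_diagonal, Matrix.diagonal_mul_diagonal]
    simp only [mul_comm]

/-- `K` is the preimage of the rotations. A reflection has trivial square, whereas `ρbar g₀ ^ 2` is
not scalar, so `g₀` is a rotation. Any other rotation commutes with `g₀` up to a scalar `u`, and
comparison of traces gives `u = 1` because the trace of `ρbar g₀` is not zero. -/
theorem IsRegularElement.exists_index_two (h : IsRegularElement p ρbar t d g₀ α β P)
    (hdih : IsDihedralRep ρbar) : ∃ K : Subgroup G, K.index = 2 ∧
      ∀ g ∈ K, ρbar g * ρbar g₀ = ρbar g₀ * ρbar g := by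
  obtain ⟨n, -, ⟨e⟩⟩ := hdih
  let f : G →* DihedralGroup n :=
    e.toMonoidHom.comp (Matrix.ProjGenLinGroup.mk.comp ρbar).rangeRestrict
  have hf : Function.Surjective f :=
    e.surjective.comp (MonoidHom.rangeRestrict_surjective _)
  have hfeq : ∀ {x y}, f x = f y → ∃ u, ρbar x * Matrix.GeneralLinearGroup.scalar (Fin 2) u =
      ρbar y := fun {x y} hxy => by
    have h1 := congrArg Subtype.val (e.injective hxy)
    exact Matrix.ProjGenLinGroup.mk_eq_mk_iff.mp h1
  let R : Subgroup (DihedralGroup n) :=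
    { carrier := {y | ∃ j, y = .r j}
      mul_mem' := by
        rintro _ _ ⟨i, rfl⟩ ⟨j, rfl⟩
        exact ⟨i + j, DihedralGroup.r_mul_r i j⟩
      one_mem' := ⟨0, DihedralGroup.one_def⟩
      inv_mem' := by
        rintro _ ⟨i, rfl⟩
        exact ⟨-i, DihedralGroup.inv_r i⟩ }
  have hg₀ : f g₀ ∈ R := by
    rcases hy : f g₀ with i | i
    · exact ⟨i, rfl⟩
    · exfalso
      have h1 : f (g₀ ^ 2) = f 1 := by
        rw [map_pow, hy, pow_two, DihedralGroup.sr_mul_self, map_one]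
      obtain ⟨u, hu⟩ := hfeq h1.symm
      have h2 := h.diag_pow 2
      rw [← hu, map_one, one_mul] at h2
      have h3 : P * Matrix.GeneralLinearGroup.scalar (Fin 2) u * P⁻¹ =
          Matrix.GeneralLinearGroup.scalar (Fin 2) u := by
        rw [mul_inv_eq_iff_eq_mul]
        exact (Matrix.GeneralLinearGroup.scalar_commute u P).symm
      rw [h3] at h2
      have h4 := congrFun (congrFun h2 0) 0
      have h5 := congrFun (congrFun h2 1) 1
      simp at h4 h5
      exact h.sq_ne (h4.symm.trans h5)
  refine ⟨R.comap f, ?_, fun g hg => ?_⟩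
  · rw [Subgroup.index_comap_of_surjective R hf, Subgroup.index_eq_two_iff]
    refine ⟨.sr 0, fun b => ?_⟩
    rcases b with i | i
    · refine Or.inr ⟨⟨i, rfl⟩, ?_⟩
      rw [DihedralGroup.r_mul_sr]
      rintro ⟨j, hj⟩
      cases hj
    · refine Or.inl ⟨⟨_, DihedralGroup.sr_mul_sr i 0⟩, ?_⟩
      rintro ⟨j, hj⟩
      cases hj
  · obtain ⟨i, hi⟩ := hg
    obtain ⟨j, hj⟩ := hg₀
    obtain ⟨u, hu⟩ := hfeq (x := g * g₀) (y := g₀ * g) (by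
      rw [map_mul, map_mul, hi, hj, DihedralGroup.r_mul_r, DihedralGroup.r_mul_r, add_comm])
    rw [map_mul, map_mul] at hu
    have h1 : ρbar g * ρbar g₀ * (ρbar g)⁻¹ * Matrix.GeneralLinearGroup.scalar (Fin 2) u =
        ρbar g₀ := by
      have h2 := (Matrix.GeneralLinearGroup.scalar_commute u (ρbar g)⁻¹)
      rw [mul_assoc, ← h2, ← mul_assoc, hu, mul_inv_cancel_right]
    have h3 := congrArg (fun M : GL (Fin 2) (ResidueField A) =>
      (M : Matrix (Fin 2) (Fin 2) (ResidueField A)).trace) h1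
    have h4 : (ρbar g₀ : Matrix (Fin 2) (Fin 2) (ResidueField A)).trace =
        residue A α + residue A β := by
      rw [← Matrix.GeneralLinearGroup.trace_conj P, h.diag, Matrix.trace_fin_two]
      simp
    have h6 : u = 1 := by
      refine Units.ext (mul_right_cancel₀ h.add_ne_zero ?_)
      rw [Units.val_one, one_mul, ← h4]
      refine Eq.trans ?_ h3
      rw [Units.val_mul, Matrix.GeneralLinearGroup.coe_scalar, Matrix.trace_mul_scalar,
        Matrix.GeneralLinearGroup.trace_conj]
    rw [h6, map_one, mul_one] at hu
    exact hu

end Small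

/-! ### Large projective image: bases adapted to a subfield -/

section Frame

variable {F : Type*} [Field F] {G : Type*} [Group G]

/-- The matrices of a representation in the basis given by `P`. -/
def frame (ρ : G →* GL (Fin 2) F) (P : GL (Fin 2) F) : G →* Matrix (Fin 2) (Fin 2) F :=
  (Units.coeHom _).comp ((MulAut.conj P).toMonoidHom.comp ρ)

theorem frame_apply (ρ : G →* GL (Fin 2) F) (P : GL (Fin 2) F) (g : G) :
    frame ρ P g = ((P * ρ g * P⁻¹ : GL (Fin 2) F) : Matrix (Fin 2) (Fin 2) F) := rfl

theorem frame_eq_iff {ρ : G →* GL (Fin 2) F} {P : GL (Fin 2) F} {g k : G} :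
    frame ρ P g = frame ρ P k ↔ ρ g = ρ k := by
  rw [frame_apply, frame_apply, Units.val_inj, mul_left_inj, mul_right_inj]

theorem frame_eq_one_iff {ρ : G →* GL (Fin 2) F} {P : GL (Fin 2) F} {g : G} :
    frame ρ P g = 1 ↔ g ∈ ρ.ker := by
  rw [← map_one (frame ρ P), frame_eq_iff, map_one, MonoidHom.mem_ker]

theorem trace_frame (ρ : G →* GL (Fin 2) F) (P : GL (Fin 2) F) (g : G) :
    (frame ρ P g).trace = (ρ g : Matrix (Fin 2) (Fin 2) F).trace :=
  Matrix.GeneralLinearGroup.trace_conj P _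

theorem det_frame (ρ : G →* GL (Fin 2) F) (P : GL (Fin 2) F) (g : G) :
    (frame ρ P g).det = (ρ g : Matrix (Fin 2) (Fin 2) F).det :=
  Matrix.GeneralLinearGroup.det_conj P _

/-- A matrix over a subfield `k` with eigenvalues in `k` is diagonalizable over `k`. -/
theorem Subfield.exists_diagonal_mul_mem (k : Subfield F) {M T : GL (Fin 2) F}
    (hM : ∀ i j, (M : Matrix (Fin 2) (Fin 2) F) i j ∈ k) {x y : F} (hx : x ∈ k) (hy : y ∈ k)
    (hxy : x ≠ y) (hT : ((T * M * T⁻¹ : GL (Fin 2) F) : Matrix (Fin 2) (Fin 2) F) =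
      Matrix.diagonal ![x, y]) :
    ∃ s₁ s₂ : F, s₁ ≠ 0 ∧ s₂ ≠ 0 ∧ (∀ l, s₁ * (T : Matrix (Fin 2) (Fin 2) F) 0 l ∈ k) ∧
      ∀ l, s₂ * (T : Matrix (Fin 2) (Fin 2) F) 1 l ∈ k := by
  let τ : Matrix (Fin 2) (Fin 2) F := T.val
  let σ : Matrix (Fin 2) (Fin 2) F := (T⁻¹).val
  have hστ : σ * τ = 1 := by
    simp only [σ, τ]; rw [← Units.val_mul, inv_mul_cancel, Units.val_one]
  have hτσ : τ * σ = 1 := by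
    simp only [σ, τ]; rw [← Units.val_mul, mul_inv_cancel, Units.val_one]
  have hM' : (M : Matrix (Fin 2) (Fin 2) F) = σ * Matrix.diagonal ![x, y] * τ := by
    simp only [σ, τ]
    rw [← hT, ← Units.val_mul, ← Units.val_mul]
    congr 1
    group
  have h1 : ∀ i l, (1 : Matrix (Fin 2) (Fin 2) F) i l ∈ k := fun i l => by
    rw [Matrix.one_apply]; split_ifs
    · exact k.one_mem
    · exact k.zero_mem
  have e1 : ∀ i l, (M : Matrix (Fin 2) (Fin 2) F) i l = σ i 0 * x * τ 0 l + σ i 1 * y * τ 1 l :=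
    fun i l => by
      rw [hM', Matrix.mul_apply, Fin.sum_univ_two, Matrix.mul_diagonal, Matrix.mul_diagonal]
      simp
  have e2 : ∀ i l, (1 : Matrix (Fin 2) (Fin 2) F) i l = σ i 0 * τ 0 l + σ i 1 * τ 1 l :=
    fun i l => by rw [← hστ, Matrix.mul_apply, Fin.sum_univ_two]
  have e3 : τ 0 0 * σ 0 0 + τ 0 1 * σ 1 0 = 1 := by
    have := congrFun (congrFun hτσ 0) 0
    rwa [Matrix.mul_apply, Fin.sum_univ_two] at this
  have e4 : τ 1 0 * σ 0 1 + τ 1 1 * σ 1 1 = 1 := by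
    have := congrFun (congrFun hτσ 1) 1
    rwa [Matrix.mul_apply, Fin.sum_univ_two] at this
  have h3 : ∃ i, σ i 0 ≠ 0 := by
    by_contra! h0
    rw [h0, h0] at e3; simp at e3
  have h4 : ∃ i, σ i 1 ≠ 0 := by
    by_contra! h0
    rw [h0, h0] at e4; simp at e4
  obtain ⟨i, hi⟩ := h3
  obtain ⟨j, hj⟩ := h4
  -- The matrix `M - y` has rank one: its row `i` is `(x - y) * σ i 0` times the first row of `T`.
  -- Likewise `M - x` gives the second row.
  refine ⟨(x - y) * σ i 0, (y - x) * σ j 1, mul_ne_zero (sub_ne_zero.mpr hxy) hi,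
    mul_ne_zero (sub_ne_zero.mpr hxy.symm) hj, fun l => ?_, fun l => ?_⟩
  · have h5 : (x - y) * σ i 0 * τ 0 l = (M : Matrix (Fin 2) (Fin 2) F) i l -
        y * (1 : Matrix (Fin 2) (Fin 2) F) i l := by rw [e1, e2]; ring
    change (x - y) * σ i 0 * τ 0 l ∈ k
    rw [h5]
    exact sub_mem (hM i l) (mul_mem hy (h1 i l))
  · have h5 : (y - x) * σ j 1 * τ 1 l = (M : Matrix (Fin 2) (Fin 2) F) j l -
        x * (1 : Matrix (Fin 2) (Fin 2) F) j l := by rw [e1, e2]; ring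
    change (y - x) * σ j 1 * τ 1 l ∈ k
    rw [h5]
    exact sub_mem (hM j l) (mul_mem hx (h1 j l))

/-- Both alternatives place the projective image between `PSL₂(k)` and `PGL₂(k)`. -/
theorem HasLargeProjectiveImage.exists_subfield {ρ : G →* GL (Fin 2) F}
    (h : HasLargeProjectiveImage ρ) : ∃ (k : Subfield F) (Q : GL (Fin 2) F),
    (∀ X : Matrix.SpecialLinearGroup (Fin 2) k, ∃ (g : G) (u : Fˣ),
      Q * ρ g * Q⁻¹ * Matrix.GeneralLinearGroup.scalar (Fin 2) u =
        Matrix.GeneralLinearGroup.map k.subtype X.toGL) ∧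
    ∀ g, ∃ (M : GL (Fin 2) k) (u : Fˣ),
      Matrix.GeneralLinearGroup.map k.subtype M * Matrix.GeneralLinearGroup.scalar (Fin 2) u =
        Q * ρ g * Q⁻¹ := by
  obtain ⟨k, P, hP⟩ := h
  obtain ⟨Q, rfl⟩ := Matrix.ProjGenLinGroup.mk_surjective P
  have key : ∀ g, Matrix.ProjGenLinGroup.mk (Q * ρ g * Q⁻¹) ∈
      (projectiveImage ρ).map (MulAut.conj (Matrix.ProjGenLinGroup.mk Q)).toMonoidHom := fun g =>
    ⟨Matrix.ProjGenLinGroup.mk (ρ g), ⟨g, rfl⟩, by simp⟩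
  refine ⟨k, Q, fun X => ?_, fun g => ?_⟩
  · have h1 : Matrix.ProjGenLinGroup.mk (Matrix.GeneralLinearGroup.map k.subtype X.toGL) ∈
        (projectiveImage ρ).map (MulAut.conj (Matrix.ProjGenLinGroup.mk Q)).toMonoidHom := by
      rcases hP with hP | hP
      · rw [hP]; exact ⟨X.toGL, rfl⟩
      · rw [hP]; exact ⟨X, rfl⟩
    obtain ⟨_, ⟨g, rfl⟩, hg⟩ := h1
    refine ⟨g, Matrix.ProjGenLinGroup.mk_eq_mk_iff.mp (Eq.trans ?_ hg)⟩
    simp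
  · have h1 := key g
    rcases hP with hP | hP
    · rw [hP] at h1
      obtain ⟨M, hM⟩ := h1
      exact ⟨M, Matrix.ProjGenLinGroup.mk_eq_mk_iff.mp hM⟩
    · rw [hP] at h1
      obtain ⟨M, hM⟩ := h1
      exact ⟨M.toGL, Matrix.ProjGenLinGroup.mk_eq_mk_iff.mp hM⟩

end Frame

section LargeFrame

variable {A : Type u} [CommRing A] [IsLocalRing A] {G : Type v} [Group G]
  {p : ℕ} [Fact p.Prime] [CharP (ResidueField A) p]
  {ρbar : G →* GL (Fin 2) (ResidueField A)} {t d : G → A}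
  {g₀ : G} {α β : A} {P : GL (Fin 2) (ResidueField A)}

theorem IsRegularElement.left_mem_bot (h : IsRegularElement p ρbar t d g₀ α β P) :
    residue A α ∈ (⊥ : Subfield (ResidueField A)) := by
  rw [Subfield.mem_bot_iff_pow_eq_self _ p, ← map_pow, h.pow_left]

theorem IsRegularElement.right_mem_bot (h : IsRegularElement p ρbar t d g₀ α β P) :
    residue A β ∈ (⊥ : Subfield (ResidueField A)) := by
  rw [Subfield.mem_bot_iff_pow_eq_self _ p, ← map_pow, h.pow_right]

/-- As the eigenvalues of `g₀` lie in `k`, rescaling the eigenvectors makes the passage to the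
eigenbasis defined over `k`, and such a passage preserves `SL₂(k)`. The scalar `u` between `g₀` and
a matrix over `k` is itself in `k`, by comparison of nonzero traces. -/
theorem IsRegularElement.exists_frame (h : IsRegularElement p ρbar t d g₀ α β P)
    (hl : HasLargeProjectiveImage ρbar) : ∃ P', IsRegularElement p ρbar t d g₀ α β P' ∧
      ∃ k : Subfield (ResidueField A), ∀ X : Matrix.SpecialLinearGroup (Fin 2) k, ∃ g, ∃ u,
        P' * ρbar g * P'⁻¹ * Matrix.GeneralLinearGroup.scalar (Fin 2) u =
          Matrix.GeneralLinearGroup.map k.subtype X.toGL := by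
  obtain ⟨k, Q, hX, hM⟩ := hl.exists_subfield
  obtain ⟨M, u, hMu⟩ := hM g₀
  have hlk : residue A α ∈ k := (bot_le : ⊥ ≤ k) h.left_mem_bot
  have hrk : residue A β ∈ k := (bot_le : ⊥ ≤ k) h.right_mem_bot
  have hadd : residue A α + residue A β ≠ 0 := fun h0 => h.sq_ne (by
    rw [← sub_eq_zero, sq_sub_sq, h0, zero_mul])
  have hentry : ∀ i j, ((Q * ρbar g₀ * Q⁻¹ : GL (Fin 2) (ResidueField A)) :
      Matrix (Fin 2) (Fin 2) (ResidueField A)) i j = u * M i j := fun i j => by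
    rw [← hMu, Units.val_mul, Matrix.GeneralLinearGroup.coe_scalar, Matrix.mul_apply,
      Fin.sum_univ_two]
    fin_cases j <;> simp [mul_comm]
  have hu : (u : ResidueField A) ∈ k := by
    have h1 : residue A α + residue A β = u * ((M 0 0 : k) + (M 1 1 : k)) := by
      have h2 := Matrix.GeneralLinearGroup.trace_conj P (ρbar g₀)
      rw [h.diag, ← Matrix.GeneralLinearGroup.trace_conj Q, Matrix.trace_fin_two,
        Matrix.trace_fin_two, hentry, hentry] at h2
      rw [mul_add, ← h2]; simp
    have h3 : ((M 0 0 : k) + (M 1 1 : k) : ResidueField A) ≠ 0 := fun h0 => by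
      rw [h0, mul_zero] at h1; exact hadd h1
    rw [eq_div_of_mul_eq h3 h1.symm]
    exact div_mem (add_mem hlk hrk) (add_mem (M 0 0).2 (M 1 1).2)
  obtain ⟨s₁, s₂, hs₁, hs₂, hk₁, hk₂⟩ := k.exists_diagonal_mul_mem (M := Q * ρbar g₀ * Q⁻¹)
    (T := P * Q⁻¹) (fun i j => by rw [hentry]; exact mul_mem hu (M i j).2) hlk hrk (fun h1 => h.sq_ne (by rw [h1])) (by
      rw [← h.diag]; congr 1; group)
  let Δ : GL (Fin 2) (ResidueField A) := Matrix.GeneralLinearGroup.mkOfDetNeZero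
    (Matrix.diagonal ![s₁, s₂]) (by rw [Matrix.det_diagonal]; simp [hs₁, hs₂])
  have hΔ : (Δ : Matrix (Fin 2) (Fin 2) (ResidueField A)) = Matrix.diagonal ![s₁, s₂] := rfl
  have hP' : IsRegularElement p ρbar t d g₀ α β (Δ * P) :=
    { h with
      diag := by
        have e1 : Δ * P * ρbar g₀ * (Δ * P)⁻¹ = Δ * (P * ρbar g₀ * P⁻¹) * Δ⁻¹ := by group
        have e2 : Δ * (P * ρbar g₀ * P⁻¹) = (P * ρbar g₀ * P⁻¹) * Δ := by
          refine Units.ext ?_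
          rw [Units.val_mul Δ, Units.val_mul (P * ρbar g₀ * P⁻¹) Δ, h.diag, hΔ,
            Matrix.diagonal_mul_diagonal,
            Matrix.diagonal_mul_diagonal]
          simp only [mul_comm]
        rw [e1, e2, mul_inv_cancel_right, h.diag] }
  have hS : ∀ i j, ((Δ * P * Q⁻¹ : GL (Fin 2) (ResidueField A)) :
      Matrix (Fin 2) (Fin 2) (ResidueField A)) i j ∈ k := fun i j => by
    rw [mul_assoc, Units.val_mul, hΔ, Matrix.diagonal_mul]
    fin_cases i
    · exact hk₁ j
    · exact hk₂ j
  choose S₀ hS₀ using fun i j => (⟨⟨_, hS i j⟩, rfl⟩ : ∃ y : k, (y : ResidueField A) =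
    ((Δ * P * Q⁻¹ : GL (Fin 2) (ResidueField A)) : Matrix (Fin 2) (Fin 2) (ResidueField A)) i j)
  have hS₀m : (Matrix.of S₀).map k.subtype = ((Δ * P * Q⁻¹ : GL (Fin 2) (ResidueField A)) :
      Matrix (Fin 2) (Fin 2) (ResidueField A)) := by
    ext i j; exact hS₀ i j
  let S : GL (Fin 2) k := Matrix.GeneralLinearGroup.mkOfDetNeZero (Matrix.of S₀) (fun h0 => by
    have h1 := congrArg k.subtype h0
    rw [RingHom.map_det, RingHom.mapMatrix_apply, hS₀m, map_zero] at h1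
    exact ((Matrix.isUnit_iff_isUnit_det _).mp (Δ * P * Q⁻¹).isUnit).ne_zero h1)
  have hSmap : Matrix.GeneralLinearGroup.map k.subtype S = Δ * P * Q⁻¹ := Units.ext hS₀m
  refine ⟨Δ * P, hP', k, fun X => ?_⟩
  let Y : Matrix.SpecialLinearGroup (Fin 2) k :=
    ⟨((S⁻¹ * X.toGL * S : GL (Fin 2) k) : Matrix (Fin 2) (Fin 2) k), by
      have h1 := Matrix.GeneralLinearGroup.det_conj S⁻¹ X.toGL
      rw [inv_inv] at h1
      rw [h1]
      exact X.2⟩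
  have hY : Y.toGL = S⁻¹ * X.toGL * S := Units.ext rfl
  obtain ⟨g, u', hg⟩ := hX Y
  refine ⟨g, u', ?_⟩
  rw [hY, map_mul, map_mul, map_inv, hSmap] at hg
  have h2 : Matrix.GeneralLinearGroup.map k.subtype X.toGL =
      (Δ * P * Q⁻¹) * (Q * ρbar g * Q⁻¹ * Matrix.GeneralLinearGroup.scalar (Fin 2) u') *
        (Δ * P * Q⁻¹)⁻¹ := by rw [hg]; group
  rw [h2, mul_assoc _ (Q * ρbar g * Q⁻¹ * _), mul_assoc (Q * ρbar g * Q⁻¹),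
    Matrix.GeneralLinearGroup.scalar_commute u' (Δ * P * Q⁻¹)⁻¹]
  group

end LargeFrame

/-! ### Unipotent elements in a large image -/

section Unipotent

variable {A : Type u} [CommRing A] [IsLocalRing A] [IsNoetherianRing A] [TopologicalSpace A]
  [IsTopologicalRing A] [CompactSpace A] [T2Space A] {G : Type v} [Group G] [TopologicalSpace G]
  {p : ℕ} [Fact p.Prime] {ρbar : G →* GL (Fin 2) (ResidueField A)} {t d : G → A}
  {g₀ : G} {α β : A} {P : GL (Fin 2) (ResidueField A)}

theorem IsRegularElement.frame_eq (h : IsRegularElement p ρbar t d g₀ α β P) :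
    frame ρbar P g₀ = !![residue A α, 0; 0, residue A β] := by
  rw [frame_apply, h.diag]
  ext i j
  fin_cases i <;> fin_cases j <;> rfl

/-- Scalars cancel in commutators, so `k` need only be known projectively. -/
theorem frame_commutator_eq {F : Type*} [Field F] {ρ : G →* GL (Fin 2) F} {P : GL (Fin 2) F}
    {g k : G} {u : Fˣ} {X : GL (Fin 2) F} {T : Matrix (Fin 2) (Fin 2) F}
    (hX : P * ρ k * P⁻¹ * Matrix.GeneralLinearGroup.scalar (Fin 2) u = X)
    (hT : frame ρ P g * X = T * X * frame ρ P g) : frame ρ P (g * k * g⁻¹ * k⁻¹) = T := by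
  have h1 : frame ρ P k * Matrix.scalar (Fin 2) (u : F) = (X : Matrix (Fin 2) (Fin 2) F) := by
    rw [← hX]; rfl
  have hcomm : ∀ M : Matrix (Fin 2) (Fin 2) F,
      M * Matrix.scalar (Fin 2) (u : F) = (u : F) • M := fun M => by
    rw [Matrix.scalar_apply]
    ext i j
    rw [Matrix.mul_diagonal, Matrix.smul_apply, smul_eq_mul, mul_comm]
  rw [hcomm] at h1
  have h2 : frame ρ P g * frame ρ P k = T * (frame ρ P k * frame ρ P g) := by
    rw [← h1, mul_smul_comm, mul_smul_comm, smul_mul_assoc] at hT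
    rw [← mul_assoc]
    exact smul_right_injective _ u.ne_zero hT
  rw [map_mul, map_mul, map_mul, h2, mul_assoc, mul_assoc, mul_assoc, ← map_mul, ← map_mul,
    ← map_mul]
  rw [show k * (g * (g⁻¹ * k⁻¹)) = 1 by group, map_one, mul_one]

/-- Both are commutators of `g₀` with elementary matrices. If `λ`, `μ` are the residual eigenvalues,
conjugation by `g₀` multiplies an upper entry by `λ/μ`; starting from `μ/(λ - μ)`, the commutator
has entry `1`. The lower entry `-λ/(λ - μ)` is found in the same way. -/
theorem IsRegularElement.exists_unipotent [CharP (ResidueField A) p]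
    (h : IsRegularElement p ρbar t d g₀ α β P)
    (hl : HasLargeProjectiveImage ρbar) : ∃ P', IsRegularElement p ρbar t d g₀ α β P' ∧
      ∃ U V, frame ρbar P' U = !![1, 1; 0, 1] ∧ frame ρbar P' V = !![1, 0; 1, 1] := by
  obtain ⟨P', h', k, hk⟩ := h.exists_frame hl
  have hlk : residue A α ∈ k := (bot_le : ⊥ ≤ k) h.left_mem_bot
  have hrk : residue A β ∈ k := (bot_le : ⊥ ≤ k) h.right_mem_bot
  have hne := sub_ne_zero.mpr h.residue_ne
  let l : k := ⟨_, hlk⟩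
  let m : k := ⟨_, hrk⟩
  have hlm : l - m ≠ 0 := fun h0 => hne (congrArg Subtype.val h0)
  let X : Matrix.SpecialLinearGroup (Fin 2) k :=
    ⟨!![1, m / (l - m); 0, 1], by rw [Matrix.det_fin_two_of]; ring⟩
  let Y : Matrix.SpecialLinearGroup (Fin 2) k :=
    ⟨!![1, 0; -l / (l - m), 1], by rw [Matrix.det_fin_two_of]; ring⟩
  have hXm : (Matrix.GeneralLinearGroup.map k.subtype X.toGL :
      Matrix (Fin 2) (Fin 2) (ResidueField A)) =
      !![1, residue A β / (residue A α - residue A β); 0, 1] := by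
    ext i j
    change k.subtype (X.1 i j) = _
    fin_cases i <;> fin_cases j <;> simp [X, l, m]
  have hYm : (Matrix.GeneralLinearGroup.map k.subtype Y.toGL :
      Matrix (Fin 2) (Fin 2) (ResidueField A)) =
      !![1, 0; -residue A α / (residue A α - residue A β), 1] := by
    ext i j
    change k.subtype (Y.1 i j) = _
    fin_cases i <;> fin_cases j <;> simp [Y, l, m]
  obtain ⟨g, u, hg⟩ := hk X
  obtain ⟨g', u', hg'⟩ := hk Y
  refine ⟨P', h', g₀ * g * g₀⁻¹ * g⁻¹, g₀ * g' * g₀⁻¹ * g'⁻¹, frame_commutator_eq hg ?_,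
    frame_commutator_eq hg' ?_⟩
  · rw [h'.frame_eq, hXm]
    ext i j
    fin_cases i <;> fin_cases j <;> simp [Matrix.mul_apply, Fin.sum_univ_two]
    field_simp
    ring
  · rw [h'.frame_eq, hYm]
    ext i j
    fin_cases i <;> fin_cases j <;> simp [Matrix.mul_apply, Fin.sum_univ_two]
    field_simp
    ring

theorem IsAdmissible.d_eq_one_of_det (hadm : IsAdmissible p ρbar t d) {g : G}
    (hg : (frame ρbar P g).det = 1) : d g = 1 := by
  obtain ⟨φ, hφ, hφd, -⟩ := hadm.constant_generated
  obtain ⟨x, hx⟩ := hφd g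
  have h1 := hadm.residue_d g
  rw [← det_frame ρbar P, hx, hφ, WittVector.constantCoeff_apply, WittVector.teichmuller_coeff_zero,
    hg] at h1
  rw [hx, h1, map_one, map_one]

theorem IsAdmissible.residue_t_eq (hadm : IsAdmissible p ρbar t d) (P) (g : G) :
    residue A (t g) = frame ρbar P g 0 0 + frame ρbar P g 1 1 := by
  rw [hadm.residue_t, ← trace_frame ρbar P, Matrix.trace_fin_two]

theorem IsRegularElement.residue_offDiagonal (h : IsRegularElement p ρbar t d g₀ α β P)
    (hadm : IsAdmissible p ρbar t d) (g k : G) :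
    residue A (offDiagonal t g₀ α β g k) = (residue A α - residue A β) ^ 2 *
      (frame ρbar P g 0 1 * frame ρbar P k 1 0) := by
  simp only [offDiagonal, map_sub, map_add, map_mul, hadm.residue_t_eq P, h.frame_eq,
    Matrix.mul_apply, Fin.sum_univ_two, Matrix.of_apply, Matrix.cons_val', Matrix.cons_val_zero,
    Matrix.cons_val_one, Matrix.cons_val_fin_one]
  ring

end Unipotent

section Entries

variable {G A : Type*} [Group G] [CommRing A] [IsDomain A] {a d : G → A} {x : G → G → A}

/-- Upper triangular entries on a normal subgroup, with determinant one, are trivial as soon as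
some element conjugates the two diagonal characters into each other. -/
theorem IsMatrixEntries.eq_one_of_eq_zero (h : IsMatrixEntries a d x) {H : Subgroup G} [H.Normal]
    (hx : ∀ l, ∀ k ∈ H, x l k = 0) (hdet : ∀ k ∈ H, a k * d k = 1)
    (hd : ∀ k ∈ H, d k + 1 ≠ 0) {l V : G} (hV : x l V ≠ 0) (hV2 : x l (V * V) ≠ 0) :
    ∀ k ∈ H, a k = 1 ∧ d k = 1 ∧ ∀ g, x k g = 0 := by
  have hconj : ∀ {k}, k ∈ H → ∀ W, W⁻¹ * k * W ∈ H := fun {k} hk W => by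
    simpa using Subgroup.Normal.conj_mem ‹H.Normal› k hk W⁻¹
  -- Compare the lower left entries of the two sides of `k W = W (W⁻¹ k W)`.
  have key : ∀ {k}, k ∈ H → ∀ {W}, x l W ≠ 0 → d k = a (W⁻¹ * k * W) := fun {k} hk {W} hW => by
    have h1 := h.mul_right k W l
    have h2 := h.mul_right W (W⁻¹ * k * W) l
    rw [show W * (W⁻¹ * k * W) = k * W by group, h1, hx l k hk, hx l _ (hconj hk W)] at h2
    refine mul_right_cancel₀ hW ?_
    linear_combination h2
  -- Using `key` for `V` and for `V * V`, both diagonal entries of `V⁻¹ k V` equal `d k`. Their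
  -- product is `1` and `d k ≠ -1`, so `d k = 1`.
  have h1 : ∀ k ∈ H, a k = 1 ∧ d k = 1 := fun k hk => by
    have e1 := key hk hV
    have e2 := key hk hV2
    have e3 := key (hconj hk V) hV
    rw [show V⁻¹ * (V⁻¹ * k * V) * V = (V * V)⁻¹ * k * (V * V) by group, ← e2] at e3
    have e4 := hdet _ (hconj hk V)
    rw [← e1, e3] at e4
    have e5 : d k = 1 := by
      have : (d k + 1) * (d k - 1) = 0 := by linear_combination e4
      exact sub_eq_zero.mp ((mul_eq_zero.mp this).resolve_left (hd k hk))
    refine ⟨?_, e5⟩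
    have e6 := hdet k hk
    rwa [e5, mul_one] at e6
  refine fun k hk => ⟨(h1 k hk).1, (h1 k hk).2, fun g => ?_⟩
  -- Comparing the upper left entries of `k V` gives `x k V = 0`, and rank one with `x l V ≠ 0`
  -- extends this to `x k g` for all `g`.
  have e1 := h.mul_a k V
  have e2 := h.mul_a V (V⁻¹ * k * V)
  rw [show V * (V⁻¹ * k * V) = k * V by group, e1, hx V _ (hconj hk V), (h1 k hk).1,
    (h1 _ (hconj hk V)).1] at e2
  have e3 := h.rank_one k g l V
  have e4 : x k V = 0 := by linear_combination e2
  rw [e4, zero_mul] at e3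
  exact (mul_eq_zero.mp e3).resolve_right hV

end Entries

/-! ### Pseudo-representations that factor through the residual representation -/

theorem exists_natCast_eq_of_mem_bot (p : ℕ) [Fact p.Prime] {F : Type*} [Field F] [CharP F p]
    {y : F} (hy : y ∈ (⊥ : Subfield F)) : ∃ n : ℕ, (n : F) = y := by
  obtain ⟨n, rfl⟩ := (mem_bot_iff_intCast p _).mp hy
  refine ⟨(n % p).toNat, ?_⟩
  have hp : (p : ℤ) ≠ 0 := by exact_mod_cast (Fact.out : p.Prime).ne_zero
  have h1 : (((n % p).toNat : ℤ) : F) = n := by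
    rw [Int.toNat_of_nonneg (Int.emod_nonneg n hp), CharP.intCast_eq_intCast F p]
    exact Int.mod_modEq n p
  exact_mod_cast h1

theorem Matrix.upper_pow {F : Type*} [CommRing F] (n : ℕ) :
    (!![1, 1; 0, 1] : Matrix (Fin 2) (Fin 2) F) ^ n = !![1, (n : F); 0, 1] := by
  induction n with
  | zero => rw [pow_zero, Matrix.one_fin_two, Nat.cast_zero]
  | succ n ih => rw [pow_succ, ih, Matrix.mul_fin_two]; simp [add_comm]

theorem Matrix.lower_pow {F : Type*} [CommRing F] (n : ℕ) :
    (!![1, 0; 1, 1] : Matrix (Fin 2) (Fin 2) F) ^ n = !![1, 0; (n : F), 1] := by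
  induction n with
  | zero => rw [pow_zero, Matrix.one_fin_two, Nat.cast_zero]
  | succ n ih => rw [pow_succ, ih, Matrix.mul_fin_two]; simp

/-- The pseudo-representation `(t, d)` factors through the residual representation `φ`. -/
structure IsResidual {A : Type u} [CommRing A] [IsLocalRing A] {G : Type v} [Group G] (t d : G → A)
    (φ : G →* Matrix (Fin 2) (Fin 2) (ResidueField A)) : Prop where
  isPseudoRep : IsPseudoRep t d
  residue_t : ∀ g, residue A (t g) = φ g 0 0 + φ g 1 1
  d_eq_one : ∀ g, (φ g).det = 1 → d g = 1
  t_eq : ∀ g k, φ g = φ k → t g = t k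

namespace IsResidual

variable {A : Type u} [CommRing A] [IsLocalRing A] {G : Type v} [Group G] {t d : G → A}
    {φ : G →* Matrix (Fin 2) (Fin 2) (ResidueField A)} (h : IsResidual t d φ)

include h

theorem t_mul_mul {g : G} (hg : (φ g).det = 1) (k : G) :
    t (g * (g * k)) = t g * t (g * k) - t k := by
  have h1 := h.isPseudoRep.t_mul (g * k) g
  rw [h.d_eq_one g hg, h.isPseudoRep.t_central (g * k) g, h.isPseudoRep.t_central (g * k) g⁻¹,
    inv_mul_cancel_left] at h1
  linear_combination h1

/-- The Chebyshev recursion, expanded to second order at `t g = 2`. -/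
theorem t_pow_sub_two {g : G} (hg : (φ g).det = 1) (n : ℕ) :
    ∃ v, t (g ^ n) - 2 = (t g - 2) * (n ^ 2 + (t g - 2) * v) := by
  induction n using Nat.twoStepInduction with
  | zero => exact ⟨0, by rw [pow_zero, h.isPseudoRep.t_one]; simp⟩
  | one => exact ⟨0, by rw [pow_one]; simp⟩
  | more n h0 h1 =>
    obtain ⟨v₀, h0⟩ := h0
    obtain ⟨v₁, h1⟩ := h1
    have h2 := h.t_mul_mul hg (g ^ n)
    rw [← pow_succ', ← pow_succ'] at h2
    refine ⟨t g * v₁ + (n + 1) ^ 2 - v₀, ?_⟩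
    rw [h2]
    push_cast at h1 ⊢
    linear_combination t g * h1 - h0

/-- As `g` is residually conjugate to `g ^ j`, one has `t g = t (g ^ j)`. By `t_pow_sub_two`, `t g -
2` is then killed by a scalar congruent to `j ^ 2 - 1`, a unit. -/
theorem t_eq_two {g k : G} (hg : (φ g).det = 1) (hg2 : residue A (t g) = 2) {j : ℕ}
    (hj : φ (k * g) = φ (g ^ j * k)) (hj2 : (j : ResidueField A) ^ 2 ≠ 1) : t g = 2 := by
  have h1 : φ (k * g * k⁻¹) = φ (g ^ j) := by
    rw [map_mul, hj, ← map_mul, mul_inv_cancel_right]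
  have h2 := h.t_eq _ _ h1
  rw [h.isPseudoRep.t_central, inv_mul_cancel_left] at h2
  obtain ⟨v, hv⟩ := h.t_pow_sub_two hg j
  rw [← h2] at hv
  have h3 : IsUnit ((j : A) ^ 2 + (t g - 2) * v - 1) := by
    rw [← isUnit_map_iff (residue A), isUnit_iff_ne_zero]
    simp only [map_sub, map_add, map_mul, map_pow, map_natCast, map_ofNat, map_one, hg2]
    rw [sub_self, zero_mul, add_zero, sub_ne_zero]
    exact hj2
  have h4 : (t g - 2) * ((j : A) ^ 2 + (t g - 2) * v - 1) = 0 := by linear_combination -hv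
  exact sub_eq_zero.mp ((h3.mul_left_eq_zero).mp h4)

/-- The sequence `t (g ^ n * k)` satisfies a recursion with double root `1`, so it is linear in `n`.
-/
theorem t_pow_mul {g : G} (hg : (φ g).det = 1) (hg2 : t g = 2) (n : ℕ) (k : G) :
    t (g ^ n * k) = t k + n * (t (g * k) - t k) := by
  induction n using Nat.twoStepInduction with
  | zero => simp
  | one => simp
  | more n h0 h1 =>
    have h2 := h.t_mul_mul hg (g ^ n * k)
    rw [← mul_assoc g (g ^ n), ← pow_succ', ← mul_assoc, ← pow_succ'] at h2
    rw [h2, h0, h1, hg2]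
    push_cast
    ring

variable {p : ℕ} [Fact p.Prime] [CharP (ResidueField A) p] {U V : G}
  (hU : φ U = !![1, 1; 0, 1]) (hV : φ V = !![1, 0; 1, 1]) (hU2 : t U = 2) (hV2 : t V = 2)

include p

-- Residually `U ^ p = 1`, so `p (t (U V) - t V) = t (U ^ p V) - t V` vanishes, and `t (U V) - t V`
-- has residue `3 - 2 = 1`.
include hU hV hU2 hV2 in
theorem natCast_eq_zero : (p : A) = 0 := by
  have h1 := h.t_pow_mul (by rw [hU, Matrix.det_fin_two_of]; ring) hU2 p V
  have h2 : t (U ^ p * V) = t V := by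
    refine h.t_eq _ _ ?_
    rw [map_mul, map_pow, hU, Matrix.upper_pow, CharP.cast_eq_zero, ← Matrix.one_fin_two, one_mul]
  have h3 : residue A (t (U * V)) = 3 := by
    rw [h.residue_t, map_mul, hU, hV, Matrix.mul_fin_two]
    simp; norm_num
  have h4 : IsUnit (t (U * V) - t V) := by
    rw [← isUnit_map_iff (residue A), isUnit_iff_ne_zero, map_sub, h3, hV2, map_ofNat]
    norm_num
  rw [h2] at h1
  refine (h4.mul_left_eq_zero).mp ?_
  linear_combination -h1

-- Take `w = U V ^ (p - 1) U`, residually a Weyl element with `w ^ 4 = 1`. For `τ = t w` the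
-- equation `t (w ^ 4) = 2` reads `τ ^ 2 (τ ^ 2 - 4) = 0`. The residue of `τ` is zero, so `τ = 0`;
-- linearity in the exponents gives `τ = 2 - 2 (t (U V) - 2)`.
include hU hV hU2 hV2 in
theorem t_mul_eq_three [IsDomain A] {c : A} (hc : 2 * c = 1) : t (U * V) = 3 := by
  have hp := h.natCast_eq_zero (p := p) hU hV hU2 hV2
  have hUd : (φ U).det = 1 := by rw [hU, Matrix.det_fin_two_of]; ring
  have hVd : (φ V).det = 1 := by rw [hV, Matrix.det_fin_two_of]; ring
  obtain ⟨n, hn⟩ : ∃ n : ℕ, n + 1 = p := ⟨p - 1, Nat.sub_add_cancel (Fact.out : p.Prime).one_le⟩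
  have hnA : (n : A) = -1 := by
    rw [← hn] at hp; push_cast at hp; linear_combination hp
  have hnF : (n : ResidueField A) = -1 := by
    rw [← map_natCast (residue A), hnA, map_neg, map_one]
  have hw : φ (U * V ^ n * U) = !![0, 1; -1, 0] := by
    rw [map_mul, map_mul, map_pow, hV, hU, Matrix.lower_pow, hnF, Matrix.mul_fin_two,
      Matrix.mul_fin_two]
    simp
  generalize hwdef : U * V ^ n * U = w at hw
  have hwd : (φ w).det = 1 := by rw [hw, Matrix.det_fin_two_of]; ring
  have e1 : t w = 2 - 2 * (t (U * V) - 2) := by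
    have h1 := h.t_pow_mul hUd hU2 2 (V ^ n)
    have h2 := h.t_pow_mul hVd hV2 n U
    have h3 := h.t_pow_mul hVd hV2 n 1
    rw [mul_one, mul_one, h.isPseudoRep.t_one, hV2] at h3
    rw [h.isPseudoRep.t_central, h.isPseudoRep.t_central V, hU2] at h2
    rw [← hwdef, h.isPseudoRep.t_central, ← mul_assoc, ← pow_two, h1, h2, h3, hnA]
    push_cast
    ring
  have e2 : t (w * w) = t w * t w - 2 := by
    have h1 := h.t_mul_mul hwd 1
    rwa [mul_one, h.isPseudoRep.t_one] at h1
  have e3 : t (w * w * (w * w)) = t (w * w) * t (w * w) - 2 := by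
    have h1 := h.t_mul_mul (g := w * w) (by rw [map_mul, Matrix.det_mul, hwd, one_mul]) 1
    rwa [mul_one, h.isPseudoRep.t_one] at h1
  have e4 : t (w * w * (w * w)) = 2 := by
    rw [h.t_eq (w * w * (w * w)) 1, h.isPseudoRep.t_one]
    rw [map_mul, map_mul, hw, Matrix.mul_fin_two, Matrix.mul_fin_two, map_one, Matrix.one_fin_two]
    simp
  have e5 : IsUnit (t w ^ 2 - 4) := by
    rw [← isUnit_map_iff (residue A), isUnit_iff_ne_zero, map_sub, map_pow, h.residue_t, hw]
    simp only [Matrix.of_apply, Matrix.cons_val', Matrix.cons_val_zero, Matrix.cons_val_one,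
      Matrix.cons_val_fin_one, add_zero, map_ofNat]
    intro h0
    have h1 := congrArg (residue A) hc
    rw [map_mul, map_ofNat, map_one] at h1
    have h2 : (2 : ResidueField A) * 2 = 0 := by linear_combination -h0
    rw [mul_self_eq_zero.mp h2, zero_mul] at h1
    exact zero_ne_one h1
  have e6 : t w = 0 := by
    have h1 : t w ^ 2 * (t w ^ 2 - 4) = 0 := by
      rw [e4, e2] at e3; linear_combination -e3
    exact pow_eq_zero_iff two_ne_zero |>.mp ((e5.mul_left_eq_zero).mp h1)
  rw [e6] at e1
  linear_combination c * e1 - (t (U * V) - 3) * hc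

include hU hV hU2 hV2 in
theorem t_pow_mul_pow [IsDomain A] {c : A} (hc : 2 * c = 1) (m n : ℕ) :
    t (U ^ m * V ^ n) = 2 + m * n := by
  have hUd : (φ U).det = 1 := by rw [hU, Matrix.det_fin_two_of]; ring
  have hVd : (φ V).det = 1 := by rw [hV, Matrix.det_fin_two_of]; ring
  have h1 := h.t_pow_mul hUd hU2 m (V ^ n)
  have h2 := h.t_pow_mul hVd hV2 n U
  have h3 := h.t_pow_mul hVd hV2 n 1
  have h4 := h.t_mul_eq_three (p := p) hU hV hU2 hV2 hc
  rw [mul_one, mul_one, h.isPseudoRep.t_one, hV2] at h3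
  rw [h.isPseudoRep.t_central, h.isPseudoRep.t_central V, hU2, h4] at h2
  rw [h1, h2, h3]
  ring

-- The big Bruhat cell: `U ^ l V ^ m U ^ n` has lower left entry `m` and diagonal entries `1 + l m`
-- and `1 + m n`, and the determinant fixes the last entry.
omit h in
include hU hV in
theorem exists_eq_pow_mul {M : Matrix (Fin 2) (Fin 2) (ResidueField A)}
    (hM : ∀ i j, M i j ∈ (⊥ : Subfield (ResidueField A))) (hdet : M.det = 1) (h0 : M 1 0 ≠ 0) :
    ∃ l m n : ℕ, φ (U ^ l * V ^ m * U ^ n) = M := by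
  obtain ⟨m, hm⟩ := exists_natCast_eq_of_mem_bot p (hM 1 0)
  obtain ⟨l, hl⟩ := exists_natCast_eq_of_mem_bot p
    (div_mem (sub_mem (hM 0 0) (one_mem _)) (hM 1 0))
  obtain ⟨n, hn⟩ := exists_natCast_eq_of_mem_bot p
    (div_mem (sub_mem (hM 1 1) (one_mem _)) (hM 1 0))
  refine ⟨l, m, n, ?_⟩
  rw [map_mul, map_mul, map_pow, map_pow, map_pow, hU, hV, Matrix.upper_pow, Matrix.lower_pow,
    Matrix.upper_pow, hm, hl, hn, Matrix.mul_fin_two, Matrix.mul_fin_two]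
  rw [Matrix.det_fin_two] at hdet
  ext i j
  fin_cases i <;> fin_cases j <;> simp <;> field_simp
  · ring
  · linear_combination hdet
  · ring

omit h in
include hU hV in
theorem exists_eq {M : Matrix (Fin 2) (Fin 2) (ResidueField A)}
    (hM : ∀ i j, M i j ∈ (⊥ : Subfield (ResidueField A))) (hdet : M.det = 1) : ∃ g, φ g = M := by
  by_cases h0 : M 1 0 = 0
  · have h1 : M 0 0 ≠ 0 := fun h1 => by
      rw [Matrix.det_fin_two, h0, h1] at hdet; simp at hdet
    obtain ⟨l, m, n, h2⟩ := exists_eq_pow_mul (p := p) hU hV (M := φ V * M) (fun i j => by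
        rw [hV, Matrix.mul_apply, Fin.sum_univ_two]
        refine add_mem (mul_mem ?_ (hM _ _)) (mul_mem ?_ (hM _ _)) <;> fin_cases i <;>
          simp) (by
        rw [Matrix.det_mul, hdet, hV, Matrix.det_fin_two_of]; ring) (by
        rw [hV, Matrix.mul_apply, Fin.sum_univ_two, h0]; simpa using h1)
    refine ⟨V⁻¹ * (U ^ l * V ^ m * U ^ n), ?_⟩
    rw [map_mul, h2, ← mul_assoc, ← map_mul, inv_mul_cancel, map_one, one_mul]
  · obtain ⟨l, m, n, h2⟩ := exists_eq_pow_mul (p := p) hU hV hM hdet h0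
    exact ⟨_, h2⟩

-- On the big cell the trace is `2 + (n + l) m`. Off it, `V g` and `V V g` are in the big cell and
-- `t g = 2 t (V g) - t (V V g)`, where `p - 1` serves as `-1`.
include hU hV hU2 hV2 in
theorem exists_t_eq_natCast [IsDomain A] {c : A} (hc : 2 * c = 1) {g : G}
    (hg : ∀ i j, φ g i j ∈ (⊥ : Subfield (ResidueField A))) (hdet : (φ g).det = 1) :
    ∃ n : ℕ, t g = n := by
  have key : ∀ k, (∀ i j, φ k i j ∈ (⊥ : Subfield (ResidueField A))) → (φ k).det = 1 →
      φ k 1 0 ≠ 0 → ∃ n : ℕ, t k = n := fun k hk hkd hk0 => by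
    obtain ⟨l, m, n, h1⟩ := exists_eq_pow_mul (p := p) hU hV hk hkd hk0
    refine ⟨2 + (n + l) * m, ?_⟩
    rw [← h.t_eq _ _ h1, h.isPseudoRep.t_central, ← mul_assoc, ← pow_add,
      h.t_pow_mul_pow (p := p) hU hV hU2 hV2 hc]
    push_cast
    ring
  have hV1 : ∀ i j, φ V i j ∈ (⊥ : Subfield (ResidueField A)) := fun i j => by
    rw [hV]; fin_cases i <;> fin_cases j <;> simp
  have hVd : (φ V).det = 1 := by rw [hV, Matrix.det_fin_two_of]; ring
  have hmul : ∀ k, (∀ i j, φ k i j ∈ (⊥ : Subfield (ResidueField A))) →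
      ∀ i j, φ (V * k) i j ∈ (⊥ : Subfield (ResidueField A)) := fun k hk i j => by
    rw [map_mul, Matrix.mul_apply, Fin.sum_univ_two]
    exact add_mem (mul_mem (hV1 _ _) (hk _ _)) (mul_mem (hV1 _ _) (hk _ _))
  have hmuld : ∀ k, (φ k).det = 1 → (φ (V * k)).det = 1 := fun k hk => by
    rw [map_mul, Matrix.det_mul, hVd, hk, one_mul]
  by_cases h0 : φ g 1 0 = 0
  · have h1 : φ g 0 0 ≠ 0 := fun h1 => by
      rw [Matrix.det_fin_two, h0, h1] at hdet; simp at hdet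
    have e1 : φ (V * g) 1 0 = φ g 0 0 := by
      rw [map_mul, hV, Matrix.mul_apply, Fin.sum_univ_two, h0]; simp
    have e2 : φ (V * g) 0 0 = φ g 0 0 := by
      rw [map_mul, hV, Matrix.mul_apply, Fin.sum_univ_two, h0]; simp
    have e3 : φ (V * (V * g)) 1 0 = 2 * φ g 0 0 := by
      rw [map_mul, hV, Matrix.mul_apply, Fin.sum_univ_two, e1, e2]; simp; ring
    have h2 : (2 : ResidueField A) ≠ 0 := fun h3 => by
      have h4 := congrArg (residue A) hc
      rw [map_mul, map_ofNat, map_one, h3, zero_mul] at h4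
      exact zero_ne_one h4
    obtain ⟨m, hm⟩ := key (V * g) (hmul g hg) (hmuld g hdet) (by rwa [e1])
    obtain ⟨n, hn⟩ := key (V * (V * g)) (hmul _ (hmul g hg)) (hmuld _ (hmuld g hdet)) (by
      rw [e3]; exact mul_ne_zero h2 h1)
    have h5 := h.t_mul_mul hVd g
    have hp := h.natCast_eq_zero (p := p) hU hV hU2 hV2
    obtain ⟨q, hq⟩ : ∃ q : ℕ, q + 1 = p :=
      ⟨p - 1, Nat.sub_add_cancel (Fact.out : p.Prime).one_le⟩
    refine ⟨2 * m + q * n, ?_⟩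
    rw [← hq] at hp
    push_cast at hp ⊢
    rw [hm, hn, hV2] at h5
    linear_combination h5 - n * hp
  · exact key g hg hdet h0

end IsResidual

/-! ### Comparison with matrices over the residue field -/

namespace GMA

variable {A : Type u} [CommRing A] {R : GMA A} {G : Type v} [Group G] {t d : G → A}
  {ρ : G →* R.Algˣ}

/-- If `t` is the trace of a representation `φ` over a field, the elements of the span of the image
of `ρ` correspond to matrices. -/
theorem exists_matrix_of_mem_span {F : Type*} [Field F] {ι : A →+* F} {k : Subfield F}
    (hιk : ∀ a, ι a ∈ k) {φ : G →* Matrix (Fin 2) (Fin 2) F} (hφk : ∀ g i j, φ g i j ∈ k)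
    (ht : ∀ g, (ρ g : R.Alg).tr = t g) (htφ : ∀ g, ι (t g) = (φ g).trace) {z : R.Alg}
    (hz : z ∈ Submodule.span A (Set.range fun g => (ρ g : R.Alg))) :
    ∃ M : Matrix (Fin 2) (Fin 2) F, (∀ i j, M i j ∈ k) ∧
      (∀ h, ι (R.trLinear (z * ρ h)) = (M * φ h).trace) ∧
      ∀ (w : R.Alg) (N : Matrix (Fin 2) (Fin 2) F),
        (∀ h, ι (R.trLinear (w * ρ h)) = (N * φ h).trace) →
          ι (R.trLinear (w * z)) = (N * M).trace := by
  induction hz using Submodule.span_induction with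
  | mem x hx =>
    obtain ⟨g, rfl⟩ := hx
    refine ⟨φ g, hφk g, fun h => ?_, fun w N hw => hw g⟩
    rw [← Units.val_mul, ← map_mul ρ, ← map_mul φ, trLinear_apply, ht, htφ]
  | zero => exact ⟨0, fun i j => k.zero_mem, fun h => by simp, fun w N hw => by simp⟩
  | add x y _ _ hx hy =>
    obtain ⟨M, h1, h2, h3⟩ := hx
    obtain ⟨M', h1', h2', h3'⟩ := hy
    refine ⟨M + M', fun i j => k.add_mem (h1 i j) (h1' i j), fun h => ?_, fun w N hw => ?_⟩
    · rw [add_mul, map_add, map_add, h2, h2', add_mul, Matrix.trace_add]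
    · rw [mul_add, map_add, map_add, h3 w N hw, h3' w N hw, mul_add, Matrix.trace_add]
  | smul a x _ hx =>
    obtain ⟨M, h1, h2, h3⟩ := hx
    refine ⟨ι a • M, fun i j => k.mul_mem (hιk a) (h1 i j), fun h => ?_, fun w N hw => ?_⟩
    · rw [smul_mul_assoc, map_smul, smul_eq_mul, map_mul, h2, smul_mul_assoc, Matrix.trace_smul,
        smul_eq_mul]
    · rw [mul_smul_comm, map_smul, smul_eq_mul, map_mul, h3 w N hw, mul_smul_comm,
        Matrix.trace_smul, smul_eq_mul]

/-- If `t` is the trace of a representation over a field whose image contains `SL₂(k)`, all the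
elements of determinant one are in the image of `ρ`. -/
theorem exists_rho_eq [IsDomain A] {F : Type*} [Field F] {ι : A →+* F} (hι : Function.Injective ι)
    {k : Subfield F} (hιk : ∀ a, ι a ∈ k) {φ : G →* Matrix (Fin 2) (Fin 2) F}
    (hφk : ∀ g i j, φ g i j ∈ k) (htφ : ∀ g, ι (t g) = (φ g).trace)
    (hsurj : ∀ M : Matrix (Fin 2) (Fin 2) F, (∀ i j, M i j ∈ k) → M.det = 1 → ∃ g, φ g = M)
    (hR : R.IsFaithful)
    (ht : ∀ g, (ρ g : R.Alg).tr = t g) (hd : ∀ g, (ρ g : R.Alg).det = d g)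
    {c α β δ : A} (hc : 2 * c = 1) (hδ : (α - β) * δ = 1) {g₀ : G} (htg : t g₀ = α + β)
    (hdg : d g₀ = α * β) {k₁ k₂ : G} (hk : offDiagonal t g₀ α β k₁ k₂ ≠ 0) {y : R.Alg}
    (hy : y.det = 1) : ∃ g, (ρ g : R.Alg) = y := by
  obtain ⟨κ, hκ⟩ : ∃ κ, κ = δ * δ * offDiagonal t g₀ α β k₁ k₂ := ⟨_, rfl⟩
  have hδ0 : δ ≠ 0 := by rintro rfl; simp at hδ
  have hκ0 : ι κ ≠ 0 := (map_ne_zero_iff ι hι).mpr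
    (by rw [hκ]; exact mul_ne_zero (mul_ne_zero hδ0 hδ0) hk)
  have h1 := smul_mem_span ht hd hδ htg hdg k₁ k₂ y
  rw [← hκ] at h1
  obtain ⟨M, hM, hM1, hM2⟩ := exists_matrix_of_mem_span hιk hφk ht htφ h1
  have h2 : ι 2 * ι c = 1 := by rw [← map_mul, hc, map_one]
  rw [map_ofNat] at h2
  have e1 := hM2 _ _ hM1
  have e2 := hM1 1
  rw [map_one, map_one, Units.val_one, mul_one, mul_one] at e2
  rw [smul_mul_assoc, mul_smul_comm, LinearMap.map_smul, LinearMap.map_smul, smul_eq_mul, smul_eq_mul, map_mul,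
    map_mul, Matrix.trace_fin_two, Matrix.mul_apply, Matrix.mul_apply, Fin.sum_univ_two,
    Fin.sum_univ_two] at e1
  rw [LinearMap.map_smul, smul_eq_mul, map_mul, Matrix.trace_fin_two] at e2
  have e3 := congrArg ι (R.two_mul_det y)
  rw [hy, mul_one, map_sub, map_mul, map_ofNat, ← trLinear_apply, ← trLinear_apply] at e3
  -- The determinant of the matrix attached to `κ y` is read off from the traces of `κ y` and of its
  -- square. Dividing by `κ` gives an element of `SL₂(k)`, hence some `φ g`; then `ρ g` and `y` have
  -- the same traces against the image.
  have e4 : M.det = ι κ ^ 2 := by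
    rw [Matrix.det_fin_two]
    linear_combination ι c * e1 - ι c * (ι κ * ι (R.trLinear y) + M 0 0 + M 1 1) * e2
      - ι c * ι κ ^ 2 * e3 + (ι κ ^ 2 - M 0 0 * M 1 1 + M 0 1 * M 1 0) * h2
  obtain ⟨g, hg⟩ := hsurj ((ι κ)⁻¹ • M) (fun i j => k.mul_mem (k.inv_mem (hιk κ)) (hM i j)) (by
    rw [Matrix.det_smul, e4, Fintype.card_fin, ← mul_pow, inv_mul_cancel₀ hκ0, one_pow])
  refine ⟨g, (sub_eq_zero.mp (eq_zero_of_tr_mul_rho hR ht hd hc hδ htg hdg hk fun h => hι ?_)).symm⟩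
  have e5 := hM1 h
  rw [smul_mul_assoc, map_smul, smul_eq_mul, map_mul] at e5
  rw [sub_mul, map_sub, map_sub, map_zero, ← Units.val_mul, ← map_mul ρ, R.trLinear_apply (ρ _ : R.Alg),
    ht, htφ, map_mul φ, hg, smul_mul_assoc, Matrix.trace_smul, ← e5, smul_eq_mul,
    inv_mul_cancel_left₀ hκ0, sub_self]

end GMA

/-! ### Large image with vanishing products: trivial action of the kernel -/

section Large

variable {A : Type u} [CommRing A] [IsLocalRing A] [IsNoetherianRing A] [TopologicalSpace A]
  [IsTopologicalRing A] [CompactSpace A] [T2Space A] {G : Type v} [Group G] [TopologicalSpace G]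
  {p : ℕ} [Fact p.Prime] {ρbar : G →* GL (Fin 2) (ResidueField A)} {t d : G → A}
  {g₀ : G} {α β δ : A} {P : GL (Fin 2) (ResidueField A)}

theorem residue_two_ne_zero {c : A} (hc : 2 * c = 1) : (2 : ResidueField A) ≠ 0 := fun h3 => by
  have h4 := congrArg (residue A) hc
  rw [map_mul, map_ofNat, map_one, h3, zero_mul] at h4
  exact zero_ne_one h4

/-- If the lower entries vanish on the kernel, `V` and `V * V` have nonzero lower entries, as `2` is
residually nonzero, and `IsMatrixEntries.eq_one_of_eq_zero` shows that the kernel does not affect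
`t`. If the upper entries vanish, `U` plays the same role. -/
theorem IsRegularElement.isResidual [IsDomain A] [CharP (ResidueField A) p]
    (h : IsRegularElement p ρbar t d g₀ α β P)
    (hadm : IsAdmissible p ρbar t d) {c : A} (hc : 2 * c = 1) (hδ : (α - β) * δ = 1)
    (hzero : ∀ k₁ ∈ ρbar.ker, ∀ k₂ ∈ ρbar.ker, offDiagonal t g₀ α β k₁ k₂ = 0) {U V : G}
    (hU : frame ρbar P U = !![1, 1; 0, 1]) (hV : frame ρbar P V = !![1, 0; 1, 1]) :
    IsResidual t d (frame ρbar P) := by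
  obtain ⟨hM, hsum, -⟩ := hadm.isPseudoRep.isMatrixEntries hc hδ h.t_eq h.d_eq
  have h2 := residue_two_ne_zero hc
  have hδ0 : δ ≠ 0 := by rintro rfl; simp at hδ
  have hne := sub_ne_zero.mpr h.residue_ne
  have hx : ∀ {g k}, frame ρbar P g 0 1 ≠ 0 → frame ρbar P k 1 0 ≠ 0 →
      δ * δ * offDiagonal t g₀ α β g k ≠ 0 := fun {g k} hg hk =>
    mul_ne_zero (mul_ne_zero hδ0 hδ0) fun h0 => by
      have h1 := h.residue_offDiagonal hadm g k
      rw [h0, map_zero] at h1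
      exact mul_ne_zero (pow_ne_zero 2 hne) (mul_ne_zero hg hk) h1.symm
  have hU1 : frame ρbar P U 0 1 ≠ 0 := by rw [hU]; simp
  have hV1 : frame ρbar P V 1 0 ≠ 0 := by rw [hV]; simp
  have hU2 : frame ρbar P (U * U) 0 1 ≠ 0 := by
    rw [map_mul, hU, Matrix.mul_fin_two]; simpa [one_add_one_eq_two] using h2
  have hV2 : frame ρbar P (V * V) 1 0 ≠ 0 := by
    rw [map_mul, hV, Matrix.mul_fin_two]; simpa [one_add_one_eq_two] using h2
  have hadd : ∀ {b : A}, residue A b = 1 → b + 1 ≠ 0 := fun {b} hb h0 => by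
    have h1 := congrArg (residue A) h0
    rw [map_add, hb, map_one, map_zero, one_add_one_eq_two] at h1
    exact h2 h1
  have hdet : ∀ k ∈ ρbar.ker, diagEntry t g₀ β δ k * diagEntry t g₀ α (-δ) k = 1 := fun k hk => by
    have h3 := hadm.isPseudoRep.two_mul_d k
    have h4 := hM.mul_a k k
    have h5 := hM.mul_d k k
    rw [hzero k hk k hk] at h4 h5
    rw [hadm.d_eq_one hk, ← hsum, ← hsum, h4, h5] at h3
    linear_combination (-c) * h3 + (1 - diagEntry t g₀ β δ k * diagEntry t g₀ α (-δ) k) * hc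
  have key : ∀ k ∈ ρbar.ker, ∀ g, t (k * g) = t g := by
    intro k hk g
    rcases hM.eq_zero_or_eq_zero (H := ρbar.ker) (fun g hg k hk => by
      rw [hzero g hg k hk, mul_zero]) with h0 | h0
    · obtain ⟨h3, h4, h5⟩ := hM.symm.eq_one_of_eq_zero (H := ρbar.ker) (fun l k hk => h0 k hk l)
        (fun k hk => by rw [mul_comm]; exact hdet k hk)
        (fun k hk => hadd (h.residue_diagEntry_eq_one hadm hδ hk).1) (l := V) (V := U)
        (hx hU1 hV1) (hx hU2 hV1) k hk
      rw [← hsum, ← hsum, hM.mul_a, hM.mul_d, h3, h4, h5, h0 k hk, one_mul, one_mul, add_zero,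
        add_zero]
    · obtain ⟨h3, h4, h5⟩ := hM.eq_one_of_eq_zero (H := ρbar.ker) (fun l k hk => h0 k hk l)
        hdet (fun k hk => hadd (h.residue_diagEntry_eq_one hadm hδ hk).2) (l := U) (V := V)
        (hx hU1 hV1) (hx hU1 hV2) k hk
      rw [← hsum, ← hsum, hM.mul_a, hM.mul_d, h3, h4, h5, h0 k hk, one_mul, one_mul, add_zero,
        add_zero]
  refine ⟨hadm.isPseudoRep, fun g => hadm.residue_t_eq P g, fun g => hadm.d_eq_one_of_det,
    fun g k hgk => ?_⟩
  rw [← key (g * k⁻¹) (by rw [MonoidHom.mem_ker, map_mul, map_inv, frame_eq_iff.mp hgk,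
    mul_inv_cancel]) k, inv_mul_cancel_right]

/-- Residually `g₀` conjugates `U` to `U ^ i`, where `i` represents the ratio of the eigenvalues in
the prime field. By regularity `i ^ 2 ≠ 1`, so `t_eq_two` applies. For `V` the ratio is inverted. -/
theorem IsRegularElement.t_unipotent (h : IsRegularElement p ρbar t d g₀ α β P)
    [CharP (ResidueField A) p] (hres : IsResidual t d (frame ρbar P)) {U V : G}
    (hU : frame ρbar P U = !![1, 1; 0, 1]) (hV : frame ρbar P V = !![1, 0; 1, 1]) :
    t U = 2 ∧ t V = 2 := by
  obtain ⟨i, hi⟩ := exists_natCast_eq_of_mem_bot p (div_mem h.left_mem_bot h.right_mem_bot)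
  obtain ⟨j, hj⟩ := exists_natCast_eq_of_mem_bot p (div_mem h.right_mem_bot h.left_mem_bot)
  have h1 := h.left_ne
  have h2 := h.right_ne
  constructor
  · refine hres.t_eq_two (k := g₀) (j := i) (by rw [hU, Matrix.det_fin_two_of]; ring)
      (by rw [hres.residue_t, hU]; simp [one_add_one_eq_two]) ?_ ?_
    · rw [map_mul, map_mul, map_pow, hU, h.frame_eq, Matrix.upper_pow, hi, Matrix.mul_fin_two,
        Matrix.mul_fin_two]
      simp [h2]
    · rw [hi, div_pow, Ne, div_eq_one_iff_eq (pow_ne_zero 2 h2)]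
      exact h.sq_ne
  · refine hres.t_eq_two (k := g₀) (j := j) (by rw [hV, Matrix.det_fin_two_of]; ring)
      (by rw [hres.residue_t, hV]; simp [one_add_one_eq_two]) ?_ ?_
    · rw [map_mul, map_mul, map_pow, hV, h.frame_eq, Matrix.lower_pow, hj, Matrix.mul_fin_two,
        Matrix.mul_fin_two]
      simp [h1]
    · rw [hj, div_pow, Ne, div_eq_one_iff_eq (pow_ne_zero 2 h1)]
      exact h.sq_ne.symm

end Large

/-! ### The preimage of `SL₂(k)` and an irreducibility criterion -/

section SpecialLinear

variable {F : Type*} [Field F] {G : Type*} [Group G]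

/-- The elements whose matrix is in `SL₂(k)`. -/
def specialLinearComap (ρ : G →* GL (Fin 2) F) (P : GL (Fin 2) F) (k : Subfield F) : Subgroup G :=
  ((Matrix.GeneralLinearGroup.map k.subtype).comp
    (Matrix.SpecialLinearGroup.toGL (n := Fin 2))).range.comap
      ((MulAut.conj P).toMonoidHom.comp ρ)

theorem mem_specialLinearComap {ρ : G →* GL (Fin 2) F} {P : GL (Fin 2) F} {k : Subfield F} {g : G} :
    g ∈ specialLinearComap ρ P k ↔ (∀ i j, frame ρ P g i j ∈ k) ∧ (frame ρ P g).det = 1 := by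
  constructor
  · rintro ⟨X, hX⟩
    have h1 : frame ρ P g = k.subtype.mapMatrix X.1 := (congrArg Units.val hX).symm
    rw [h1]
    exact ⟨fun i j => (X.1 i j).2, by rw [← RingHom.map_det, X.2, map_one]⟩
  · rintro ⟨h1, h2⟩
    have h3 : k.subtype.mapMatrix (Matrix.of fun i j => (⟨_, h1 i j⟩ : k)) = frame ρ P g := by
      ext i j; rfl
    refine ⟨⟨Matrix.of fun i j => ⟨_, h1 i j⟩, k.subtype.injective ?_⟩, Units.ext h3⟩
    rw [RingHom.map_det, h3, h2, map_one]

theorem isAbsolutelyIrreducibleRep_of_unipotent {ψ : G →* GL (Fin 2) F} {U V : G}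
    (hU : (ψ U : Matrix (Fin 2) (Fin 2) F) = !![1, 1; 0, 1])
    (hV : (ψ V : Matrix (Fin 2) (Fin 2) F) = !![1, 0; 1, 1]) : IsAbsolutelyIrreducibleRep ψ := by
  rintro ⟨w, hw, h⟩
  have h1 : ∀ g, (((Matrix.GeneralLinearGroup.map (algebraMap F (AlgebraicClosure F))).comp ψ) g :
      Matrix (Fin 2) (Fin 2) (AlgebraicClosure F)) =
      (ψ g : Matrix (Fin 2) (Fin 2) F).map (algebraMap F (AlgebraicClosure F)) := fun g => rfl
  obtain ⟨a, ha⟩ := h U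
  obtain ⟨b, hb⟩ := h V
  rw [h1, hU] at ha
  rw [h1, hV] at hb
  have a0 := congrFun ha 0
  have a1 := congrFun ha 1
  have b0 := congrFun hb 0
  have b1 := congrFun hb 1
  simp [Matrix.mulVec, dotProduct, Fin.sum_univ_two] at a0 a1 b0 b1
  have e0 : w 0 = 0 := by
    by_contra h0
    have : b = 1 := mul_right_cancel₀ h0 (by rw [one_mul, ← b0])
    rw [this, one_mul] at b1
    exact h0 (by linear_combination b1)
  have e1 : w 1 = 0 := by
    by_contra h0
    have : a = 1 := mul_right_cancel₀ h0 (by rw [one_mul, ← a1])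
    rw [this, one_mul] at a0
    exact h0 (by linear_combination a0)
  exact hw (by ext i; fin_cases i <;> simp [e0, e1])

end SpecialLinear

/-! ### Full image over the prime field -/

section Large

variable {A : Type u} [CommRing A] [IsLocalRing A] [IsNoetherianRing A] [TopologicalSpace A]
  [IsTopologicalRing A] [CompactSpace A] [T2Space A] {G : Type v} [Group G] [TopologicalSpace G]
  {p : ℕ} [Fact p.Prime] {ρbar : G →* GL (Fin 2) (ResidueField A)} {t d : G → A}
  {g₀ : G} {α β δ : A} {P : GL (Fin 2) (ResidueField A)}

/-- The large case where the pseudo-representation factors through the residual one. -/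
theorem IsResidual.hasLargeRestriction [IsDomain A] [CharP (ResidueField A) p]
    (hadm : IsAdmissible p ρbar t d) {c : A} (hc : 2 * c = 1)
    (h : IsRegularElement p ρbar t d g₀ α β P)
    (hres : IsResidual t d (frame ρbar P)) {U V : G}
    (hU : frame ρbar P U = !![1, 1; 0, 1]) (hV : frame ρbar P V = !![1, 0; 1, 1]) :
    HasLargeRestriction p ρbar t d := by
  have := hadm.finite_residueField
  have := hadm.isTopologicalGroup
  have := hadm.compactSpace_group
  obtain ⟨hU2, hV2⟩ := h.t_unipotent hres hU hV
  have hp0 : (p : A) = 0 := hres.natCast_eq_zero hU hV hU2 hV2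
  have hcharA : CharP A p := (CharP.charP_iff_prime_eq_zero Fact.out).mpr hp0
  have hcast : ∀ {m n : ℕ}, (m : ResidueField A) = n → (m : A) = n := fun {m n} hmn => by
    rw [CharP.natCast_eq_natCast A p]
    exact (CharP.natCast_eq_natCast (ResidueField A) p).mp hmn
  let K := specialLinearComap ρbar P ⊥
  have hKmem : ∀ g, g ∈ K ↔ _ := fun g => mem_specialLinearComap
  have hker : ρbar.ker ≤ K := fun g hg => by
    rw [hKmem, frame_eq_one_iff.mpr hg]
    refine ⟨fun i j => ?_, Matrix.det_one⟩
    rw [Matrix.one_apply]; split_ifs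
    · exact one_mem _
    · exact zero_mem _
  have hKo : IsOpen (K : Set G) := Subgroup.isOpen_mono hker hadm.continuous_residual
  have hcK : CompactSpace K :=
    isCompact_iff_compactSpace.mp (Subgroup.isClosed_of_isOpen K hKo).isCompact
  have hUK : U ∈ K := by
    rw [hKmem, hU, Matrix.det_fin_two_of]
    exact ⟨fun i j => by fin_cases i <;> fin_cases j <;> simp, by ring⟩
  have hVK : V ∈ K := by
    rw [hKmem, hV, Matrix.det_fin_two_of]
    exact ⟨fun i j => by fin_cases i <;> fin_cases j <;> simp, by ring⟩
  have hcl := isClosed_traceRing t K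
  have hfin : Set.Finite (Set.range fun n : ℕ => (n : A)) := by
    refine ((Set.finite_lt_nat p).image fun n : ℕ => (n : A)).subset ?_
    rintro _ ⟨n, rfl⟩
    refine ⟨n % p, Nat.mod_lt _ (Fact.out : p.Prime).pos, ?_⟩
    exact (CharP.natCast_eq_natCast A p).mpr (Nat.mod_modEq n p)
  have hS : (Int.castRingHom A).range ≤ traceRing t K := by
    rintro _ ⟨n, rfl⟩; exact intCast_mem _ n
  -- The traces on `K` are integers and `p = 0` in `A`, so the trace ring is the prime field.
  have hnat : ∀ z ∈ traceRing t K, ∃ n : ℕ, (n : A) = z := by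
    have h1 : ∀ z ∈ (Int.castRingHom A).range, z ∈ Set.range fun n : ℕ => (n : A) := by
      rintro _ ⟨n, rfl⟩
      obtain ⟨m, hm⟩ := exists_natCast_eq_of_mem_bot p
        (intCast_mem (⊥ : Subfield (ResidueField A)) n)
      refine ⟨m, ?_⟩
      have h2 : ((m : ℤ) : ResidueField A) = n := by exact_mod_cast hm
      rw [CharP.intCast_eq_intCast (ResidueField A) p, ← CharP.intCast_eq_intCast A p] at h2
      exact_mod_cast h2
    have h2 : traceRing t K ≤ (Int.castRingHom A).range :=
      traceRing_le (hfin.subset h1).isClosed fun g hg => by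
        obtain ⟨n, hn⟩ := hres.exists_t_eq_natCast (p := p) hU hV hU2 hV2 hc
          ((hKmem g).mp hg).1 ((hKmem g).mp hg).2
        exact ⟨n, by rw [hn]; simp⟩
    exact fun z hz => h1 z (h2 hz)
  have hfinite : Finite (traceRing t K) := (hfin.subset hnat).to_subtype
  let ι : traceRing t K →+* ResidueField A := (residue A).comp (traceRing t K).subtype
  have hι : Function.Injective ι := by
    rintro ⟨x, hx⟩ ⟨y, hy⟩ hxy
    obtain ⟨m, rfl⟩ := hnat x hx
    obtain ⟨n, rfl⟩ := hnat y hy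
    refine Subtype.ext (hcast ?_)
    have h1 : residue A m = residue A n := hxy
    rwa [map_natCast, map_natCast] at h1
  have hιk : ∀ a, ι a ∈ (⊥ : Subfield (ResidueField A)) := by
    rintro ⟨x, hx⟩
    obtain ⟨m, rfl⟩ := hnat x hx
    change residue A m ∈ _
    rw [map_natCast]
    exact natCast_mem _ m
  refine hadm.hasLargeRestriction hc hker (P := P) (fun g hg => ((hKmem g).mp hg).1) inferInstance
    (fun ρbar₀ hρ => Or.inl ?_) ?_
  · let κ : ResidueField (traceRing t K) →+* ResidueField A := ResidueField.map (traceRing t K).subtype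
    have hmat : ∀ g i j, κ ((ρbar₀ g : Matrix (Fin 2) (Fin 2) (ResidueField (traceRing t K))) i j) =
      frame ρbar P g i j := fun g i j => by
      rw [frame_apply, ← hρ]; rfl
    refine isAbsolutelyIrreducibleRep_of_unipotent (U := ⟨U, hUK⟩) (V := ⟨V, hVK⟩) ?_ ?_
    · ext i j
      refine κ.injective ?_
      rw [hmat, hU]
      fin_cases i <;> fin_cases j <;> simp
    · ext i j
      refine κ.injective ?_
      rw [hmat, hV]
      fin_cases i <;> fin_cases j <;> simp
  · let t₀ : K → traceRing t K := fun g => ⟨t g, mem_traceRing g.2⟩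
    let d₀ : K → traceRing t K := fun g => ⟨d g, d_mem_traceRing t K hadm.isPseudoRep hc g.2⟩
    have hps : IsPseudoRep t₀ d₀ := hadm.isPseudoRep.restrict_traceRing hc
    have hr := div_mem h.left_mem_bot h.right_mem_bot
    have hr' := div_mem h.right_mem_bot h.left_mem_bot
    have hl0 := h.left_ne
    have hr0 := h.right_ne
    -- Since `g₀` need not lie in `K`, it is replaced by `diag(λ/μ, μ/λ)` in `SL₂(𝔽_p)`, where `λ`,
    -- `μ` are its residual eigenvalues; the new ones are distinct because `λ ^ 2 ≠ μ ^ 2`.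
    obtain ⟨g₁, hg₁⟩ := IsResidual.exists_eq (φ := frame ρbar P) (p := p) hU hV
      (M := !![residue A α / residue A β, 0; 0, residue A β / residue A α])
      (fun i j => by
        fin_cases i <;> fin_cases j
        · exact hr
        · exact zero_mem _
        · exact zero_mem _
        · exact hr') (by rw [Matrix.det_fin_two_of]; field_simp; ring)
    have hg₁K : g₁ ∈ K := by
      rw [hKmem, hg₁, Matrix.det_fin_two_of]
      refine ⟨fun i j => ?_, by field_simp; ring⟩
      fin_cases i <;> fin_cases j
      · exact hr
      · exact zero_mem _
      · exact zero_mem _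
      · exact hr'
    obtain ⟨a, ha⟩ := exists_natCast_eq_of_mem_bot p hr
    obtain ⟨b, hb⟩ := exists_natCast_eq_of_mem_bot p hr'
    have hcm : c ∈ traceRing t K := mem_of_mul_eq_one hcl (ofNat_mem _ 2) hc
    have hc₀ : 2 * (⟨c, hcm⟩ : traceRing t K) = 1 := Subtype.ext hc
    have htg : t₀ ⟨g₁, hg₁K⟩ = (a : traceRing t K) + b := hι (by
      rw [map_add, map_natCast, map_natCast, ha, hb]
      change residue A (t g₁) = _
      rw [hres.residue_t, hg₁]; rfl)
    have hdg : d₀ ⟨g₁, hg₁K⟩ = (a : traceRing t K) * b := hι (by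
      rw [map_mul, map_natCast, map_natCast, ha, hb]
      change residue A (d g₁) = _
      rw [hadm.d_eq_one_of_det ((hKmem g₁).mp hg₁K).2, map_one]
      field_simp)
    have hab : ι ((a : traceRing t K) - b) ≠ 0 := by
      rw [map_sub, map_natCast, map_natCast, ha, hb, sub_ne_zero]
      intro h0
      rw [div_eq_div_iff hr0 hl0] at h0
      exact h.sq_ne (by rw [pow_two, pow_two, h0])
    obtain ⟨δ, hδ⟩ : ∃ δ, ((a : traceRing t K) - b) * δ = 1 := by
      refine IsUnit.exists_right_inv ?_
      rw [← isUnit_map_iff (traceRing t K).subtype, ← isUnit_map_iff (residue A)]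
      exact isUnit_iff_ne_zero.mpr hab
    have hoff : ι (offDiagonal t₀ ⟨g₁, hg₁K⟩ (a : traceRing t K) b ⟨U, hUK⟩ ⟨V, hVK⟩) ≠ 0 := by
      have ht₀ : ∀ g : K, ι (t₀ g) = frame ρbar P g 0 0 + frame ρbar P g 1 1 := fun g =>
        hres.residue_t g
      have h1 : ι (offDiagonal t₀ ⟨g₁, hg₁K⟩ (a : traceRing t K) b ⟨U, hUK⟩ ⟨V, hVK⟩) =
          ι ((a : traceRing t K) - b) ^ 2 := by
        simp only [offDiagonal, map_sub, map_add, map_mul, ht₀, map_natCast, ha, hb,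
          Subgroup.coe_mul, hg₁, hU, hV, Matrix.mul_fin_two, Matrix.of_apply, Matrix.cons_val',
          Matrix.cons_val_zero, Matrix.cons_val_one, Matrix.cons_val_fin_one]
        ring
      rw [h1]
      exact pow_ne_zero 2 hab
    have hk : offDiagonal t₀ ⟨g₁, hg₁K⟩ (a : traceRing t K) b ⟨U, hUK⟩ ⟨V, hVK⟩ ≠ 0 := fun h0 =>
      hoff (by rw [h0, map_zero])
    refine ⟨hps.exists_gma hc₀ hδ htg hdg hk, fun R ρ hR hfin ht hd => ⟨?_, ⊤, top_ne_bot, ?_⟩⟩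
    · exact GMA.isClosed_range hR ((hadm.continuous_t.comp continuous_subtype_val).subtype_mk _)
        ht hd hc₀ hδ htg hdg hk
    · intro y hy _
      obtain ⟨g, hg⟩ := GMA.exists_rho_eq hι hιk (φ := (frame ρbar P).comp K.subtype)
        (fun g => ((hKmem g).mp g.2).1)
        (fun g => (hres.residue_t g).trans (Matrix.trace_fin_two _).symm)
        (fun M hM hMd => by
          obtain ⟨g, hg⟩ := IsResidual.exists_eq (φ := frame ρbar P) (p := p) hU hV hM hMd
          exact ⟨⟨g, (hKmem g).mpr (by rw [hg]; exact ⟨hM, hMd⟩)⟩, hg⟩)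
        hR ht hd hc₀ hδ htg hdg hk hy
      exact ⟨g, Units.ext hg⟩

end Large

/-! ### The main theorem -/

theorem mainTheorem11 (p : ℕ) [Fact p.Prime] (hp : p ≠ 2)
    {A : Type u} [CommRing A] [IsDomain A] [TopologicalSpace A] [IsLocalRing A]
    [IsNoetherianRing A]
    {Pi : Type v} [Group Pi] [TopologicalSpace Pi]
    (ρbar : Pi →* GL (Fin 2) (IsLocalRing.ResidueField A)) (t d : Pi → A)
    (hadm : IsAdmissible p ρbar t d)
    (hreg : IsRegularRep ρbar)
    (hred : IsReducibleRep ρbar → ¬ IsSumOfTwoCharacters t)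
    (hdih : IsDihedralRep ρbar → ∀ Pi' : Subgroup Pi, Pi'.index = 2 →
      (∀ x ∈ Pi', ∀ y ∈ Pi', ρbar x * ρbar y = ρbar y * ρbar x) →
      ¬ IsSumOfTwoCharacters (fun g : Pi' => t g))
    (hexc : ¬ IsReducibleRep ρbar → ¬ IsDihedralRep ρbar → ¬ HasLargeProjectiveImage ρbar →
      ¬ IsVirtuallyAbelian t d) :
    ∃ (A₀ : Subring A) (_ : IsLocalRing A₀) (_ : IsLocalHom A₀.subtype) (Pi₀ : Subgroup Pi),
      CompactSpace A₀ ∧ IsNoetherianRing A₀ ∧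
      IsLocalRing.maximalIdeal A₀ = (IsLocalRing.maximalIdeal A).comap A₀.subtype ∧
      IsOpen (Pi₀ : Set Pi) ∧ ρbar.ker ≤ Pi₀ ∧
      ∃ (ht : ∀ g : Pi₀, t g ∈ A₀) (hd : ∀ g : Pi₀, d g ∈ A₀),
        (∀ g : Pi₀, IsUnit (⟨d g, hd g⟩ : A₀)) ∧
        ∃ ρbar₀ : Pi₀ →* GL (Fin 2) (IsLocalRing.ResidueField A₀),
          (∃ P : GL (Fin 2) (IsLocalRing.ResidueField A), ∀ g : Pi₀,
            Matrix.GeneralLinearGroup.map (IsLocalRing.ResidueField.map A₀.subtype) (ρbar₀ g) =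
              P * ρbar g * P⁻¹) ∧
          IsAdmissible p ρbar₀ (fun g => (⟨t g, ht g⟩ : A₀)) (fun g => (⟨d g, hd g⟩ : A₀)) ∧
          HasCongruenceLargeImage (fun g : Pi₀ => (⟨t g, ht g⟩ : A₀))
            (fun g : Pi₀ => (⟨d g, hd g⟩ : A₀)) := by

  have := hadm.isTopologicalRing
  have := hadm.compactSpace_ring
  have := hadm.t2Space_ring
  have := hadm.charP_residueField
  obtain ⟨c, hc⟩ := hadm.exists_half hp
  obtain ⟨g₀, α, β, P, h⟩ := hadm.exists_isRegularElement hreg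
  obtain ⟨δ, hδ⟩ := h.exists_inv
  change HasLargeRestriction p ρbar t d
  by_cases hzero : ∀ k₁ ∈ ρbar.ker, ∀ k₂ ∈ ρbar.ker, offDiagonal t g₀ α β k₁ k₂ = 0
  · by_cases h1 : IsReducibleRep ρbar
    · exact absurd (h.isSumOfTwoCharacters hadm hc hδ hzero (MonoidHom.id Pi) continuous_id
        fun q => hadm.commute_of_isReducibleRep h1 q g₀) (hred h1)
    by_cases h2 : IsDihedralRep ρbar
    · obtain ⟨K, hK, hcomm⟩ := h.exists_index_two h2
      exact absurd (h.isSumOfTwoCharacters hadm hc hδ hzero K.subtype continuous_subtype_val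
        fun q => hcomm q q.2) (hdih h2 K hK fun x hx y hy =>
          h.commute_of_commute (hcomm x hx) (hcomm y hy))
    by_cases h3 : HasLargeProjectiveImage ρbar
    · obtain ⟨P', h', U, V, hU, hV⟩ := h.exists_unipotent h3
      -- The new basis `P'` has the same `g₀`, `α` and `β`, so `hzero` still applies.
      exact (h'.isResidual hadm hc hδ hzero hU hV).hasLargeRestriction hadm hc h' hU hV
    exact absurd (h.isVirtuallyAbelian hadm hc hδ hzero) (hexc h1 h2 h3)
  · push Not at hzero
    obtain ⟨k₁, hk₁, k₂, hk₂, hk⟩ := hzero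
    exact h.hasLargeRestriction hadm hc hk₁ hk₂ hk
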